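/- Let $X$ be a CAT(0) space. A \emph{curtain} is a set $h=h_{\alpha,r}=\pi_\alpha^{-1}(\alpha[r-\tfrac12,r+\tfrac12])$, where $\alpha:I\to X$ is a geodesic defined on a closed interval $I\subseteq\mathbf R$, $\pi_\alpha$ is the closest-point projection to $\alpha$, and $[r-\tfrac12,r+\tfrac12]$ lies in the interior of $I$. Its halfspaces are $h^-=\pi_\alpha^{-1}\alpha(I\cap(-\infty,r-\tfrac12))$ and $h^+=\pi_\alpha^{-1}\alpha(I\cap(r+\tfrac12,\infty))$; $h$ \emph{separates} two sets if they lie in opposite halfspaces of $h$. A \emph{chain} is a sequence of pairwise disjoint curtains $h_i$ such that $h_i$ separates $h_{i-1}$ from $h_{i+1}$ for all $i$. For $L\in\mathbf N=\{0,1,2,\dots\}$, two disjoint curtains are \emph{$L$-separated} if every chain all of whose elements meet both of them has cardinality at most $L$, and they are \emph{separated} if they are $L$-separated for some $L\in\mathbf N$. An \emph{$L$-chain} is a chain whose elements are pairwise $L$-separated. Let $X_L$ be the set $X$ with the metric $d_L$ given by $d_L(x,x)=0$ and, for $x\ne y$, by $$d_L(x,y)=1+\max\{|c| : c\text{ is an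 }L\text{-chain each of whose elements separates }x\text{ from }y\}.$$ An isometry $g$ of $X$ (that is, a surjective one) is \emph{semisimple} if its displacement function $x\mapsto d(x,gx)$ attains its infimum, and \emph{hyperbolic} if moreover this minimum is positive. An \emph{axis} of $g$ is a geodesic line on which $g$ acts as a nontrivial translation. A geodesic $\gamma$ is \emph{contracting} if there is $D$ such that $\operatorname{diam}\pi_\gamma(B)\le D$ for every ball $B$ disjoint from $\gamma$. The isometry $g$ is \emph{contracting} if it is hyperbolic and has a contracting axis, and \emph{rank-one} if it is hyperbolic and has an axis that does not bound an isometrically embedded Euclidean half-plane. It \emph{acts loxodromically} on $X_L$ if $n\mapsto g^nx$ is a quasi-isometric embedding $\mathbf Z\to X_L$ for some $x\in X$. It \emph{skewers} curtains $h_1,h_2$ if, perhaps after exchanging the names of the two halfspaces of $h_1$, or of $h_2$, there is $m\in\mathbf N$ with $g^mh_1^+\subsetneq h_2^+\subsetneq h_1^+$. \textbf{Theorem.} Let $g$ be a semisimple isometry of a CAT(0) space $X$. The following are equivalent. \begin{enumerate} \item $g$ is contracting. \item $g$ acts loxodromically on $X_L$ for some $L\in\mathbf N$. \item $g$ is hyperbolic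 and there exist $L,n\in\mathbf N$ such that $d_L(x,g^nx)>L+4$ for some $x$ lying in an axis of $g$. \item $g$ skewers a pair of separated curtains. \end{enumerate} If, moreover, $X$ is proper, then $g$ is contracting if and only if $g$ is rank-one (so that, for proper $X$, the conditions above are also equivalent to $g$ being rank-one). -/

import Mathlib

section CatZero

/-- `α` is a geodesic with parameter domain `I`: a unit-speed isometric embedding of `I`. -/
def IsGeodesicOn {X : Type*} [MetricSpace X] (α : ℝ → X) (I : Set ℝ) : Prop :=
  ∀ s ∈ I, ∀ t ∈ I, dist (α s) (α t) = |s - t|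

/-- A CAT(0) space: a geodesic metric space whose geodesic triangles are no fatter than their
Euclidean comparison triangles. In a geodesic space, `p` lies on a geodesic from `x` to `y`
if and only if `dist x p + dist p y = dist x y`; so in the second field `p` and `q` are arbitrary
points on two sides of a geodesic triangle with vertices `x, y, z`, the points `x', y', z'` span a
comparison triangle in the Euclidean plane, and `p'`, `q'` are the comparison points. -/
structure IsCAT0 (X : Type*) [MetricSpace X] : Prop where
  exists_geodesic : ∀ x y : X, ∃ γ : ℝ → X,
    IsGeodesicOn γ (Set.Icc 0 (dist x y)) ∧ γ 0 = x ∧ γ (dist x y) = y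
  comparison : ∀ (x y z p q : X) (x' y' z' p' q' : EuclideanSpace ℝ (Fin 2)),
    dist x' y' = dist x y → dist y' z' = dist y z → dist x' z' = dist x z →
    dist x p + dist p y = dist x y → dist x q + dist q z = dist x z →
    dist x' p' = dist x p → dist p' y' = dist p y →
    dist x' q' = dist x q → dist q' z' = dist q z →
    dist p q ≤ dist p' q'

/-- `α t` is a closest point to `x` on the geodesic `α` with domain `I`. (In a CAT(0) space, for
a nonempty closed interval `I`, there is exactly one such `t`: `α t` is the closest-point
projection of `x`.) -/
def IsFoot {X : Type*} [MetricSpace X] (α : ℝ → X) (I : Set ℝ) (x : X) (t : ℝ) : Prop :=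
  t ∈ I ∧ ∀ s ∈ I, dist x (α t) ≤ dist x (α s)

end CatZero

section Curtains

/-- The data of a curtain: a geodesic `α : I → X` on a closed interval `I`, and a number `r` with
`[r - 1/2, r + 1/2]` in the interior of `I`. -/
structure Curtain (X : Type*) [MetricSpace X] where
  I : Set ℝ
  ordConnected : I.OrdConnected
  isClosed : IsClosed I
  α : ℝ → X
  isGeodesicOn : IsGeodesicOn α I
  r : ℝ
  pole_subset : Set.Icc (r - 1 / 2) (r + 1 / 2) ⊆ interior I

namespace Curtain

variable {X : Type*} [MetricSpace X]

/-- The curtain as a set: the points projecting to the pole `α [r - 1/2, r + 1/2]`. -/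
def carrier (h : Curtain X) : Set X :=
  {x | ∃ t, IsFoot h.α h.I x t ∧ t ∈ Set.Icc (h.r - 1 / 2) (h.r + 1 / 2)}

/-- The halfspaces of a curtain: `h.side true` is `h⁺`, and `h.side false` is `h⁻`. -/
def side (h : Curtain X) : Bool → Set X
  | true => {x | ∃ t, IsFoot h.α h.I x t ∧ h.r + 1 / 2 < t}
  | false => {x | ∃ t, IsFoot h.α h.I x t ∧ t < h.r - 1 / 2}

/-- `h` separates `A` from `B`: they lie in opposite halfspaces of `h`. -/
def Separates (h : Curtain X) (A B : Set X) : Prop :=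
  ∃ ε : Bool, A ⊆ h.side ε ∧ B ⊆ h.side (!ε)

/-- Two curtains meet. -/
def Meets (h k : Curtain X) : Prop := (h.carrier ∩ k.carrier).Nonempty

end Curtain

/-- A finite chain of `n` curtains: each one separates its predecessor from its successor, and
distinct elements are disjoint (for `n ≥ 3` the latter follows from the former in CAT(0) spaces).
Its cardinality is `n`, because curtains are nonempty. -/
structure IsCurtainChain {X : Type*} [MetricSpace X] {n : ℕ} (c : Fin n → Curtain X) : Prop where
  disjoint : ∀ i j, i ≠ j → Disjoint (c i).carrier (c j).carrier
  separates : ∀ i j k : Fin n, (i : ℕ) + 1 = j → (j : ℕ) + 1 = k →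
    (c j).Separates (c i).carrier (c k).carrier

/-- `h` and `k` are `L`-separated: they are disjoint, and every chain all of whose elements meet
both of them has cardinality at most `L`. (An infinite chain contains finite chains of every
cardinality, so finite chains suffice.) -/
def IsLSeparated {X : Type*} [MetricSpace X] (L : ℕ) (h k : Curtain X) : Prop :=
  Disjoint h.carrier k.carrier ∧
    ∀ (n : ℕ) (c : Fin n → Curtain X), IsCurtainChain c →
      (∀ i, (c i).Meets h ∧ (c i).Meets k) → n ≤ L

/-- An `L`-chain: a chain whose elements are pairwise `L`-separated. -/
def IsLChain {X : Type*} [MetricSpace X] (L : ℕ) {n : ℕ} (c : Fin n → Curtain X) : Prop :=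
  IsCurtainChain c ∧ ∀ i j, i ≠ j → IsLSeparated L (c i) (c j)

open Classical in
/-- The metric `d_L` of the space `X_L`: zero on the diagonal, and otherwise one plus the maximal
cardinality of an `L`-chain separating `x` from `y`. (The set of cardinalities contains `0`, and in
a CAT(0) space it is bounded above in terms of `dist x y`, so that the supremum is a maximum.) -/
noncomputable def curtainDist {X : Type*} [MetricSpace X] (L : ℕ) (x y : X) : ℕ :=
  if x = y then 0
  else 1 + sSup {n : ℕ | ∃ c : Fin n → Curtain X,
    IsLChain L c ∧ ∀ i, (c i).Separates {x} {y}}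

end Curtains

section Isometries

variable {X : Type*} [MetricSpace X]

/-- The displacement function of `g` attains its infimum. -/
def IsSemisimpleIsometry (g : X ≃ᵢ X) : Prop :=
  ∃ x, ∀ y, dist x (g x) ≤ dist y (g y)

/-- The displacement function of `g` attains a strictly positive minimum. -/
def IsHyperbolicIsometry (g : X ≃ᵢ X) : Prop :=
  ∃ x, 0 < dist x (g x) ∧ ∀ y, dist x (g x) ≤ dist y (g y)

/-- `α` is an axis of `g`: a geodesic line that `g` translates nontrivially. -/
def IsAxis (g : X ≃ᵢ X) (α : ℝ → X) : Prop :=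
  IsGeodesicOn α Set.univ ∧ ∃ τ : ℝ, τ ≠ 0 ∧ ∀ t, g (α t) = α (t + τ)

/-- The geodesic `α` with domain `I` is `D`-contracting: the projection to `α` of every ball
disjoint from `α` has diameter at most `D`. -/
def IsContractingGeodesic (D : ℝ) (α : ℝ → X) (I : Set ℝ) : Prop :=
  ∀ (x : X) (ρ : ℝ), Disjoint (Metric.ball x ρ) (α '' I) →
    ∀ y ∈ Metric.ball x ρ, ∀ z ∈ Metric.ball x ρ, ∀ s t : ℝ,
      IsFoot α I y s → IsFoot α I z t → dist (α s) (α t) ≤ D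

/-- `g` is a contracting isometry: it is hyperbolic and has a contracting axis. -/
def IsContractingIsometry (g : X ≃ᵢ X) : Prop :=
  IsHyperbolicIsometry g ∧
    ∃ α, IsAxis g α ∧ ∃ D : ℝ, IsContractingGeodesic D α Set.univ

/-- `α` bounds a half-flat: it is the boundary line of an isometrically embedded Euclidean
half-plane `{(t, s) | 0 ≤ s}`. -/
def BoundsHalfFlat (α : ℝ → X) : Prop :=
  ∃ F : ℝ → ℝ → X, (∀ t, F t 0 = α t) ∧
    ∀ t t' s s' : ℝ, 0 ≤ s → 0 ≤ s' →
      dist (F t s) (F t' s') = Real.sqrt ((t - t') ^ 2 + (s - s') ^ 2)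

/-- `g` is rank-one: it is hyperbolic and has an axis that does not bound a half-flat. -/
def IsRankOneIsometry (g : X ≃ᵢ X) : Prop :=
  IsHyperbolicIsometry g ∧ ∃ α, IsAxis g α ∧ ¬ BoundsHalfFlat α

/-- `g` acts loxodromically on `X_L = (X, d_L)`: an orbit map `n ↦ g ^ n x` is a quasi-isometric
embedding of `ℤ` into `X_L`. -/
def ActsLoxodromically (L : ℕ) (g : X ≃ᵢ X) : Prop :=
  ∃ x : X, ∃ K C : ℝ, 1 ≤ K ∧ 0 ≤ C ∧ ∀ m n : ℤ,
    |(m : ℝ) - n| / K - C ≤ (curtainDist L ((g ^ m) x) ((g ^ n) x) : ℝ) ∧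
    (curtainDist L ((g ^ m) x) ((g ^ n) x) : ℝ) ≤ K * |(m : ℝ) - n| + C

/-- `g` skewers `h₁, h₂`: up to flipping the curtains, that is, choosing which of the halfspaces of
`h₁` and which of those of `h₂` is called positive, `g ^ m h₁⁺ ⊊ h₂⁺ ⊊ h₁⁺` for some `m`. -/
def Skewers (g : X ≃ᵢ X) (h₁ h₂ : Curtain X) : Prop :=
  ∃ (ε₁ ε₂ : Bool) (m : ℕ),
    (g ^ m) '' h₁.side ε₁ ⊂ h₂.side ε₂ ∧ h₂.side ε₂ ⊂ h₁.side ε₁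

end Isometries

/-! ### Distance inequalities in CAT(0) spaces -/

/-! The four conditions are tied together by one property of an axis, `HasSeparatedDuals`: two
curtains dual to it are `L`-separated, for a fixed `L`, once they are far enough apart. The cycle
proved is 1 → 4 → 2 → 3 → 1.

If a line is contracting, a geodesic whose projection travels far along it passes close to it
(`IsContractingGeodesic.exists_near`). A curtain meeting two distant dual curtains therefore comes
near a bounded piece of the line, and only boundedly many members of a chain can do so, because
crossing a curtain costs unit length. Hence dual curtains are separated, and a power of `g` skewers
two of them. If `g` skewers a separated pair, the translates of one curtain form arbitrarily long
`L`-chains, so orbits escape linearly in `X_L`. Such a semisimple `g` has no fixed point, hence has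
an axis.

Conversely, let an `L`-chain of at least `L + 4` curtains cross an axis. Two `L`-separated curtains
cannot both meet `L + 1` dual curtains, so a late member of the chain lies behind all dual curtains
far ahead, and an early member ahead of all those far behind (`exists_right_bound`). These two
members separate the dual curtains, and periodicity makes this uniform. Separated duals give
contraction by a bottleneck argument: if a point `p` between `x` and `y` is far from the line, the
curtains dual to the perpendicular from the line to `p` meet both the dual curtain through `p` and
the one through `x` or `y` (`dist_foot_le_of_separated`).

Half-flats are visibly not contracting. In a proper space, suppose that distances to an axis do not
grow linearly away from the feet of projections. Then a limit of points yields a horofunction on the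
axis with asymptotic slope at most one half; translating back by powers of `g` makes it linear, and
the geodesics towards its centre span a half-flat. Linear divergence, on the other hand, shows that
points with distant feet are at distance at least a quarter of the sum of their heights over the
line, which implies contraction (`exists_isContractingGeodesic_of_fraction`). -/

lemma exists_planar_vectors {a b l : ℝ} (ha : 0 ≤ a) (hb : 0 ≤ b)
    (h1 : a ≤ b + l) (h2 : b ≤ a + l) (h3 : l ≤ a + b) :
    ∃ v w : EuclideanSpace ℝ (Fin 2), ‖v‖ = a ∧ ‖w‖ = b ∧
      inner ℝ v w = (a ^ 2 + b ^ 2 - l ^ 2) / 2 := by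
  rcases ha.eq_or_lt with rfl | ha'
  · have : l = b := by linarith
    subst this
    refine ⟨0, !₂[l, 0], by simp, ?_, by simp⟩
    simp [EuclideanSpace.norm_eq, Fin.sum_univ_two, Real.sqrt_sq hb]
  -- Law of cosines: `c` is the coordinate of the second vector along the first. The division by `a`
  -- is why `a = 0` is split off.
  · set c := (a ^ 2 + b ^ 2 - l ^ 2) / (2 * a) with hc
    have hc' : c * (2 * a) = a ^ 2 + b ^ 2 - l ^ 2 := by rw [hc]; field_simp
    have hcb : c ^ 2 ≤ b ^ 2 := by
      apply sq_le_sq'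
      · have : 0 ≤ (c + b) * (2 * a) := by nlinarith
        have := nonneg_of_mul_nonneg_left this (by positivity)
        linarith
      · have : 0 ≤ (b - c) * (2 * a) := by nlinarith
        have := nonneg_of_mul_nonneg_left this (by positivity)
        linarith
    refine ⟨!₂[a, 0], !₂[c, Real.sqrt (b ^ 2 - c ^ 2)], ?_, ?_, ?_⟩
    · simp [EuclideanSpace.norm_eq, Fin.sum_univ_two, Real.sqrt_sq ha]
    · rw [EuclideanSpace.norm_eq]
      simp [Fin.sum_univ_two, Real.sq_sqrt (sub_nonneg.2 hcb), Real.sqrt_sq hb]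
    · simp [PiLp.inner_apply, Fin.sum_univ_two]
      linarith

namespace IsCAT0

variable {X : Type*} [MetricSpace X]

/-- The comparison inequality for points on two sides of a triangle, in coordinates. -/
lemma sq_dist_le_of_sides (hX : IsCAT0 X) {x y z p q : X} {u v : ℝ}
    (hu0 : 0 ≤ u) (hu1 : u ≤ 1) (hv0 : 0 ≤ v) (hv1 : v ≤ 1)
    (hp : dist x p = u * dist x y) (hp' : dist p y = (1 - u) * dist x y)
    (hq : dist x q = v * dist x z) (hq' : dist q z = (1 - v) * dist x z) :
    dist p q ^ 2 ≤ u ^ 2 * dist x y ^ 2 + v ^ 2 * dist x z ^ 2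
      - u * v * (dist x y ^ 2 + dist x z ^ 2 - dist y z ^ 2) := by
  obtain ⟨a, b, ha, hb, hab⟩ := exists_planar_vectors (a := dist x y) (b := dist x z)
    (l := dist y z) dist_nonneg dist_nonneg
    (by linarith [dist_triangle x z y, dist_comm y z]) (dist_triangle x y z)
    (by linarith [dist_triangle y x z, dist_comm x y])
  have hyz : ‖a - b‖ = dist y z := by
    have h : ‖a - b‖ ^ 2 = dist y z ^ 2 := by
      rw [norm_sub_sq_real, ha, hb, hab]; ring
    exact (pow_left_inj₀ (norm_nonneg _) dist_nonneg two_ne_zero).1 h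
  have key := hX.comparison x y z p q 0 a b (u • a) (v • b)
    (by rw [dist_zero_left, ha]) (by rw [dist_eq_norm, hyz]) (by rw [dist_zero_left, hb])
    (by rw [hp, hp']; ring) (by rw [hq, hq']; ring)
    (by rw [dist_zero_left, norm_smul, Real.norm_of_nonneg hu0, ha, hp])
    (by
      have : u • a - a = -((1 - u) • a) := by module
      rw [dist_eq_norm, this, norm_neg, norm_smul, Real.norm_of_nonneg (by linarith), ha, hp'])
    (by rw [dist_zero_left, norm_smul, Real.norm_of_nonneg hv0, hb, hq])
    (by
      have : v • b - b = -((1 - v) • b) := by module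
      rw [dist_eq_norm, this, norm_neg, norm_smul, Real.norm_of_nonneg (by linarith), hb, hq'])
  calc dist p q ^ 2 ≤ dist (u • a) (v • b) ^ 2 := by gcongr
    _ = _ := by
      rw [dist_eq_norm, norm_sub_sq_real, norm_smul, norm_smul, Real.norm_of_nonneg hu0,
        Real.norm_of_nonneg hv0, ha, hb, real_inner_smul_left, real_inner_smul_right, hab]
      ring

/-- The inequality of Bruhat and Tits. -/
lemma sq_dist_le (hX : IsCAT0 X) {x y p : X} (z : X) {u : ℝ}
    (hu0 : 0 ≤ u) (hu1 : u ≤ 1)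
    (hp : dist x p = u * dist x y) (hp' : dist p y = (1 - u) * dist x y) :
    dist p z ^ 2 ≤ (1 - u) * dist x z ^ 2 + u * dist y z ^ 2 - u * (1 - u) * dist x y ^ 2 := by
  have := hX.sq_dist_le_of_sides (z := z) (q := z) hu0 hu1 zero_le_one le_rfl hp hp'
    (by ring) (by simp)
  linarith

/-- The Bruhat–Tits bound is stronger: the square of `(1 - u) a + u b` is `(1 - u) a² + u b² - u (1
- u) (a - b)²`, and `|a - b| ≤ dist x y` when `a`, `b` are the distances to `z`. -/
lemma dist_le_of_between (hX : IsCAT0 X) {x y p : X} (z : X) {u : ℝ}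
    (hu0 : 0 ≤ u) (hu1 : u ≤ 1)
    (hp : dist x p = u * dist x y) (hp' : dist p y = (1 - u) * dist x y) :
    dist p z ≤ (1 - u) * dist x z + u * dist y z := by
  have h := hX.sq_dist_le z hu0 hu1 hp hp'
  have h1 : |dist x z - dist y z| ≤ dist x y := abs_dist_sub_le x y z
  have h2 : (dist x z - dist y z) ^ 2 ≤ dist x y ^ 2 := by
    rw [← sq_abs]; gcongr
  have h3 : 0 ≤ u * (1 - u) := mul_nonneg hu0 (by linarith)
  have h4 := dist_nonneg (x := x) (y := z)
  have h5 := dist_nonneg (x := y) (y := z)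
  refine abs_le_of_sq_le_sq' ?_ (add_nonneg (mul_nonneg (by linarith) h4) (mul_nonneg hu0 h5)) |>.2
  nlinarith [mul_le_mul_of_nonneg_left h2 h3]

/-- Points on two sides of a triangle, at the same fraction from the common vertex. -/
lemma dist_le_mul_of_sides (hX : IsCAT0 X) {x y z p q : X} {u : ℝ}
    (hu0 : 0 ≤ u) (hu1 : u ≤ 1)
    (hp : dist x p = u * dist x y) (hp' : dist p y = (1 - u) * dist x y)
    (hq : dist x q = u * dist x z) (hq' : dist q z = (1 - u) * dist x z) :
    dist p q ≤ u * dist y z := by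
  have := hX.sq_dist_le_of_sides hu0 hu1 hu0 hu1 hp hp' hq hq'
  refine abs_le_of_sq_le_sq' ?_ (mul_nonneg hu0 dist_nonneg) |>.2
  nlinarith

/-- A point dividing a geodesic segment in a given ratio. -/
lemma exists_between (hX : IsCAT0 X) (x y : X) {u : ℝ} (hu0 : 0 ≤ u) (hu1 : u ≤ 1) :
    ∃ p, dist x p = u * dist x y ∧ dist p y = (1 - u) * dist x y := by
  obtain ⟨γ, hγ, h0, h1⟩ := hX.exists_geodesic x y
  have hd := dist_nonneg (x := x) (y := y)
  have hm : u * dist x y ∈ Set.Icc 0 (dist x y) := ⟨by positivity, by nlinarith⟩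
  refine ⟨γ (u * dist x y), ?_, ?_⟩
  · have := hγ 0 ⟨le_rfl, hd⟩ _ hm
    rw [h0, zero_sub, abs_neg, abs_of_nonneg hm.1] at this
    exact this
  · have := hγ _ hm (dist x y) ⟨hd, le_rfl⟩
    rw [h1, abs_sub_comm, abs_of_nonneg (by linarith [hm.2])] at this
    rw [this]; ring

/-- Reshetnyak's quadrilateral inequality. -/
lemma quadrilateral (hX : IsCAT0 X) (x y p q : X) :
    dist x q ^ 2 + dist y p ^ 2 ≤
      dist x p ^ 2 + dist y q ^ 2 + 2 * dist x y * dist p q := by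
  rcases eq_or_ne x y with rfl | hxy
  · simp [add_comm]
  rcases eq_or_ne p q with rfl | hpq
  · simp
  have h1 : 0 < dist x y := dist_pos.2 hxy
  have h2 : 0 < dist p q := dist_pos.2 hpq
  set A := dist x y with hA
  set B := dist p q with hB
  -- The diagonal from `x` to `q` is cut in the ratio `A : B`, which turns the error term `(1 - s)²
  -- A² + s² B²` into `2 s (1 - s) A B`.
  have hs0 : 0 < A / (A + B) := by positivity
  set s := A / (A + B) with hs
  have hs1 : 1 - s = B / (A + B) := by rw [hs]; field_simp; ring
  have hs1' : 0 < 1 - s := by rw [hs1]; positivity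
  obtain ⟨m, hm, hm'⟩ := hX.exists_between x q hs0.le (by linarith)
  have e1 := hX.sq_dist_le y hs0.le (by linarith) hm hm'
  have e2 := hX.sq_dist_le p hs0.le (by linarith) hm hm'
  have e3 : dist y p ≤ dist m y + dist m p := by
    rw [dist_comm m y]; exact dist_triangle y m p
  have e4 : s * (1 - s) * dist y p ^ 2 ≤ (1 - s) * dist m y ^ 2 + s * dist m p ^ 2 := by
    have : dist y p ^ 2 ≤ (dist m y + dist m p) ^ 2 := by gcongr
    have h3 : 0 ≤ s * (1 - s) := by positivity
    nlinarith [sq_nonneg ((1 - s) * dist m y - s * dist m p), mul_le_mul_of_nonneg_left this h3]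
  rw [dist_comm q y, dist_comm q p, ← hB] at *
  rw [← hA] at e1
  have e5 : s * (1 - s) * (dist x q ^ 2 + dist y p ^ 2) ≤
      s * (1 - s) * (dist x p ^ 2 + dist y q ^ 2) + (1 - s) ^ 2 * A ^ 2 + s ^ 2 * B ^ 2 := by
    nlinarith [mul_le_mul_of_nonneg_left e1 hs1'.le, mul_le_mul_of_nonneg_left e2 hs0.le]
  have e6 : (1 - s) ^ 2 * A ^ 2 + s ^ 2 * B ^ 2 = s * (1 - s) * (2 * A * B) := by
    rw [hs1, hs]; field_simp; ring
  have h3 : 0 < s * (1 - s) := by positivity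
  rw [add_assoc, e6, ← mul_add] at e5
  exact le_of_mul_le_mul_left e5 h3

end IsCAT0

/-! ### Projection to a geodesic -/

/-- A geodesic whose domain is a nonempty closed interval. -/
structure IsClosedGeodesic {X : Type*} [MetricSpace X] (α : ℝ → X) (I : Set ℝ) : Prop where
  geodesic : IsGeodesicOn α I
  closed : IsClosed I
  ordConnected : I.OrdConnected
  nonempty : I.Nonempty

/-- The parameter of the closest-point projection of `x` to the geodesic `α` with domain `I`. -/
noncomputable def footParam {X : Type*} [MetricSpace X] (α : ℝ → X) (I : Set ℝ) (x : X) : ℝ :=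
  Classical.epsilon (IsFoot α I x)

section Foot

variable {X : Type*} [MetricSpace X] {α : ℝ → X} {I : Set ℝ}

lemma IsGeodesicOn.mono {J : Set ℝ} (h : IsGeodesicOn α I) (hJ : J ⊆ I) : IsGeodesicOn α J :=
  fun s hs t ht => h s (hJ hs) t (hJ ht)

lemma IsGeodesicOn.continuousOn (h : IsGeodesicOn α I) : ContinuousOn α I := by
  have : LipschitzOnWith 1 α I := LipschitzOnWith.of_dist_le_mul fun s hs t ht => by
    rw [h s hs t ht, Real.dist_eq]; simp
  exact this.continuousOn

/-- Geodesic segments, parametrized by arc length. -/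
lemma IsCAT0.exists_segment (hX : IsCAT0 X) (x y : X) : ∃ γ : ℝ → X,
    IsClosedGeodesic γ (Set.Icc 0 (dist x y)) ∧ γ 0 = x ∧ γ (dist x y) = y := by
  obtain ⟨γ, h, h0, h1⟩ := hX.exists_geodesic x y
  exact ⟨γ, ⟨h, isClosed_Icc, Set.ordConnected_Icc, ⟨0, le_rfl, dist_nonneg⟩⟩, h0, h1⟩

lemma IsGeodesicOn.dist_convexComb (h : IsGeodesicOn α I) {s t u : ℝ} (hs : s ∈ I) (ht : t ∈ I)
    (hu0 : 0 ≤ u) (hu1 : u ≤ 1) (hw : (1 - u) * s + u * t ∈ I) :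
    dist (α s) (α ((1 - u) * s + u * t)) = u * dist (α s) (α t) ∧
      dist (α ((1 - u) * s + u * t)) (α t) = (1 - u) * dist (α s) (α t) := by
  rw [h s hs _ hw, h _ hw t ht, h s hs t ht]
  constructor
  · rw [show s - ((1 - u) * s + u * t) = u * (s - t) by ring, abs_mul, abs_of_nonneg hu0]
  · rw [show (1 - u) * s + u * t - t = (1 - u) * (s - t) by ring, abs_mul,
      abs_of_nonneg (by linarith : 0 ≤ 1 - u)]

lemma IsGeodesicOn.sq_dist_le (h : IsGeodesicOn α I) (hX : IsCAT0 X) (z : X) {s t u : ℝ}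
    (hs : s ∈ I) (ht : t ∈ I) (hu0 : 0 ≤ u) (hu1 : u ≤ 1) (hw : (1 - u) * s + u * t ∈ I) :
    dist z (α ((1 - u) * s + u * t)) ^ 2 ≤
      (1 - u) * dist z (α s) ^ 2 + u * dist z (α t) ^ 2 - u * (1 - u) * (s - t) ^ 2 := by
  obtain ⟨h1, h2⟩ := h.dist_convexComb hs ht hu0 hu1 hw
  have := hX.sq_dist_le z hu0 hu1 h1 h2
  rwa [h s hs t ht, sq_abs, dist_comm _ z, dist_comm _ z, dist_comm _ z] at this

lemma IsGeodesicOn.dist_le_convexComb (h : IsGeodesicOn α I) (hX : IsCAT0 X) (z : X) {s t u : ℝ}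
    (hs : s ∈ I) (ht : t ∈ I) (hu0 : 0 ≤ u) (hu1 : u ≤ 1) (hw : (1 - u) * s + u * t ∈ I) :
    dist z (α ((1 - u) * s + u * t)) ≤ (1 - u) * dist z (α s) + u * dist z (α t) := by
  obtain ⟨h1, h2⟩ := h.dist_convexComb hs ht hu0 hu1 hw
  have := hX.dist_le_of_between z hu0 hu1 h1 h2
  rwa [dist_comm _ z, dist_comm _ z, dist_comm _ z] at this

namespace IsClosedGeodesic

lemma convexComb_mem (hα : IsClosedGeodesic α I) {s t u : ℝ} (hs : s ∈ I) (ht : t ∈ I)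
    (hu0 : 0 ≤ u) (hu1 : u ≤ 1) : (1 - u) * s + u * t ∈ I := by
  have := hα.ordConnected.convex hs ht (a := 1 - u) (b := u) (by linarith) hu0 (by ring)
  simpa using this

lemma exists_isFoot (hα : IsClosedGeodesic α I) (x : X) : ∃ t, IsFoot α I x t := by
  obtain ⟨s₀, hs₀⟩ := hα.nonempty
  -- Parameters further than `R` from `s₀` give points no closer to `x` than `α s₀`, so a compact
  -- part of `I` suffices and `X` need not be proper.
  set R := 2 * dist x (α s₀)
  have hR : 0 ≤ R := by positivity
  have hK : IsCompact (I ∩ Set.Icc (s₀ - R) (s₀ + R)) := isCompact_Icc.inter_left hα.closed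
  obtain ⟨t, ht, hmin⟩ := hK.exists_isMinOn (f := fun s => dist x (α s))
    ⟨s₀, hs₀, by linarith, by linarith⟩
    (((continuous_const.dist continuous_id).comp_continuousOn hα.geodesic.continuousOn).mono Set.inter_subset_left)
  refine ⟨t, ht.1, fun s hs => ?_⟩
  by_cases h : s ∈ Set.Icc (s₀ - R) (s₀ + R)
  · exact hmin ⟨hs, h⟩
  · have h1 : R < |s - s₀| := by
      by_contra! h2
      rw [abs_le] at h2
      exact h ⟨by linarith [h2.1], by linarith [h2.2]⟩
    have h2 : dist x (α t) ≤ dist x (α s₀) := hmin ⟨hs₀, by linarith, by linarith⟩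
    have h3 := hα.geodesic s hs s₀ hs₀
    have h4 := dist_triangle_left (α s) (α s₀) x
    have h5 : R = 2 * dist x (α s₀) := rfl
    linarith

lemma isFoot_footParam (hα : IsClosedGeodesic α I) (x : X) : IsFoot α I x (footParam α I x) :=
  Classical.epsilon_spec (hα.exists_isFoot x)

lemma footParam_mem (hα : IsClosedGeodesic α I) (x : X) : footParam α I x ∈ I :=
  (hα.isFoot_footParam x).1

/-- The angle at a foot is at least a right angle. Moving from the foot by a fraction `u` towards `α
s` does not decrease the distance to `x`; compare with the Bruhat–Tits bound, divide by `u` and let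
`u` tend to zero. -/
lemma sq_dist_ge_of_isFoot (hα : IsClosedGeodesic α I) (hX : IsCAT0 X) {x : X} {s t : ℝ}
    (ht : IsFoot α I x t) (hs : s ∈ I) :
    dist x (α t) ^ 2 + (s - t) ^ 2 ≤ dist x (α s) ^ 2 := by
  have key : ∀ u : ℝ, 0 < u → u ≤ 1 →
      dist x (α t) ^ 2 + (1 - u) * (s - t) ^ 2 ≤ dist x (α s) ^ 2 := by
    intro u hu0 hu1
    have hw := hα.convexComb_mem ht.1 hs hu0.le hu1
    have h1 := hα.geodesic.sq_dist_le hX x ht.1 hs hu0.le hu1 hw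
    have h2 : dist x (α t) ^ 2 ≤ dist x (α ((1 - u) * t + u * s)) ^ 2 := by
      have := ht.2 _ hw
      gcongr
    have h3 : u * (dist x (α t) ^ 2 + (1 - u) * (s - t) ^ 2) ≤ u * dist x (α s) ^ 2 := by
      nlinarith
    exact le_of_mul_le_mul_left h3 hu0
  refine le_of_forall_pos_le_add fun ε hε => ?_
  have hC : 0 ≤ (s - t) ^ 2 := sq_nonneg _
  have h1 := key (ε / ((s - t) ^ 2 + ε)) (by positivity)
    ((div_le_one (by positivity)).2 (by linarith))
  have h2 : ε / ((s - t) ^ 2 + ε) * (s - t) ^ 2 ≤ ε := by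
    rw [div_mul_eq_mul_div, div_le_iff₀ (by positivity)]
    nlinarith
  linarith

lemma footParam_eq (hα : IsClosedGeodesic α I) (hX : IsCAT0 X) {x : X} {t : ℝ}
    (ht : IsFoot α I x t) : footParam α I x = t := by
  have h1 := hα.sq_dist_ge_of_isFoot hX ht (hα.footParam_mem x)
  have h2 : dist x (α (footParam α I x)) ^ 2 ≤ dist x (α t) ^ 2 := by
    have := (hα.isFoot_footParam x).2 t ht.1
    gcongr
  have : (footParam α I x - t) ^ 2 ≤ 0 := by linarith
  nlinarith [sq_nonneg (footParam α I x - t), pow_eq_zero_iff (two_ne_zero) |>.1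
    (le_antisymm this (sq_nonneg _))]

lemma isFoot_iff (hα : IsClosedGeodesic α I) (hX : IsCAT0 X) {x : X} {t : ℝ} :
    IsFoot α I x t ↔ footParam α I x = t :=
  ⟨hα.footParam_eq hX, fun h => h ▸ hα.isFoot_footParam x⟩

lemma footParam_apply (hα : IsClosedGeodesic α I) (hX : IsCAT0 X) {t : ℝ} (ht : t ∈ I) :
    footParam α I (α t) = t :=
  hα.footParam_eq hX ⟨ht, fun s _ => by simp⟩

lemma sq_dist_ge (hα : IsClosedGeodesic α I) (hX : IsCAT0 X) (x : X) {s : ℝ} (hs : s ∈ I) :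
    dist x (α (footParam α I x)) ^ 2 + (s - footParam α I x) ^ 2 ≤ dist x (α s) ^ 2 :=
  hα.sq_dist_ge_of_isFoot hX (hα.isFoot_footParam x) hs

lemma dist_foot_le (hα : IsClosedGeodesic α I) (x : X) {s : ℝ} (hs : s ∈ I) :
    dist x (α (footParam α I x)) ≤ dist x (α s) := (hα.isFoot_footParam x).2 s hs

/-- Adding the Pythagorean inequalities at the two feet to the quadrilateral inequality cancels the
heights and leaves `|a - b|² ≤ dist x y * |a - b|`. -/
lemma abs_footParam_sub_le (hα : IsClosedGeodesic α I) (hX : IsCAT0 X) (x y : X) :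
    |footParam α I x - footParam α I y| ≤ dist x y := by
  have hx := hα.footParam_mem x
  have hy := hα.footParam_mem y
  have h1 := hX.quadrilateral x y (α (footParam α I x)) (α (footParam α I y))
  have h2 := hα.sq_dist_ge hX x hy
  have h3 := hα.sq_dist_ge hX y hx
  rw [hα.geodesic _ hx _ hy] at h1
  set a := footParam α I x
  set b := footParam α I y
  have h4 : |a - b| ^ 2 ≤ dist x y * |a - b| := by
    rw [sq_abs]; nlinarith
  rcases (abs_nonneg (a - b)).eq_or_lt with h | h
  · rw [← h]; exact dist_nonneg
  · rw [sq] at h4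
    exact le_of_mul_le_mul_right h4 h

lemma continuous_footParam (hα : IsClosedGeodesic α I) (hX : IsCAT0 X) :
    Continuous (footParam α I) :=
  (LipschitzWith.of_dist_le_mul (K := 1) fun x y => by
    simpa [Real.dist_eq] using hα.abs_footParam_sub_le hX x y).continuous

lemma footParam_of_between (hα : IsClosedGeodesic α I) (hX : IsCAT0 X) {x p : X}
    (hp : dist x p + dist p (α (footParam α I x)) = dist x (α (footParam α I x))) :
    footParam α I p = footParam α I x :=
  hα.footParam_eq hX ⟨hα.footParam_mem x, fun s hs => by
    linarith [hα.dist_foot_le x hs, dist_triangle x p (α s)]⟩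

/-- The distance to a geodesic is 1-Lipschitz. -/
lemma dist_foot_le_add (hα : IsClosedGeodesic α I) (x y : X) :
    dist x (α (footParam α I x)) ≤ dist x y + dist y (α (footParam α I y)) :=
  (hα.dist_foot_le x (hα.footParam_mem y)).trans (dist_triangle _ _ _)

lemma abs_dist_foot_sub_le (hα : IsClosedGeodesic α I) (x y : X) :
    |dist x (α (footParam α I x)) - dist y (α (footParam α I y))| ≤ dist x y := by
  have h1 := hα.dist_foot_le_add x y
  have h2 := hα.dist_foot_le_add y x
  rw [dist_comm y x] at h2
  rw [abs_le]; constructor <;> linarith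

lemma continuous_dist_foot (hα : IsClosedGeodesic α I) :
    Continuous fun x => dist x (α (footParam α I x)) :=
  (LipschitzWith.of_dist_le_mul (K := 1) fun x y => by
    simpa [Real.dist_eq] using hα.abs_dist_foot_sub_le x y).continuous

/-- The preimage of an interval under the projection to a geodesic is connected. -/
lemma isPreconnected_preimage (hα : IsClosedGeodesic α I) (hX : IsCAT0 X) {S : Set ℝ}
    (hS : S.OrdConnected) : IsPreconnected (footParam α I ⁻¹' S) := by
  -- Each point is joined to its foot inside its own fibre of the projection; two feet are joined
  -- along `α`.
  have leg : ∀ x, ∃ t ⊆ footParam α I ⁻¹' {footParam α I x}, x ∈ t ∧ α (footParam α I x) ∈ t ∧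
      IsPreconnected t := by
    intro x
    obtain ⟨γ, hγ, h0, h1⟩ := hX.exists_segment x (α (footParam α I x))
    refine ⟨γ '' Set.Icc 0 (dist x (α (footParam α I x))), ?_, ⟨0, ⟨le_rfl, dist_nonneg⟩, h0⟩,
      ⟨_, ⟨dist_nonneg, le_rfl⟩, h1⟩, isPreconnected_Icc.image _ hγ.geodesic.continuousOn⟩
    rintro _ ⟨s, hs, rfl⟩
    refine hα.footParam_of_between hX ?_
    have e1 := hγ.geodesic 0 ⟨le_rfl, dist_nonneg⟩ s hs
    have e2 := hγ.geodesic s hs _ ⟨dist_nonneg, le_rfl⟩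
    rw [h0, zero_sub, abs_neg, abs_of_nonneg hs.1] at e1
    rw [h1, abs_sub_comm, abs_of_nonneg (by linarith [hs.2])] at e2
    rw [e1, e2]; ring
  refine isPreconnected_of_forall_pair fun x hx y hy => ?_
  obtain ⟨t₁, ht₁, hx₁, hx₁', hc₁⟩ := leg x
  obtain ⟨t₂, ht₂, hy₂, hy₂', hc₂⟩ := leg y
  have hsub : Set.uIcc (footParam α I x) (footParam α I y) ⊆ S ∩ I :=
    (hS.inter hα.ordConnected).uIcc_subset ⟨hx, hα.footParam_mem x⟩ ⟨hy, hα.footParam_mem y⟩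
  have hc : IsPreconnected (α '' Set.uIcc (footParam α I x) (footParam α I y)) :=
    isPreconnected_uIcc.image _
      (hα.geodesic.continuousOn.mono fun s hs => (hsub hs).2)
  refine ⟨t₁ ∪ α '' Set.uIcc (footParam α I x) (footParam α I y) ∪ t₂, ?_, Or.inl (Or.inl hx₁),
    Or.inr hy₂, ?_⟩
  · rintro z ((hz | ⟨s, hs, rfl⟩) | hz)
    · rw [Set.mem_preimage, show footParam α I z = footParam α I x from ht₁ hz]; exact hx
    · rw [Set.mem_preimage, hα.footParam_apply hX (hsub hs).2]; exact (hsub hs).1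
    · rw [Set.mem_preimage, show footParam α I z = footParam α I y from ht₂ hz]; exact hy
  · exact IsPreconnected.union (α (footParam α I y))
      (Or.inr ⟨_, Set.right_mem_uIcc, rfl⟩) hy₂'
      (IsPreconnected.union (α (footParam α I x)) hx₁' ⟨_, Set.left_mem_uIcc, rfl⟩ hc₁ hc) hc₂

end IsClosedGeodesic

end Foot

/-! ### Curtains and chains -/

/-- A continuous function crossing `[p, q]` has a subinterval on which it stays in `[p, q]`,
and whose endpoints it sends to `p` and `q`. -/
lemma exists_crossing_interval {f : ℝ → ℝ} {a b p q : ℝ} (hab : a ≤ b)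
    (hf : ContinuousOn f (Set.Icc a b)) (ha : f a ≤ p) (hb : q ≤ f b) (hpq : p ≤ q) :
    ∃ s t, a ≤ s ∧ s ≤ t ∧ t ≤ b ∧ f s = p ∧ f t = q ∧ ∀ u ∈ Set.Icc s t, f u ∈ Set.Icc p q := by
  have hK : IsCompact (Set.Icc a b ∩ f ⁻¹' Set.Iic p) :=
    isCompact_Icc.of_isClosed_subset (hf.preimage_isClosed_of_isClosed isClosed_Icc isClosed_Iic)
      Set.inter_subset_left
  obtain ⟨s, ⟨hs, hsp⟩, hsmax⟩ := hK.exists_isGreatest ⟨a, ⟨le_rfl, hab⟩, ha⟩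
  have hf' : ContinuousOn f (Set.Icc s b) := hf.mono (Set.Icc_subset_Icc_left hs.1)
  have hfs : f s = p := by
    obtain ⟨u, hu, hup⟩ := intermediate_value_Icc hs.2 hf' ⟨hsp, hpq.trans hb⟩
    have : u ≤ s := hsmax ⟨⟨hs.1.trans hu.1, hu.2⟩, hup.le⟩
    rwa [le_antisymm this hu.1] at hup
  have hK' : IsCompact (Set.Icc s b ∩ f ⁻¹' Set.Ici q) :=
    isCompact_Icc.of_isClosed_subset (hf'.preimage_isClosed_of_isClosed isClosed_Icc isClosed_Ici)
      Set.inter_subset_left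
  obtain ⟨t, ⟨ht, htq⟩, htmin⟩ := hK'.exists_isLeast ⟨b, ⟨hs.2, le_rfl⟩, hb⟩
  have hft : f t = q := by
    obtain ⟨u, hu, huq⟩ := intermediate_value_Icc ht.1
      (hf'.mono (Set.Icc_subset_Icc_right ht.2)) ⟨hfs.le.trans hpq, htq⟩
    have : t ≤ u := htmin ⟨⟨hu.1, hu.2.trans ht.2⟩, huq.ge⟩
    rwa [le_antisymm hu.2 this] at huq
  refine ⟨s, t, hs.1, ht.1, ht.2, hfs, hft, fun u hu => ⟨?_, ?_⟩⟩
  · by_contra! h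
    have : u ≤ s := hsmax ⟨⟨hs.1.trans hu.1, hu.2.trans ht.2⟩, h.le⟩
    rw [le_antisymm this hu.1, hfs] at h
    exact lt_irrefl _ h
  · by_contra! h
    have : t ≤ u := htmin ⟨⟨hu.1, hu.2.trans ht.2⟩, h.le⟩
    rw [le_antisymm hu.2 this, hft] at h
    exact lt_irrefl _ h

namespace Curtain

variable {X : Type*} [MetricSpace X]

/-- The parameter of the projection to the geodesic defining a curtain. -/
noncomputable def proj (h : Curtain X) (x : X) : ℝ := footParam h.α h.I x

lemma Icc_subset (h : Curtain X) : Set.Icc (h.r - 1 / 2) (h.r + 1 / 2) ⊆ h.I :=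
  h.pole_subset.trans interior_subset

lemma isClosedGeodesic (h : Curtain X) : IsClosedGeodesic h.α h.I :=
  ⟨h.isGeodesicOn, h.isClosed, h.ordConnected,
    ⟨h.r, h.Icc_subset ⟨by linarith, by linarith⟩⟩⟩

lemma mem_carrier (h : Curtain X) (hX : IsCAT0 X) {x : X} :
    x ∈ h.carrier ↔ h.proj x ∈ Set.Icc (h.r - 1 / 2) (h.r + 1 / 2) := by
  simp only [carrier, Set.mem_ofPred_eq, h.isClosedGeodesic.isFoot_iff hX]
  exact ⟨fun ⟨t, ht, h'⟩ => by rwa [← ht] at h', fun h' => ⟨_, rfl, h'⟩⟩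

lemma mem_side_true (h : Curtain X) (hX : IsCAT0 X) {x : X} :
    x ∈ h.side true ↔ h.r + 1 / 2 < h.proj x := by
  simp only [side, Set.mem_ofPred_eq, h.isClosedGeodesic.isFoot_iff hX]
  exact ⟨fun ⟨t, ht, h'⟩ => by rwa [← ht] at h', fun h' => ⟨_, rfl, h'⟩⟩

lemma mem_side_false (h : Curtain X) (hX : IsCAT0 X) {x : X} :
    x ∈ h.side false ↔ h.proj x < h.r - 1 / 2 := by
  simp only [side, Set.mem_ofPred_eq, h.isClosedGeodesic.isFoot_iff hX]
  exact ⟨fun ⟨t, ht, h'⟩ => by rwa [← ht] at h', fun h' => ⟨_, rfl, h'⟩⟩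

lemma notMem_carrier_of_mem_side (h : Curtain X) (hX : IsCAT0 X) {ε : Bool} {x : X}
    (hx : x ∈ h.side ε) : x ∉ h.carrier := by
  rw [h.mem_carrier hX]
  rintro ⟨h1, h2⟩
  cases ε
  · rw [h.mem_side_false hX] at hx; linarith
  · rw [h.mem_side_true hX] at hx; linarith

lemma notMem_side_not (h : Curtain X) (hX : IsCAT0 X) {ε : Bool} {x : X}
    (hx : x ∈ h.side ε) : x ∉ h.side (!ε) := by
  intro hx'
  cases ε <;> simp only [Bool.not_true, Bool.not_false, h.mem_side_false hX,
    h.mem_side_true hX] at hx hx' <;> linarith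

lemma mem_side_not (h : Curtain X) (hX : IsCAT0 X) {ε : Bool} {x : X}
    (hx : x ∉ h.carrier) (hx' : x ∉ h.side ε) : x ∈ h.side (!ε) := by
  rw [h.mem_carrier hX, Set.mem_Icc, not_and_or, not_le, not_le] at hx
  cases ε <;> simp only [Bool.not_true, Bool.not_false, h.mem_side_false hX,
    h.mem_side_true hX] at hx' ⊢ <;> rcases hx with hx | hx <;> first | assumption | (exfalso; linarith)

lemma isPreconnected_carrier (h : Curtain X) (hX : IsCAT0 X) : IsPreconnected h.carrier := by
  have : h.carrier = footParam h.α h.I ⁻¹' Set.Icc (h.r - 1 / 2) (h.r + 1 / 2) := by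
    ext x; exact h.mem_carrier hX
  rw [this]
  exact h.isClosedGeodesic.isPreconnected_preimage hX Set.ordConnected_Icc

lemma isPreconnected_carrier_union_side (h : Curtain X) (hX : IsCAT0 X) (ε : Bool) :
    IsPreconnected (h.carrier ∪ h.side ε) := by
  cases ε
  · have : h.carrier ∪ h.side false = footParam h.α h.I ⁻¹' Set.Iic (h.r + 1 / 2) := by
      ext x
      rw [Set.mem_union, h.mem_carrier hX, h.mem_side_false hX, Set.mem_preimage, Set.mem_Iic]
      change (_ ∧ h.proj x ≤ _) ∨ h.proj x < _ ↔ h.proj x ≤ _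
      constructor
      · rintro (h | h) <;> linarith
      · intro h'
        rcases lt_or_ge (h.proj x) (h.r - 1 / 2) with h2 | h2
        exacts [Or.inr h2, Or.inl ⟨h2, h'⟩]
    rw [this]
    exact h.isClosedGeodesic.isPreconnected_preimage hX Set.ordConnected_Iic
  · have : h.carrier ∪ h.side true = footParam h.α h.I ⁻¹' Set.Ici (h.r - 1 / 2) := by
      ext x
      rw [Set.mem_union, h.mem_carrier hX, h.mem_side_true hX, Set.mem_preimage, Set.mem_Ici]
      change (_ ∧ h.proj x ≤ _) ∨ _ < h.proj x ↔ _ ≤ h.proj x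
      constructor
      · rintro (h | h) <;> linarith
      · intro h'
        rcases lt_or_ge (h.r + 1 / 2) (h.proj x) with h2 | h2
        exacts [Or.inr h2, Or.inl ⟨h', h2⟩]
    rw [this]
    exact h.isClosedGeodesic.isPreconnected_preimage hX Set.ordConnected_Ici

lemma isOpen_side (h : Curtain X) (hX : IsCAT0 X) (ε : Bool) : IsOpen (h.side ε) := by
  have hc := h.isClosedGeodesic.continuous_footParam hX
  cases ε
  · have : h.side false = footParam h.α h.I ⁻¹' Set.Iio (h.r - 1 / 2) := by
      ext x; exact h.mem_side_false hX
    rw [this]; exact isOpen_Iio.preimage hc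
  · have : h.side true = footParam h.α h.I ⁻¹' Set.Ioi (h.r + 1 / 2) := by
      ext x; exact h.mem_side_true hX
    rw [this]; exact isOpen_Ioi.preimage hc

lemma carrier_nonempty (h : Curtain X) (hX : IsCAT0 X) : h.carrier.Nonempty := by
  have hr : h.r ∈ Set.Icc (h.r - 1 / 2) (h.r + 1 / 2) := ⟨by linarith, by linarith⟩
  refine ⟨h.α h.r, (h.mem_carrier hX).2 ?_⟩
  rwa [proj, h.isClosedGeodesic.footParam_apply hX (h.Icc_subset hr)]

lemma side_nonempty (h : Curtain X) (hX : IsCAT0 X) (ε : Bool) : (h.side ε).Nonempty := by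
  have key : ∀ t ∈ Set.Icc (h.r - 1 / 2) (h.r + 1 / 2), ∃ δ > 0, Metric.ball t δ ⊆ h.I :=
    fun t ht => Metric.mem_nhds_iff.1 (mem_interior_iff_mem_nhds.1 (h.pole_subset ht))
  cases ε
  · obtain ⟨δ, hδ, hb⟩ := key (h.r - 1 / 2) ⟨le_rfl, by linarith⟩
    refine ⟨h.α (h.r - 1 / 2 - δ / 2), (h.mem_side_false hX).2 ?_⟩
    rw [proj, h.isClosedGeodesic.footParam_apply hX (hb _)]
    · linarith
    · rw [Metric.mem_ball, Real.dist_eq, abs_lt]; constructor <;> linarith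
  · obtain ⟨δ, hδ, hb⟩ := key (h.r + 1 / 2) ⟨by linarith, le_rfl⟩
    refine ⟨h.α (h.r + 1 / 2 + δ / 2), (h.mem_side_true hX).2 ?_⟩
    rw [proj, h.isClosedGeodesic.footParam_apply hX (hb _)]
    · linarith
    · rw [Metric.mem_ball, Real.dist_eq, abs_lt]; constructor <;> linarith

/-- The halfspaces are disjoint open sets covering the complement of the curtain, so a connected set
avoiding the curtain lies in one of them. -/
lemma subset_side (h : Curtain X) (hX : IsCAT0 X) {S : Set X} (hS : IsPreconnected S)
    (hd : Disjoint S h.carrier) {ε : Bool} {z : X} (hz : z ∈ S) (hz' : z ∈ h.side ε) :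
    S ⊆ h.side ε := by
  refine hS.subset_left_of_subset_union (h.isOpen_side hX ε) (h.isOpen_side hX (!ε)) ?_ ?_
    ⟨z, hz, hz'⟩
  · exact Set.disjoint_left.2 fun x hx hx' => h.notMem_side_not hX hx hx'
  · intro x hx
    by_cases h1 : x ∈ h.side ε
    · exact Or.inl h1
    · exact Or.inr (h.mem_side_not hX (Set.disjoint_left.1 hd hx) h1)

lemma exists_subset_side (h : Curtain X) (hX : IsCAT0 X) {S : Set X} (hS : IsPreconnected S)
    (hne : S.Nonempty) (hd : Disjoint S h.carrier) : ∃ ε, S ⊆ h.side ε := by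
  obtain ⟨z, hz⟩ := hne
  by_cases h1 : z ∈ h.side true
  · exact ⟨_, h.subset_side hX hS hd hz h1⟩
  · exact ⟨_, h.subset_side hX hS hd hz (h.mem_side_not hX (Set.disjoint_left.1 hd hz) h1)⟩

lemma inter_carrier_nonempty (h : Curtain X) (hX : IsCAT0 X) {S : Set X} (hS : IsPreconnected S)
    {ε : Bool} {z w : X} (hz : z ∈ S) (hz' : z ∈ h.side ε) (hw : w ∈ S) (hw' : w ∉ h.side ε) :
    (S ∩ h.carrier).Nonempty := by
  by_contra hne
  exact hw' (h.subset_side hX hS (Set.disjoint_iff_inter_eq_empty.2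
    (Set.not_nonempty_iff_eq_empty.1 hne)) hz hz' hw)

/-- The complement of `h.side ε` is connected and misses `k`, so it lies in a single halfspace of
`k`, the one containing `z`. Take complements. -/
lemma nested (h k : Curtain X) (hX : IsCAT0 X) {ε ε' : Bool} (hk : k.carrier ⊆ h.side ε) {z : X}
    (hz : z ∉ h.side ε) (hz' : z ∈ k.side (!ε')) : k.carrier ∪ k.side ε' ⊆ h.side ε := by
  have hd : Disjoint (h.carrier ∪ h.side (!ε)) k.carrier := by
    refine Set.disjoint_right.2 fun x hx hx' => ?_
    rcases hx' with hx' | hx'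
    · exact h.notMem_carrier_of_mem_side hX (hk hx) hx'
    · exact h.notMem_side_not hX (hk hx) hx'
  have hzm : z ∈ h.carrier ∪ h.side (!ε) := by
    by_cases h1 : z ∈ h.carrier
    · exact Or.inl h1
    · exact Or.inr (h.mem_side_not hX h1 hz)
  have hs := k.subset_side hX (h.isPreconnected_carrier_union_side hX (!ε)) hd hzm hz'
  intro x hx
  by_contra hx'
  have hxm : x ∈ h.carrier ∪ h.side (!ε) := by
    by_cases h1 : x ∈ h.carrier
    · exact Or.inl h1
    · exact Or.inr (h.mem_side_not hX h1 hx')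
  rcases hx with hx | hx
  · exact k.notMem_carrier_of_mem_side hX (hs hxm) hx
  · exact k.notMem_side_not hX hx (hs hxm)

lemma Separates.symm {h : Curtain X} {A B : Set X} (hs : h.Separates A B) : h.Separates B A := by
  obtain ⟨ε, h1, h2⟩ := hs
  exact ⟨!ε, h2, by simpa using h1⟩

lemma separates_singleton {h : Curtain X} {x y : X} :
    h.Separates {x} {y} ↔ ∃ ε, x ∈ h.side ε ∧ y ∈ h.side (!ε) := by
  simp [Separates]

/-- A geodesic segment between points separated by a curtain spends time at least one in it. -/
lemma exists_interval (h : Curtain X) (hX : IsCAT0 X) {γ : ℝ → X} {d : ℝ} (hd : 0 ≤ d)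
    (hγ : IsGeodesicOn γ (Set.Icc 0 d)) (hs : h.Separates {γ 0} {γ d}) :
    ∃ s, 0 < s ∧ s + 1 ≤ d ∧ ∀ u ∈ Set.Icc s (s + 1), γ u ∈ h.carrier := by
  have hα := h.isClosedGeodesic
  have hc : ContinuousOn (fun u => h.proj (γ u)) (Set.Icc 0 d) :=
    (hα.continuous_footParam hX).comp_continuousOn hγ.continuousOn
  have hlip : ∀ s ∈ Set.Icc 0 d, ∀ t ∈ Set.Icc 0 d, |h.proj (γ s) - h.proj (γ t)| ≤ |s - t| :=
    fun s hs t ht => (hα.abs_footParam_sub_le hX _ _).trans (hγ s hs t ht).le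
  obtain ⟨ε, h0, h1⟩ := separates_singleton.1 hs
  suffices ∃ s t, 0 < s ∧ s ≤ t ∧ t ≤ d ∧ 1 ≤ |h.proj (γ s) - h.proj (γ t)| ∧
      ∀ u ∈ Set.Icc s t, γ u ∈ h.carrier by
    obtain ⟨s, t, hs, hst, ht, hl, hu⟩ := this
    have h2 := hl.trans (hlip s ⟨hs.le, hst.trans ht⟩ t ⟨hs.le.trans hst, ht⟩)
    rw [abs_sub_comm, abs_of_nonneg (by linarith)] at h2
    exact ⟨s, hs, by linarith, fun u hu' => hu u ⟨hu'.1, by linarith [hu'.2]⟩⟩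
  cases ε
  · rw [h.mem_side_false hX] at h0
    rw [Bool.not_false, h.mem_side_true hX] at h1
    obtain ⟨s, t, hs, hst, ht, e1, e2, hu⟩ := exists_crossing_interval hd hc h0.le h1.le
      (by linarith : h.r - 1 / 2 ≤ h.r + 1 / 2)
    refine ⟨s, t, hs.lt_of_ne ?_, hst, ht, ?_, fun u hu' => (h.mem_carrier hX).2 (hu u hu')⟩
    · rintro rfl; linarith
    · simp only [e1, e2]
      rw [show h.r - 1 / 2 - (h.r + 1 / 2) = -1 by ring]; norm_num
  · rw [h.mem_side_true hX] at h0
    rw [Bool.not_true, h.mem_side_false hX] at h1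
    obtain ⟨s, t, hs, hst, ht, e1, e2, hu⟩ := exists_crossing_interval hd hc.neg
      (neg_le_neg h0.le) (neg_le_neg h1.le)
      (by linarith : -(h.r + 1 / 2) ≤ -(h.r - 1 / 2))
    simp only [Pi.neg_apply, neg_inj] at e1 e2
    refine ⟨s, t, hs.lt_of_ne ?_, hst, ht, ?_, fun u hu' => (h.mem_carrier hX).2 ?_⟩
    · rintro rfl; linarith
    · rw [e1, e2]
      rw [show h.r + 1 / 2 - (h.r - 1 / 2) = 1 by ring]; norm_num
    · have := hu u hu'
      simp only [Pi.neg_apply] at this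
      exact ⟨by linarith [this.2], by linarith [this.1]⟩

/-- Disjoint curtains separating two points are fewer than the distance between the points. -/
lemma card_lt_dist (hX : IsCAT0 X) {n : ℕ} {c : Fin n → Curtain X}
    (hc : ∀ i j, i ≠ j → Disjoint (c i).carrier (c j).carrier) {x y : X} (hxy : x ≠ y)
    (hs : ∀ i, (c i).Separates {x} {y}) : (n : ℝ) < dist x y := by
  rcases Nat.eq_zero_or_pos n with rfl | hn
  · simpa using hxy
  obtain ⟨γ, hγ, h0, h1⟩ := hX.exists_segment x y
  have key : ∀ i, ∃ s, 0 < s ∧ s + 1 ≤ dist x y ∧ ∀ u ∈ Set.Icc s (s + 1), γ u ∈ (c i).carrier :=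
    fun i => (c i).exists_interval hX dist_nonneg hγ.geodesic (by rw [h0, h1]; exact hs i)
  choose s hs0 hs1 hsc using key
  have : Nonempty (Fin n) := ⟨⟨0, hn⟩⟩
  obtain ⟨i₀, hi₀⟩ := Finite.exists_min s
  -- Each curtain occupies a unit interval of the geodesic. Disjoint unit intervals are counted by
  -- Lebesgue measure, and `s i₀ > 0` makes the final inequality strict.
  have hdisj : Pairwise (Function.onFun Disjoint fun i => Set.Icc (s i) (s i + 1)) := by
    intro i j hij
    exact Set.disjoint_left.2 fun u hu hu' =>
      Set.disjoint_left.1 (hc i j hij) (hsc i u hu) (hsc j u hu')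
  have hle : MeasureTheory.volume (⋃ i, Set.Icc (s i) (s i + 1)) ≤
      MeasureTheory.volume (Set.Icc (s i₀) (dist x y)) :=
    MeasureTheory.measure_mono (Set.iUnion_subset fun i =>
      Set.Icc_subset_Icc (hi₀ i) (hs1 i))
  rw [MeasureTheory.measure_iUnion hdisj fun i => measurableSet_Icc] at hle
  simp only [Real.volume_Icc, add_sub_cancel_left, tsum_fintype, Finset.sum_const,
    Finset.card_univ, Fintype.card_fin, nsmul_eq_mul, ENNReal.ofReal_one, mul_one] at hle
  rw [← ENNReal.ofReal_natCast, ENNReal.ofReal_le_ofReal_iff (by linarith [hs1 i₀])] at hle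
  linarith [hs0 i₀]

end Curtain

section Chains

variable {X : Type*} [MetricSpace X] {n : ℕ} {c : Fin n → Curtain X} {ε : Fin n → Bool}

/-- The halfspaces `(c i).side (ε i)` of a sequence of curtains are nested. -/
def IsOriented {X : Type*} [MetricSpace X] {n : ℕ} (c : Fin n → Curtain X) (ε : Fin n → Bool) :
    Prop :=
  ∀ i j, i < j → (c j).carrier ∪ (c j).side (ε j) ⊆ (c i).side (ε i)

namespace IsOriented

lemma carrier_union_side_not (hX : IsCAT0 X) (h : IsOriented c ε) {i j : Fin n} (hij : i < j) :
    (c i).carrier ∪ (c i).side (!ε i) ⊆ (c j).side (!ε j) := by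
  intro x hx
  have hx' : x ∉ (c i).side (ε i) := fun h' => by
    rcases hx with hx | hx
    · exact (c i).notMem_carrier_of_mem_side hX h' hx
    · exact (c i).notMem_side_not hX h' hx
  exact (c j).mem_side_not hX (fun h1 => hx' (h i j hij (Or.inl h1)))
    fun h1 => hx' (h i j hij (Or.inr h1))

lemma isCurtainChain (hX : IsCAT0 X) (h : IsOriented c ε) : IsCurtainChain c where
  disjoint := by
    have key : ∀ i j, i < j → Disjoint (c i).carrier (c j).carrier := fun i j hij =>
      Set.disjoint_right.2 fun x hx hx' =>
        (c i).notMem_carrier_of_mem_side hX (h i j hij (Or.inl hx)) hx'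
    intro i j hij
    rcases lt_or_gt_of_ne hij with h1 | h1
    exacts [key i j h1, (key j i h1).symm]
  separates := fun i j k hij hjk => by
    refine Curtain.Separates.symm ⟨ε j, ?_, ?_⟩
    · exact fun x hx => h j k (Fin.lt_def.2 (by omega)) (Or.inl hx)
    · exact fun x hx => h.carrier_union_side_not hX (i := i) (j := j)
        (Fin.lt_def.2 (by omega)) (Or.inl hx)

lemma comp {m : ℕ} (h : IsOriented c ε) {f : Fin m → Fin n} (hf : StrictMono f) :
    IsOriented (c ∘ f) (ε ∘ f) := fun _ _ hij => h _ _ (hf hij)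

lemma rev (hX : IsCAT0 X) (h : IsOriented c ε) :
    IsOriented (c ∘ Fin.rev) (fun i => !ε i.rev) := fun _ _ hij =>
  h.carrier_union_side_not hX (Fin.rev_lt_rev.2 hij)

/-- If two nested curtains separated `x` from `y` in opposite directions, the point beyond the later
one would not be beyond the earlier one. -/
lemma consistent (hX : IsCAT0 X) (h : IsOriented c ε) {x y : X}
    (hs : ∀ i, (c i).Separates {x} {y}) :
    (∀ i, x ∈ (c i).side (!ε i) ∧ y ∈ (c i).side (ε i)) ∨
      (∀ i, x ∈ (c i).side (ε i) ∧ y ∈ (c i).side (!ε i)) := by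
  have h0 : ∀ i, (x ∈ (c i).side (!ε i) ∧ y ∈ (c i).side (ε i)) ∨
      (x ∈ (c i).side (ε i) ∧ y ∈ (c i).side (!ε i)) := by
    intro i
    obtain ⟨b, hb⟩ := Curtain.separates_singleton.1 (hs i)
    generalize ε i = e
    revert hb
    cases e <;> cases b <;> simp +contextual
  have key : ∀ i j, i < j → x ∈ (c i).side (!ε i) → y ∈ (c i).side (ε i) →
      ¬ (x ∈ (c j).side (ε j) ∧ y ∈ (c j).side (!ε j)) := fun i j hij hx _ hj =>
    (c i).notMem_side_not hX (h i j hij (Or.inr hj.1)) hx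
  have key' : ∀ i j, i < j → x ∈ (c i).side (ε i) → y ∈ (c i).side (!ε i) →
      ¬ (x ∈ (c j).side (!ε j) ∧ y ∈ (c j).side (ε j)) := fun i j hij _ hy hj =>
    (c i).notMem_side_not hX (h i j hij (Or.inr hj.2)) hy
  by_contra hcon
  push Not at hcon
  obtain ⟨⟨i, hi⟩, ⟨j, hj⟩⟩ := hcon
  have hi' := (h0 i).resolve_left fun h => hi h.1 h.2
  have hj' := (h0 j).resolve_right fun h => hj h.1 h.2
  rcases lt_trichotomy i j with h1 | rfl | h1
  · exact key' i j h1 hi'.1 hi'.2 hj'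
  · exact hi hj'.1 hj'.2
  · exact key j i h1 hj'.1 hj'.2 hi'

end IsOriented

/-- Orient each curtain towards its successor or, if it has none, away from its predecessor.
Neighbours are then nested by `Curtain.nested`, and nesting is transitive. -/
lemma IsCurtainChain.exists_orientation (hX : IsCAT0 X) (hc : IsCurtainChain c) :
    ∃ ε, IsOriented c ε := by
  have key : ∀ i : Fin n, ∃ b, (∀ j : Fin n, (i : ℕ) + 1 = j → (c j).carrier ⊆ (c i).side b) ∧
      (∀ j : Fin n, (j : ℕ) + 1 = i → (c j).carrier ⊆ (c i).side (!b)) := by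
    intro i
    have hne : ∀ j, j ≠ i → ∃ b, (c j).carrier ⊆ (c i).side b := fun j hj =>
      (c i).exists_subset_side hX ((c j).isPreconnected_carrier hX) ((c j).carrier_nonempty hX)
        (hc.disjoint j i hj)
    by_cases h1 : ∃ j : Fin n, (i : ℕ) + 1 = j
    · obtain ⟨j, hj⟩ := h1
      by_cases h2 : ∃ k : Fin n, (k : ℕ) + 1 = i
      · obtain ⟨k, hk⟩ := h2
        obtain ⟨b, hb1, hb2⟩ := hc.separates k i j hk hj
        refine ⟨!b, fun j' hj' => ?_, fun k' hk' => ?_⟩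
        · rwa [show j' = j from Fin.ext (by omega)]
        · rw [Bool.not_not]
          rwa [show k' = k from Fin.ext (by omega)]
      · obtain ⟨b, hb⟩ := hne j (fun h => by subst h; omega)
        refine ⟨b, fun j' hj' => ?_, fun k' hk' => absurd ⟨k', hk'⟩ h2⟩
        rwa [show j' = j from Fin.ext (by omega)]
    · by_cases h2 : ∃ k : Fin n, (k : ℕ) + 1 = i
      · obtain ⟨k, hk⟩ := h2
        obtain ⟨b, hb⟩ := hne k (fun h => by subst h; omega)
        refine ⟨!b, fun j' hj' => absurd ⟨j', hj'⟩ h1, fun k' hk' => ?_⟩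
        rw [Bool.not_not]
        rwa [show k' = k from Fin.ext (by omega)]
      · exact ⟨true, fun j' hj' => absurd ⟨j', hj'⟩ h1, fun k' hk' => absurd ⟨k', hk'⟩ h2⟩
  choose ε h1 h2 using key
  refine ⟨ε, ?_⟩
  have hstep : ∀ i j : Fin n, (i : ℕ) + 1 = j →
      (c j).carrier ∪ (c j).side (ε j) ⊆ (c i).side (ε i) := by
    intro i j hij
    obtain ⟨z, hz⟩ := (c i).carrier_nonempty hX
    exact (c i).nested (c j) hX (h1 i j hij)
      (fun h => (c i).notMem_carrier_of_mem_side hX h hz) (h2 j i hij hz)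
  have main : ∀ m : ℕ, ∀ i j : Fin n, (i : ℕ) + 1 + m = j →
      (c j).carrier ∪ (c j).side (ε j) ⊆ (c i).side (ε i) := by
    intro m
    induction m with
    | zero => exact fun i j hij => hstep i j (by omega)
    | succ m ih =>
      intro i j hij
      have hlt : (i : ℕ) + 1 < n := by have := j.2; omega
      exact (ih ⟨i + 1, hlt⟩ j (by simp; omega)).trans
        ((Set.subset_union_right).trans (hstep i ⟨i + 1, hlt⟩ rfl))
  intro i j hij
  exact main (j - (i + 1)) i j (by have := Fin.lt_def.1 hij; omega)

/-- A chain of curtains meeting a set of bounded diameter is finite. -/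
lemma IsCurtainChain.card_le (hX : IsCAT0 X) (hc : IsCurtainChain c) {M : ℝ} (hM : 0 ≤ M)
    (p : Fin n → X) (hp : ∀ i, p i ∈ (c i).carrier) (hd : ∀ i j, dist (p i) (p j) ≤ M) :
    (n : ℝ) ≤ M + 2 := by
  obtain ⟨ε, hε⟩ := hc.exists_orientation hX
  rcases lt_or_ge n 2 with hn | hn
  · have : (n : ℝ) ≤ 2 := by exact_mod_cast hn.le
    linarith
  -- The `n - 2` inner curtains separate the points chosen on the first and on the last one, so
  -- there are fewer than `M` of them.
  obtain ⟨m, rfl⟩ : ∃ m, n = m + 2 := ⟨n - 2, by omega⟩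
  have hne : p 0 ≠ p (Fin.last _) := fun h =>
    Set.disjoint_left.1 (hc.disjoint 0 (Fin.last _) (by simp [Fin.ext_iff])) (hp 0)
      (h ▸ hp (Fin.last _))
  have := Curtain.card_lt_dist hX (n := m) (c := fun i => c i.succ.castSucc)
    (fun i j hij => hc.disjoint _ _ (by simpa using hij)) hne (fun i => by
      rw [Curtain.separates_singleton]
      refine ⟨!ε i.succ.castSucc, ?_, ?_⟩
      · exact hε.carrier_union_side_not hX (i := 0) (by simp [Fin.lt_def]) (Or.inl (hp 0))
      · rw [Bool.not_not]
        exact hε _ _ (by simp [Fin.lt_def]) (Or.inl (hp (Fin.last _))))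
  push_cast
  linarith [hd 0 (Fin.last _)]

/-- Curtains dual to a common geodesic, with disjoint poles in increasing order. -/
lemma isOriented_of_dual (hX : IsCAT0 X) {α : ℝ → X} {I : Set ℝ} (hα : ∀ i, (c i).α = α)
    (hI : ∀ i, (c i).I = I) (hr : ∀ i j, i < j → (c i).r + 1 < (c j).r) :
    IsOriented c fun _ => true := by
  intro i j hij x hx
  have hp : (c j).proj x = (c i).proj x := by simp only [Curtain.proj, hα, hI]
  rw [(c i).mem_side_true hX, ← hp]
  have := hr i j hij
  rcases hx with hx | hx
  · rw [(c j).mem_carrier hX] at hx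
    linarith [hx.1]
  · rw [(c j).mem_side_true hX] at hx
    linarith

end Chains

/-! ### Isometric images of curtains, separation, and the curtain metrics -/

section Map

variable {X : Type*} [MetricSpace X]

lemma isFoot_isometry_comp (g : X ≃ᵢ X) {α : ℝ → X} {I : Set ℝ} {x : X} {t : ℝ} :
    IsFoot (fun s => g (α s)) I (g x) t ↔ IsFoot α I x t := by
  simp only [IsFoot, g.dist_eq]

namespace Curtain

/-- The image of a curtain under an isometry. -/
def map (g : X ≃ᵢ X) (h : Curtain X) : Curtain X where
  I := h.I
  ordConnected := h.ordConnected
  isClosed := h.isClosed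
  α := fun s => g (h.α s)
  isGeodesicOn := fun s hs t ht => by rw [g.dist_eq]; exact h.isGeodesicOn s hs t ht
  r := h.r
  pole_subset := h.pole_subset

lemma carrier_map (g : X ≃ᵢ X) (h : Curtain X) : (h.map g).carrier = g '' h.carrier := by
  ext y
  obtain ⟨x, rfl⟩ := g.surjective y
  rw [g.injective.mem_set_image]
  simp [carrier, map, isFoot_isometry_comp]

lemma side_map (g : X ≃ᵢ X) (h : Curtain X) (ε : Bool) : (h.map g).side ε = g '' h.side ε := by
  ext y
  obtain ⟨x, rfl⟩ := g.surjective y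
  rw [g.injective.mem_set_image]
  cases ε <;> simp [side, map, isFoot_isometry_comp]

lemma meets_map_symm (g : X ≃ᵢ X) {h k : Curtain X} (hm : k.Meets (h.map g)) :
    (k.map g.symm).Meets h := by
  obtain ⟨x, hx, hx'⟩ := hm
  rw [carrier_map] at hx'
  obtain ⟨y, hy, rfl⟩ := hx'
  refine ⟨y, ?_, hy⟩
  rw [carrier_map]
  exact ⟨_, hx, by simp⟩

lemma separates_map (g : X ≃ᵢ X) {h : Curtain X} {A B : Set X} (hs : h.Separates A B) :
    (h.map g).Separates (g '' A) (g '' B) := by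
  obtain ⟨ε, h1, h2⟩ := hs
  refine ⟨ε, ?_, ?_⟩ <;> rw [side_map] <;> exact Set.image_mono (by assumption)

end Curtain

variable {n : ℕ} {c : Fin n → Curtain X} {L : ℕ}

lemma IsCurtainChain.map (g : X ≃ᵢ X) (hc : IsCurtainChain c) :
    IsCurtainChain fun i => (c i).map g where
  disjoint i j hij := by
    rw [Curtain.carrier_map, Curtain.carrier_map]
    exact Set.disjoint_image_of_injective g.injective (hc.disjoint i j hij)
  separates i j k hij hjk := by
    rw [Curtain.carrier_map, Curtain.carrier_map]
    exact Curtain.separates_map g (hc.separates i j k hij hjk)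

lemma IsLSeparated.map (g : X ≃ᵢ X) {h k : Curtain X} (hs : IsLSeparated L h k) :
    IsLSeparated L (h.map g) (k.map g) := by
  refine ⟨?_, fun n c hc hm => hs.2 n _ (hc.map g.symm) fun i =>
    ⟨Curtain.meets_map_symm g (hm i).1, Curtain.meets_map_symm g (hm i).2⟩⟩
  rw [Curtain.carrier_map, Curtain.carrier_map]
  exact Set.disjoint_image_of_injective g.injective hs.1

lemma IsLSeparated.symm {h k : Curtain X} (hs : IsLSeparated L h k) : IsLSeparated L k h :=
  ⟨hs.1.symm, fun n c hc hm => hs.2 n c hc fun i => (hm i).symm⟩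

lemma IsLSeparated.of_carrier_eq {h k h' k' : Curtain X} (hs : IsLSeparated L h k)
    (e : h'.carrier = h.carrier) (e' : k'.carrier = k.carrier) : IsLSeparated L h' k' := by
  simpa only [IsLSeparated, Curtain.Meets, e, e'] using hs

/-- Curtains are `L`-separated if two `L`-separated curtains lie between them. -/
lemma IsLSeparated.of_between (hX : IsCAT0 X) {h k a b : Curtain X} (hs : IsLSeparated L h k)
    (hd : Disjoint a.carrier b.carrier)
    (hm : ∀ S : Set X, IsPreconnected S → (S ∩ a.carrier).Nonempty → (S ∩ b.carrier).Nonempty →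
      (S ∩ h.carrier).Nonempty ∧ (S ∩ k.carrier).Nonempty) : IsLSeparated L a b :=
  ⟨hd, fun n c hc hc' => hs.2 n c hc fun i =>
    hm _ ((c i).isPreconnected_carrier hX) (hc' i).1 (hc' i).2⟩

lemma IsLChain.map (g : X ≃ᵢ X) (hc : IsLChain L c) : IsLChain L fun i => (c i).map g :=
  ⟨hc.1.map g, fun i j hij => (hc.2 i j hij).map g⟩

lemma IsLChain.comp (hX : IsCAT0 X) (hc : IsLChain L c) {m : ℕ} {f : Fin m → Fin n}
    (hf : StrictMono f) : IsLChain L (c ∘ f) := by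
  obtain ⟨ε, hε⟩ := hc.1.exists_orientation hX
  exact ⟨(hε.comp hf).isCurtainChain hX, fun i j hij => hc.2 _ _ (hf.injective.ne hij)⟩

/-- After reversing it if necessary, an `L`-chain separating `x` from `y` runs from `x` to `y`. -/
lemma IsLChain.exists_oriented (hX : IsCAT0 X) (hc : IsLChain L c) {x y : X}
    (hs : ∀ i, (c i).Separates {x} {y}) : ∃ (c' : Fin n → Curtain X) (ε : Fin n → Bool),
      IsOriented c' ε ∧ (∀ i j, i ≠ j → IsLSeparated L (c' i) (c' j)) ∧
      ∀ i, x ∈ (c' i).side (!ε i) ∧ y ∈ (c' i).side (ε i) := by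
  obtain ⟨ε, hε⟩ := hc.1.exists_orientation hX
  rcases hε.consistent hX hs with h | h
  · exact ⟨c, ε, hε, hc.2, h⟩
  · refine ⟨_, _, hε.rev hX, fun i j hij => hc.2 _ _ (Fin.rev_injective.ne hij), fun i => ?_⟩
    simpa using h i.rev

end Map

/-! ### The metrics `d_L`: invariance, comparison with the original metric, triangle inequality. -/

section CurtainDist

variable {X : Type*} [MetricSpace X] {L : ℕ}

lemma curtainDist_self (x : X) : curtainDist L x x = 0 := by simp [curtainDist]

lemma curtainDist_set_bddAbove (hX : IsCAT0 X) (L : ℕ) {x y : X} (hxy : x ≠ y) :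
    BddAbove {n : ℕ | ∃ c : Fin n → Curtain X, IsLChain L c ∧ ∀ i, (c i).Separates {x} {y}} := by
  refine ⟨⌈dist x y⌉₊, ?_⟩
  rintro n ⟨c, hc, hs⟩
  exact_mod_cast (Curtain.card_lt_dist hX hc.1.disjoint hxy hs).le.trans (Nat.le_ceil _)

lemma curtainDist_set_nonempty (L : ℕ) (x y : X) :
    {n : ℕ | ∃ c : Fin n → Curtain X, IsLChain L c ∧ ∀ i, (c i).Separates {x} {y}}.Nonempty :=
  ⟨0, fun i => i.elim0, ⟨⟨fun i => i.elim0, fun i => i.elim0⟩, fun i => i.elim0⟩,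
    fun i => i.elim0⟩

lemma IsLChain.lt_curtainDist (hX : IsCAT0 X) {x y : X} (hxy : x ≠ y) {n : ℕ}
    {c : Fin n → Curtain X} (hc : IsLChain L c) (hs : ∀ i, (c i).Separates {x} {y}) :
    n < curtainDist L x y := by
  rw [curtainDist, if_neg hxy, Nat.lt_iff_add_one_le, add_comm]
  exact Nat.add_le_add_left (le_csSup (curtainDist_set_bddAbove hX L hxy) ⟨c, hc, hs⟩) 1

lemma exists_isLChain_of_ne (hX : IsCAT0 X) (L : ℕ) {x y : X} (hxy : x ≠ y) :
    ∃ (n : ℕ) (c : Fin n → Curtain X), IsLChain L c ∧ (∀ i, (c i).Separates {x} {y}) ∧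
      curtainDist L x y = 1 + n := by
  obtain ⟨c, hc, hs⟩ := Nat.sSup_mem (curtainDist_set_nonempty L x y)
    (curtainDist_set_bddAbove hX L hxy)
  exact ⟨_, c, hc, hs, by rw [curtainDist, if_neg hxy]⟩

lemma curtainDist_comm (x y : X) : curtainDist L x y = curtainDist L y x := by
  have : ∀ (c : Curtain X), c.Separates {x} {y} ↔ c.Separates {y} {x} :=
    fun c => ⟨Curtain.Separates.symm, Curtain.Separates.symm⟩
  rcases eq_or_ne x y with rfl | hxy
  · rfl
  · simp only [curtainDist, this, if_neg hxy, if_neg hxy.symm]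

lemma curtainDist_le (hX : IsCAT0 X) (x y : X) : (curtainDist L x y : ℝ) ≤ 1 + dist x y := by
  rcases eq_or_ne x y with rfl | hxy
  · simp [curtainDist_self]
  · obtain ⟨n, c, hc, hs, h⟩ := exists_isLChain_of_ne hX L hxy
    rw [h]
    push_cast
    linarith [Curtain.card_lt_dist hX hc.1.disjoint hxy hs]

lemma curtainDist_isometry (hX : IsCAT0 X) (g : X ≃ᵢ X) (x y : X) :
    curtainDist L (g x) (g y) = curtainDist L x y := by
  have key : ∀ (g : X ≃ᵢ X) (x y : X), curtainDist L x y ≤ curtainDist L (g x) (g y) := by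
    intro g x y
    rcases eq_or_ne x y with rfl | hxy
    · simp [curtainDist_self]
    · obtain ⟨n, c, hc, hs, h⟩ := exists_isLChain_of_ne hX L hxy
      have := (hc.map g).lt_curtainDist hX (g.injective.ne hxy) fun i => by
        simpa using Curtain.separates_map g (hs i)
      omega
  refine le_antisymm ?_ (key g x y)
  simpa using key g.symm (g x) (g y)

/-- Of the disjoint curtains separating `x` from `z`, at most one contains `y`; each of the others
separates `y` from `x` or from `z`. The summand one in `d_L` absorbs the exception. -/
lemma curtainDist_triangle (hX : IsCAT0 X) (x y z : X) :
    curtainDist L x z ≤ curtainDist L x y + curtainDist L y z := by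
  classical
  rcases eq_or_ne x y with rfl | hxy
  · simp [curtainDist_self]
  rcases eq_or_ne y z with rfl | hyz
  · simp [curtainDist_self]
  rcases eq_or_ne x z with rfl | hxz
  · simp [curtainDist_self]
  obtain ⟨n, c, hc, hs, h⟩ := exists_isLChain_of_ne hX L hxz
  have key : ∀ u v : X, u ≠ v →
      (Finset.univ.filter fun i => (c i).Separates {u} {v}).card < curtainDist L u v := by
    intro u v huv
    set s := Finset.univ.filter fun i => (c i).Separates {u} {v}
    refine (hc.comp hX (s.orderEmbOfFin rfl).strictMono).lt_curtainDist hX huv fun i => ?_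
    have := s.orderEmbOfFin_mem rfl i
    exact (Finset.mem_filter.1 this).2
  have hcover : (Finset.univ : Finset (Fin n)) ⊆
      ((Finset.univ.filter fun i => (c i).Separates {x} {y}) ∪
        Finset.univ.filter fun i => (c i).Separates {y} {z}) ∪
        Finset.univ.filter fun i => y ∈ (c i).carrier := by
    intro i _
    simp only [Finset.mem_union, Finset.mem_filter, Finset.mem_univ, true_and,
      Curtain.separates_singleton]
    obtain ⟨ε, h1, h2⟩ := Curtain.separates_singleton.1 (hs i)
    by_cases hy : y ∈ (c i).carrier
    · exact Or.inr hy
    · by_cases hy' : y ∈ (c i).side ε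
      · exact Or.inl (Or.inr ⟨ε, hy', h2⟩)
      · exact Or.inl (Or.inl ⟨ε, h1, (c i).mem_side_not hX hy hy'⟩)
  have hone : (Finset.univ.filter fun i => y ∈ (c i).carrier).card ≤ 1 := by
    refine Finset.card_le_one.2 fun i hi j hj => ?_
    by_contra hij
    exact Set.disjoint_left.1 (hc.1.disjoint i j hij) (Finset.mem_filter.1 hi).2
      (Finset.mem_filter.1 hj).2
  have h1 := (Finset.card_le_card hcover).trans ((Finset.card_union_le _ _).trans
    (Nat.add_le_add_right (Finset.card_union_le _ _) _))
  rw [Finset.card_univ, Fintype.card_fin] at h1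
  have := key x y hxy
  have := key y z hyz
  omega

end CurtainDist

/-! ### Axes of hyperbolic isometries -/

section Axis

variable {X : Type*} [MetricSpace X]

/-- A discrete local geodesic in a CAT(0) space is a geodesic. -/
lemma IsCAT0.dist_eq_of_local (hX : IsCAT0 X) {a : ℕ → X} {η : ℝ}
    (h1 : ∀ k, dist (a k) (a (k + 1)) = η) (h2 : ∀ k, dist (a k) (a (k + 2)) = 2 * η) (k : ℕ) :
    dist (a 0) (a k) = k * η := by
  have hle : ∀ k : ℕ, dist (a 0) (a k) ≤ k * η := by
    intro k
    induction k with
    | zero => simp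
    | succ k ih =>
      have := dist_triangle (a 0) (a k) (a (k + 1))
      rw [h1] at this
      push_cast; linarith
  -- That is, the sequence `dist (a 0) (a k) ^ 2 - k² η²` is convex. It vanishes at `0` and `1`,
  -- hence is nonnegative.
  have hcn : ∀ k, 2 * dist (a 0) (a (k + 1)) ^ 2 ≤
      dist (a 0) (a k) ^ 2 + dist (a 0) (a (k + 2)) ^ 2 - 2 * η ^ 2 := by
    intro k
    have := hX.sq_dist_le (a 0) (x := a k) (y := a (k + 2)) (p := a (k + 1)) (u := 1 / 2)
      (by norm_num) (by norm_num) (by rw [h1, h2]; ring) (by rw [h1, h2]; ring)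
    rw [h2, dist_comm _ (a 0), dist_comm _ (a 0), dist_comm _ (a 0)] at this
    linarith
  have hind : ∀ k : ℕ, (k : ℝ) ^ 2 * η ^ 2 ≤ dist (a 0) (a k) ^ 2 ∧
      dist (a 0) (a k) ^ 2 + (2 * k + 1) * η ^ 2 ≤ dist (a 0) (a (k + 1)) ^ 2 := by
    intro k
    induction k with
    | zero => simp [h1]
    | succ k ih =>
      have := hcn k
      obtain ⟨i1, i2⟩ := ih
      push_cast
      constructor <;> nlinarith
  refine le_antisymm (hle k) ?_
  refine abs_le_of_sq_le_sq' ?_ dist_nonneg |>.2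
  rw [mul_pow]
  exact (hind k).1

lemma isometryEquiv_pow_succ_apply (g : X ≃ᵢ X) (k : ℕ) (x : X) :
    (g ^ (k + 1)) x = (g ^ k) (g x) := by
  rw [pow_succ]; rfl

lemma isometryEquiv_zpow_add_apply (g : X ≃ᵢ X) (k l : ℤ) (x : X) :
    (g ^ (k + l)) x = (g ^ k) ((g ^ l) x) := by
  rw [zpow_add]; rfl

/-- Orbits of points of minimal displacement are geodesic. -/
lemma IsCAT0.dist_pow_apply (hX : IsCAT0 X) {g : X ≃ᵢ X} {x : X}
    (hmin : ∀ y, dist x (g x) ≤ dist y (g y)) (k : ℕ) :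
    dist x ((g ^ k) x) = k * dist x (g x) := by
  -- The midpoint `m` of `x` and `g x` is moved by exactly the minimal displacement, so there is no
  -- corner at `g x`: the sequence `x, m, g x, g m, …` is a discrete local geodesic.
  obtain ⟨m, hm, hm'⟩ := hX.exists_between x (g x) (u := 1 / 2) (by norm_num) (by norm_num)
  set δ := dist x (g x)
  have hgm : dist (g x) (g m) = 1 / 2 * δ := by rw [g.dist_eq, hm]
  have hmm : dist m (g m) = δ := by
    refine le_antisymm ?_ (hmin m)
    have := dist_triangle m (g x) (g m)
    linarith
  let a : ℕ → X := fun k => (g ^ (k / 2)) (if k % 2 = 0 then x else m)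
  have ha2 : ∀ k, a (k + 2) = (g ^ (k / 2)) (g (if k % 2 = 0 then x else m)) := by
    intro k
    simp only [a]
    rw [show (k + 2) / 2 = k / 2 + 1 by omega, isometryEquiv_pow_succ_apply,
      show (k + 2) % 2 = k % 2 by omega]
  have h2 : ∀ k, dist (a k) (a (k + 2)) = 2 * (δ / 2) := by
    intro k
    rw [ha2, (g ^ (k / 2)).dist_eq]
    split_ifs
    · ring
    · rw [hmm]; ring
  have h1 : ∀ k, dist (a k) (a (k + 1)) = δ / 2 := by
    intro k
    rcases Nat.mod_two_eq_zero_or_one k with h | h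
    · simp only [a]
      rw [show (k + 1) / 2 = k / 2 by omega, if_pos h, if_neg (by omega), (g ^ (k / 2)).dist_eq, hm]
      ring
    · simp only [a]
      rw [show (k + 1) / 2 = k / 2 + 1 by omega, if_neg (by omega), if_pos (by omega),
        isometryEquiv_pow_succ_apply, (g ^ (k / 2)).dist_eq, hm']
      ring
  have := hX.dist_eq_of_local h1 h2 (2 * k)
  simp only [a] at this
  rw [show 2 * k / 2 = k by omega, if_pos (by omega : 2 * k % 2 = 0)] at this
  simp only [Nat.zero_div, pow_zero, if_true] at this
  rw [show (1 : X ≃ᵢ X) x = x from rfl] at this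
  rw [this]; push_cast; ring

/-- A hyperbolic isometry of a CAT(0) space has an axis. -/
lemma IsHyperbolicIsometry.exists_isAxis (hX : IsCAT0 X) {g : X ≃ᵢ X}
    (hg : IsHyperbolicIsometry g) : ∃ α, IsAxis g α := by
  obtain ⟨x, hpos, hmin⟩ := hg
  set δ := dist x (g x)
  obtain ⟨γ, hγ, h0, h1⟩ := hX.exists_segment x (g x)
  let α : ℝ → X := fun t => (g ^ ⌊t / δ⌋) (γ (δ * Int.fract (t / δ)))
  have hz : ∀ k l : ℤ, dist ((g ^ k) x) ((g ^ l) x) = |(k : ℝ) - l| * δ := by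
    have key : ∀ k l : ℤ, k ≤ l → dist ((g ^ k) x) ((g ^ l) x) = ((l : ℝ) - k) * δ := by
      intro k l hkl
      obtain ⟨m, rfl⟩ := Int.le.dest hkl
      rw [isometryEquiv_zpow_add_apply, (g ^ k).dist_eq, zpow_natCast, hX.dist_pow_apply hmin]
      push_cast; ring
    intro k l
    rcases le_total k l with h | h
    · rw [key k l h, abs_sub_comm, abs_of_nonneg]
      exact sub_nonneg.2 (by exact_mod_cast h)
    · rw [dist_comm, key l k h, abs_of_nonneg]
      exact sub_nonneg.2 (by exact_mod_cast h)
  have hfr : ∀ t, t = ⌊t / δ⌋ * δ + δ * Int.fract (t / δ) := by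
    intro t
    have h1 := Int.floor_add_fract (t / δ)
    have h2 : t = t / δ * δ := by field_simp
    rw [← h1] at h2
    linarith
  have hmem : ∀ t, δ * Int.fract (t / δ) ∈ Set.Icc 0 δ := fun t =>
    ⟨mul_nonneg hpos.le (Int.fract_nonneg _), by nlinarith [Int.fract_lt_one (t / δ)]⟩
  have hl : ∀ t, dist ((g ^ ⌊t / δ⌋) x) (α t) = t - ⌊t / δ⌋ * δ := by
    intro t
    have := hγ.geodesic 0 ⟨le_rfl, hpos.le⟩ _ (hmem t)
    rw [h0, zero_sub, abs_neg, abs_of_nonneg (hmem t).1] at this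
    rw [(g ^ ⌊t / δ⌋).dist_eq, this]
    linarith [hfr t]
  have hr : ∀ t, dist (α t) ((g ^ (⌊t / δ⌋ + 1)) x) = (⌊t / δ⌋ + 1) * δ - t := by
    intro t
    have := hγ.geodesic _ (hmem t) δ ⟨hpos.le, le_rfl⟩
    rw [h1, abs_sub_comm, abs_of_nonneg (by linarith [(hmem t).2])] at this
    rw [isometryEquiv_zpow_add_apply, (g ^ ⌊t / δ⌋).dist_eq, zpow_one, this]
    linarith [hfr t]
  have hgeo : ∀ s t, s ≤ t → dist (α s) (α t) = t - s := by
    intro s t hst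
    have hfl : ⌊s / δ⌋ ≤ ⌊t / δ⌋ := Int.floor_mono (by gcongr)
    rcases hfl.eq_or_lt with h | h
    · simp only [α]
      rw [h, (g ^ ⌊t / δ⌋).dist_eq, hγ.geodesic _ (hmem s) _ (hmem t)]
      have e1 := hfr s
      have e2 := hfr t
      rw [h] at e1
      rw [abs_sub_comm, abs_of_nonneg] <;> linarith
    · apply le_antisymm
      · have t1 := dist_triangle4 (α s) ((g ^ (⌊s / δ⌋ + 1)) x) ((g ^ ⌊t / δ⌋) x) (α t)
        rw [hl, hr, hz, abs_sub_comm, abs_of_nonneg] at t1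
        · push_cast at t1; linarith
        · rw [sub_nonneg]; exact_mod_cast h
      -- A shortcut from `α s` to `α t` would shorten the distance between the orbit points
      -- enclosing them, which is known exactly.
      · have t1 := dist_triangle4 ((g ^ ⌊s / δ⌋) x) (α s) (α t) ((g ^ (⌊t / δ⌋ + 1)) x)
        rw [hl, hr, hz, abs_sub_comm, abs_of_nonneg] at t1
        · push_cast at t1; linarith
        · rw [sub_nonneg]; exact_mod_cast (by omega : ⌊s / δ⌋ ≤ ⌊t / δ⌋ + 1)
  refine ⟨α, ?_, δ, hpos.ne', ?_⟩
  · intro s _ t _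
    rcases le_total s t with h | h
    · rw [hgeo s t h, abs_sub_comm, abs_of_nonneg (by linarith)]
    · rw [dist_comm, hgeo t s h, abs_of_nonneg (by linarith)]
  · intro t
    simp only [α]
    rw [add_div, div_self hpos.ne', Int.floor_add_one, Int.fract_add_one, add_comm _ (1 : ℤ),
      isometryEquiv_zpow_add_apply, zpow_one]

end Axis

/-! ### Skewering, loxodromic actions, and long chains along an axis -/

section Loxodromic

variable {X : Type*} [MetricSpace X] {g : X ≃ᵢ X} {L : ℕ}

lemma dist_pow_apply_le (g : X ≃ᵢ X) (k : ℕ) (x : X) :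
    dist x ((g ^ k) x) ≤ k * dist x (g x) := by
  induction k with
  | zero => simp [show (1 : X ≃ᵢ X) x = x from rfl]
  | succ k ih =>
    have := dist_triangle x ((g ^ k) x) ((g ^ (k + 1)) x)
    rw [isometryEquiv_pow_succ_apply, (g ^ k).dist_eq] at this
    rw [isometryEquiv_pow_succ_apply]
    push_cast; linarith

/-- An isometry acts loxodromically if the positive part of some orbit of one of its powers
escapes linearly. -/
lemma actsLoxodromically_of_le_curtainDist (hX : IsCAT0 X) {x : X} {m : ℕ} (hm : 0 < m)
    (h : ∀ k : ℕ, k ≤ curtainDist L x (((g ^ m) ^ k) x)) : ActsLoxodromically L g := by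
  set δ := dist x (g x)
  have hδ : 0 ≤ δ := dist_nonneg
  have hm' : (1 : ℝ) ≤ m := by exact_mod_cast hm
  have hnat : ∀ N : ℕ, (N : ℝ) / m - (2 + m * δ) ≤ curtainDist L x ((g ^ N) x) ∧
      (curtainDist L x ((g ^ N) x) : ℝ) ≤ 1 + N * δ := by
    intro N
    constructor
    · have h1 := h (N / m)
      have h2 := curtainDist_triangle (L := L) hX x ((g ^ N) x) (((g ^ m) ^ (N / m)) x)
      have h3 : (curtainDist L ((g ^ N) x) (((g ^ m) ^ (N / m)) x) : ℝ) ≤ 1 + m * δ := by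
        have hN : N = m * (N / m) + N % m := (Nat.div_add_mod N m).symm
        have : (g ^ N) x = ((g ^ m) ^ (N / m)) ((g ^ (N % m)) x) := by
          conv_lhs => rw [hN, pow_add, pow_mul]
          rfl
        rw [this, curtainDist_isometry hX, curtainDist_comm]
        have hlt : ((N % m : ℕ) : ℝ) ≤ m := by exact_mod_cast (Nat.mod_lt N hm).le
        have := dist_pow_apply_le g (N % m) x
        have := curtainDist_le (L := L) hX x ((g ^ (N % m)) x)
        nlinarith
      have h4 : (N : ℝ) / m ≤ ((N / m : ℕ) : ℝ) + 1 := by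
        rw [div_le_iff₀ (by positivity)]
        have : N ≤ (N / m + 1) * m := by
          have := Nat.div_add_mod N m
          have := Nat.mod_lt N hm
          nlinarith
        exact_mod_cast this
      have h5 : ((N / m : ℕ) : ℝ) ≤ curtainDist L x ((g ^ N) x) +
          curtainDist L ((g ^ N) x) (((g ^ m) ^ (N / m)) x) := by exact_mod_cast h1.trans h2
      linarith
    · exact (curtainDist_le hX _ _).trans (by linarith [dist_pow_apply_le g N x])
  -- The additive constant pays one for rounding `N / m` down and `1 + m * δ` for moving from `g ^ N
  -- x` to the orbit of `g ^ m`; the factor `m + δ` dominates `m` for the lower bound and `δ` for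
  -- the upper.
  refine ⟨x, m + δ, 2 + m * δ, by linarith, by positivity, ?_⟩
  have key : ∀ a : ℤ, ∀ N : ℕ,
      (N : ℝ) / (m + δ) - (2 + m * δ) ≤ curtainDist L ((g ^ a) x) ((g ^ (a + N)) x) ∧
      (curtainDist L ((g ^ a) x) ((g ^ (a + N)) x) : ℝ) ≤ (m + δ) * N + (2 + m * δ) := by
    intro a N
    rw [isometryEquiv_zpow_add_apply, curtainDist_isometry hX, zpow_natCast]
    obtain ⟨h1, h2⟩ := hnat N
    have h3 : (N : ℝ) / (m + δ) ≤ N / m := by gcongr; linarith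
    have h4 : 0 ≤ (N : ℝ) * m := by positivity
    have h5 : 0 ≤ m * δ := by positivity
    exact ⟨by linarith, by nlinarith⟩
  intro a b
  rcases le_total a b with hab | hab
  · obtain ⟨N, rfl⟩ := Int.le.dest hab
    have : |(a : ℝ) - ((a + N : ℤ) : ℝ)| = N := by push_cast; simp
    rw [this]
    exact key a N
  · obtain ⟨N, rfl⟩ := Int.le.dest hab
    have : |((b + N : ℤ) : ℝ) - b| = N := by push_cast; simp
    rw [this, curtainDist_comm]
    exact key b N

/-- An isometry skewering a pair of separated curtains acts loxodromically. -/
lemma Skewers.actsLoxodromically (hX : IsCAT0 X) {h₁ h₂ : Curtain X}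
    (hs : IsLSeparated L h₁ h₂) (hg : Skewers g h₁ h₂) : ActsLoxodromically L g := by
  obtain ⟨ε₁, ε₂, m, hsub, hsub'⟩ := hg
  have hm : 0 < m := by
    rcases Nat.eq_zero_or_pos m with rfl | hm
    · exfalso
      have : (fun x => (g ^ 0) x) '' h₁.side ε₁ = h₁.side ε₁ := by
        have : (fun x => (g ^ 0) x) = id := rfl
        rw [this, Set.image_id]
      rw [this] at hsub
      exact (hsub.trans hsub').ne rfl
    · exact hm
  set f := g ^ m with hf
  -- Disjointness of the curtains upgrades the inclusion of halfspaces to one that takes in the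
  -- curtain `h₂`.
  have hT : h₂.carrier ∪ h₂.side ε₂ ⊆ h₁.side ε₁ := by
    obtain ⟨z, hz⟩ := h₂.side_nonempty hX ε₂
    refine h₁.subset_side hX (h₂.isPreconnected_carrier_union_side hX ε₂) ?_ (Or.inr hz)
      (hsub'.1 hz)
    refine Set.disjoint_left.2 fun x hx hx' => ?_
    rcases hx with hx | hx
    · exact Set.disjoint_left.1 hs.1 hx' hx
    · exact h₁.notMem_carrier_of_mem_side hX (hsub'.1 hx) hx'
  have hstep : ∀ k : ℕ, ((f ^ (k + 1)) '' (h₂.carrier ∪ h₂.side ε₂) ⊆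
      (f ^ (k + 1)) '' h₁.side ε₁) ∧ (f ^ (k + 1)) '' h₁.side ε₁ ⊆ (f ^ k) '' h₂.side ε₂ := by
    intro k
    refine ⟨Set.image_mono hT, ?_⟩
    rintro _ ⟨x, hx, rfl⟩
    rw [isometryEquiv_pow_succ_apply]
    exact ⟨_, hsub.1 ⟨x, hx, rfl⟩, rfl⟩
  have hanti : ∀ i d : ℕ, (f ^ (i + d + 1)) '' h₁.side ε₁ ⊆ (f ^ i) '' h₂.side ε₂ := by
    intro i d
    induction d with
    | zero => exact (hstep i).2
    | succ d ih =>
      exact (hstep (i + d + 1)).2.trans ((Set.image_mono Set.subset_union_right).trans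
        ((hstep (i + d)).1.trans ih))
  have hor : ∀ n, IsOriented (fun i : Fin n => h₂.map (f ^ ((i : ℕ) + 1))) fun _ => ε₂ := by
    intro n i j hij
    rw [Curtain.carrier_map, Curtain.side_map, Curtain.side_map, ← Set.image_union]
    obtain ⟨d, hd⟩ : ∃ d, (j : ℕ) = i + 1 + d := ⟨j - (i + 1), by have := Fin.lt_def.1 hij; omega⟩
    rw [hd]
    exact (hstep _).1.trans (hanti _ _)
  -- Between the translates of `h₂` by `f ^ i` and `f ^ j` lies the translate of `h₁` by `f ^ j`. A
  -- connected set meeting both translates of `h₂` crosses it, so the `L`-separation of the `f ^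
  -- j`-translates of `h₁` and `h₂` applies.
  have hsep : ∀ i j : ℕ, i < j → IsLSeparated L (h₂.map (f ^ i)) (h₂.map (f ^ j)) := by
    intro i j hij
    obtain ⟨d, rfl⟩ : ∃ d, j = i + d + 1 := ⟨j - (i + 1), by omega⟩
    have hsub₂ : (h₂.map (f ^ (i + d + 1))).carrier ⊆ (h₁.map (f ^ (i + d + 1))).side ε₁ := by
      rw [Curtain.carrier_map, Curtain.side_map]
      exact Set.subset_union_left.trans ((Set.image_union _ _ _).symm.subset.trans (hstep _).1)
    have hnot : ∀ x ∈ (h₂.map (f ^ i)).carrier, x ∉ (h₁.map (f ^ (i + d + 1))).side ε₁ := by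
      intro x hx hx'
      rw [Curtain.side_map] at hx'
      have := hanti i d hx'
      rw [← Curtain.side_map] at this
      exact Curtain.notMem_carrier_of_mem_side _ hX this hx
    refine (hs.map (f ^ (i + d + 1))).of_between hX ?_ ?_
    · exact Set.disjoint_left.2 fun x hx hx' => hnot x hx (hsub₂ hx')
    · rintro S hS ⟨z, hz, hz'⟩ ⟨w, hw, hw'⟩
      exact ⟨(h₁.map (f ^ (i + d + 1))).inter_carrier_nonempty hX hS hw (hsub₂ hw') hz
        (hnot z hz'), w, hw, hw'⟩
  obtain ⟨x, hx⟩ := h₂.carrier_nonempty hX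
  refine actsLoxodromically_of_le_curtainDist hX (x := x) hm fun k => ?_
  rcases Nat.eq_zero_or_pos k with rfl | hk
  · exact Nat.zero_le _
  -- The point `x` and its image lie on `h₂` and on its `k`-th translate, so only `k - 1` translates
  -- are available to separate them; the summand one in `d_L` makes up for the loss.
  obtain ⟨n, rfl⟩ : ∃ n, k = n + 1 := ⟨k - 1, by omega⟩
  have hchain : IsLChain L (fun i : Fin n => h₂.map (f ^ ((i : ℕ) + 1))) := by
    refine ⟨(hor n).isCurtainChain hX, fun i j hij => ?_⟩
    rcases lt_or_gt_of_ne hij with h | h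
    · exact hsep _ _ (by simpa using h)
    · exact (hsep _ _ (by simpa using h)).symm
  have hfirst : ∀ d : ℕ, (f ^ (d + 1)) '' (h₂.carrier ∪ h₂.side ε₂) ⊆ h₂.side ε₂ := by
    intro d y hy
    obtain ⟨z, hz, rfl⟩ := hanti 0 d (by rw [zero_add]; exact (hstep d).1 hy)
    exact hz
  refine hchain.lt_curtainDist hX ?_ fun i => ?_
  · intro he
    have h1 := hfirst n ⟨x, Or.inl hx, rfl⟩
    rw [← he] at h1
    exact h₂.notMem_carrier_of_mem_side hX h1 hx
  · rw [Curtain.separates_singleton]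
    refine ⟨!ε₂, ?_, ?_⟩
    · have hx0 : x ∉ h₂.side ε₂ := fun hy => h₂.notMem_carrier_of_mem_side hX hy hx
      have hsubs : (h₂.map (f ^ ((i : ℕ) + 1))).carrier ∪ (h₂.map (f ^ ((i : ℕ) + 1))).side ε₂ ⊆
          h₂.side ε₂ := by
        rw [Curtain.carrier_map, Curtain.side_map, ← Set.image_union]
        exact hfirst i
      exact Curtain.mem_side_not _ hX (fun h => hx0 (hsubs (Or.inl h)))
        fun h => hx0 (hsubs (Or.inr h))
    · rw [Bool.not_not, Curtain.side_map]
      obtain ⟨d, hd⟩ : ∃ d, n + 1 = (i : ℕ) + 1 + d + 1 := ⟨n - 1 - i, by omega⟩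
      change (f ^ (n + 1)) x ∈ _
      rw [hd]
      exact hanti _ _ ((hstep _).1 ⟨x, Or.inl hx, rfl⟩)

lemma pow_apply_of_fixed {x : X} (hx : g x = x) (n : ℕ) : (g ^ n) x = x := by
  induction n with
  | zero => rfl
  | succ n ih => rw [isometryEquiv_pow_succ_apply, hx, ih]

lemma ActsLoxodromically.unbounded (h : ActsLoxodromically L g) :
    ∃ x, ∀ M : ℕ, ∃ n : ℕ, M < curtainDist L x ((g ^ n) x) := by
  obtain ⟨x, K, C, hK, hC, h⟩ := h
  refine ⟨x, fun M => ?_⟩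
  obtain ⟨n, hn⟩ := exists_nat_gt (K * (M + C))
  refine ⟨n, ?_⟩
  have h1 := (h 0 n).1
  rw [zpow_zero, zpow_natCast] at h1
  have h2 : |((0 : ℤ) : ℝ) - ((n : ℤ) : ℝ)| = n := by simp
  rw [h2, show (1 : X ≃ᵢ X) x = x from rfl] at h1
  have h3 : (M : ℝ) + C < n / K := by
    rw [lt_div_iff₀ (by linarith)]; linarith
  have h4 : (M : ℝ) < curtainDist L x ((g ^ n) x) := by linarith
  exact_mod_cast h4

/-- A semisimple isometry acting loxodromically is hyperbolic, and moves the points of its axes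
arbitrarily far. -/
lemma ActsLoxodromically.exists_isAxis (hX : IsCAT0 X) (hg : IsSemisimpleIsometry g)
    (h : ActsLoxodromically L g) : IsHyperbolicIsometry g ∧
      ∃ (n : ℕ) (α : ℝ → X) (x : X), IsAxis g α ∧ x ∈ Set.range α ∧
        L + 4 < curtainDist L x ((g ^ n) x) := by
  obtain ⟨x, hx⟩ := h.unbounded
  have hmove : ∀ y : X, ∀ M : ℕ, ∃ n : ℕ, M < curtainDist L y ((g ^ n) y) := by
    intro y M
    obtain ⟨n, hn⟩ := hx (M + 2 * curtainDist L x y)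
    refine ⟨n, ?_⟩
    have h1 := curtainDist_triangle (L := L) hX x y ((g ^ n) x)
    have h2 := curtainDist_triangle (L := L) hX y ((g ^ n) y) ((g ^ n) x)
    rw [curtainDist_isometry hX, curtainDist_comm y x] at h2
    omega
  have hyp : IsHyperbolicIsometry g := by
    obtain ⟨x₀, hmin⟩ := hg
    refine ⟨x₀, dist_pos.2 fun he => ?_, hmin⟩
    obtain ⟨n, hn⟩ := hmove x₀ 0
    rw [pow_apply_of_fixed he.symm, curtainDist_self] at hn
    exact lt_irrefl _ hn
  obtain ⟨α, hα⟩ := hyp.exists_isAxis hX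
  obtain ⟨n, hn⟩ := hmove (α 0) (L + 4)
  exact ⟨hyp, n, α, α 0, hα, ⟨0, rfl⟩, hn⟩

end Loxodromic

/-! ### Curtains dual to a line -/

section Dual

variable {X : Type*} [MetricSpace X] {α : ℝ → X}

lemma IsGeodesicOn.isClosedGeodesic_univ (hα : IsGeodesicOn α Set.univ) :
    IsClosedGeodesic α Set.univ :=
  ⟨hα, isClosed_univ, Set.ordConnected_univ, Set.univ_nonempty⟩

lemma IsGeodesicOn.dist_eq (hα : IsGeodesicOn α Set.univ) (s t : ℝ) :
    dist (α s) (α t) = |s - t| := hα s trivial t trivial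

lemma IsGeodesicOn.comp_neg (hα : IsGeodesicOn α Set.univ) :
    IsGeodesicOn (fun t => α (-t)) Set.univ := fun s _ t _ => by
  rw [hα.dist_eq, ← abs_neg]; ring_nf

/-- The curtain dual to the line `α` centred at `α r`. -/
def dualCurtain (hα : IsGeodesicOn α Set.univ) (r : ℝ) : Curtain X where
  I := Set.univ
  ordConnected := Set.ordConnected_univ
  isClosed := isClosed_univ
  α := α
  isGeodesicOn := hα
  r := r
  pole_subset := by simp

lemma mem_dualCurtain_carrier (hX : IsCAT0 X) (hα : IsGeodesicOn α Set.univ) {r : ℝ} {x : X} :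
    x ∈ (dualCurtain hα r).carrier ↔
      r - 1 / 2 ≤ footParam α Set.univ x ∧ footParam α Set.univ x ≤ r + 1 / 2 :=
  (dualCurtain hα r).mem_carrier hX

lemma mem_dualCurtain_side_true (hX : IsCAT0 X) (hα : IsGeodesicOn α Set.univ) {r : ℝ} {x : X} :
    x ∈ (dualCurtain hα r).side true ↔ r + 1 / 2 < footParam α Set.univ x :=
  (dualCurtain hα r).mem_side_true hX

lemma footParam_line_apply (hX : IsCAT0 X) (hα : IsGeodesicOn α Set.univ) (t : ℝ) :
    footParam α Set.univ (α t) = t :=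
  hα.isClosedGeodesic_univ.footParam_apply hX trivial

lemma apply_mem_dualCurtain (hX : IsCAT0 X) (hα : IsGeodesicOn α Set.univ) (r : ℝ) :
    α r ∈ (dualCurtain hα r).carrier := by
  rw [mem_dualCurtain_carrier hX, footParam_line_apply hX hα]
  constructor <;> linarith

lemma footParam_comp_neg (hX : IsCAT0 X) (hα : IsGeodesicOn α Set.univ) (x : X) :
    footParam (fun t => α (-t)) Set.univ x = -footParam α Set.univ x := by
  refine hα.comp_neg.isClosedGeodesic_univ.footParam_eq hX ⟨trivial, fun s _ => ?_⟩
  simp only [neg_neg]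
  exact hα.isClosedGeodesic_univ.dist_foot_le x trivial

lemma carrier_dualCurtain_neg (hX : IsCAT0 X) (hα : IsGeodesicOn α Set.univ) (r : ℝ) :
    (dualCurtain hα.comp_neg r).carrier = (dualCurtain hα (-r)).carrier := by
  ext x
  rw [mem_dualCurtain_carrier hX, mem_dualCurtain_carrier hX, footParam_comp_neg hX hα]
  constructor <;> rintro ⟨h1, h2⟩ <;> constructor <;> linarith

lemma isOriented_dualCurtain (hX : IsCAT0 X) (hα : IsGeodesicOn α Set.univ) {n : ℕ}
    {r : Fin n → ℝ} (hr : ∀ i j, i < j → r i + 1 < r j) :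
    IsOriented (fun i => dualCurtain hα (r i)) fun _ => true :=
  isOriented_of_dual hX (fun _ => rfl) (fun _ => rfl) hr

/-- Translates of an isometry along its axis. -/
lemma footParam_translate (hX : IsCAT0 X) (hα : IsGeodesicOn α Set.univ) {f : X ≃ᵢ X} {σ : ℝ}
    (hf : ∀ t, f (α t) = α (t + σ)) (x : X) :
    footParam α Set.univ (f x) = footParam α Set.univ x + σ := by
  refine hα.isClosedGeodesic_univ.footParam_eq hX ⟨trivial, fun s _ => ?_⟩
  have h := hf (s - σ)
  rw [sub_add_cancel] at h
  rw [← hf, ← h, f.dist_eq, f.dist_eq]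
  exact hα.isClosedGeodesic_univ.dist_foot_le x trivial

lemma translate_pow {f : X ≃ᵢ X} {σ : ℝ} (hf : ∀ t, f (α t) = α (t + σ)) (k : ℕ) (t : ℝ) :
    (f ^ k) (α t) = α (t + k * σ) := by
  induction k generalizing t with
  | zero => simp [show (1 : X ≃ᵢ X) (α t) = α t from rfl]
  | succ k ih =>
    rw [isometryEquiv_pow_succ_apply, hf, ih]
    congr 1; push_cast; ring

lemma translate_inv {f : X ≃ᵢ X} {σ : ℝ} (hf : ∀ t, f (α t) = α (t + σ)) (t : ℝ) :
    (f⁻¹) (α t) = α (t + -σ) := by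
  have h := hf (t + -σ)
  rw [neg_add_cancel_right] at h
  rw [← h]
  exact f.symm_apply_apply _

lemma translate_zpow {f : X ≃ᵢ X} {σ : ℝ} (hf : ∀ t, f (α t) = α (t + σ)) (k : ℤ) (t : ℝ) :
    (f ^ k) (α t) = α (t + k * σ) := by
  obtain ⟨n, rfl | rfl⟩ := k.eq_nat_or_neg
  · rw [zpow_natCast, translate_pow hf]; simp
  · rw [zpow_neg, zpow_natCast, translate_inv (translate_pow hf n)]; simp

lemma carrier_dualCurtain_translate (hX : IsCAT0 X) (hα : IsGeodesicOn α Set.univ) {f : X ≃ᵢ X}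
    {σ : ℝ} (hf : ∀ t, f (α t) = α (t + σ)) (r : ℝ) :
    ((dualCurtain hα r).map f).carrier = (dualCurtain hα (r + σ)).carrier := by
  rw [Curtain.carrier_map]
  ext y
  obtain ⟨x, rfl⟩ := f.surjective y
  rw [f.injective.mem_set_image, mem_dualCurtain_carrier hX, mem_dualCurtain_carrier hX,
    footParam_translate hX hα hf]
  constructor <;> rintro ⟨h1, h2⟩ <;> constructor <;> linarith

/-- Dual curtains of `α` that are far apart are uniformly separated. -/
def HasSeparatedDuals (hα : IsGeodesicOn α Set.univ) : Prop :=
  ∃ (L : ℕ) (T : ℝ), ∀ r r', r + T ≤ r' → IsLSeparated L (dualCurtain hα r) (dualCurtain hα r')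

lemma HasSeparatedDuals.comp_neg (hX : IsCAT0 X) {hα : IsGeodesicOn α Set.univ}
    (h : HasSeparatedDuals hα) : HasSeparatedDuals hα.comp_neg := by
  obtain ⟨L, T, h⟩ := h
  exact ⟨L, T, fun r r' hr => (h (-r') (-r) (by linarith)).symm.of_carrier_eq
    (carrier_dualCurtain_neg hX hα r) (carrier_dualCurtain_neg hX hα r')⟩

/-- Any two sufficiently distant dual curtains are skewered, by a power of `g` translating further
than the distance between their centres. Reversing the line reduces to a positive translation. -/
lemma HasSeparatedDuals.exists_skewers (hX : IsCAT0 X) {g : X ≃ᵢ X} (hg : IsAxis g α)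
    (h : HasSeparatedDuals hg.1) :
    ∃ h₁ h₂ : Curtain X, (∃ L : ℕ, IsLSeparated L h₁ h₂) ∧ Skewers g h₁ h₂ := by
  have key : ∀ (α : ℝ → X) (hα : IsGeodesicOn α Set.univ) (τ : ℝ), 0 < τ →
      (∀ t, g (α t) = α (t + τ)) → HasSeparatedDuals hα →
      ∃ h₁ h₂ : Curtain X, (∃ L : ℕ, IsLSeparated L h₁ h₂) ∧ Skewers g h₁ h₂ := by
    rintro α hα τ hτ hg ⟨L, T, hT⟩
    set T' := max T 1
    have hT' : 1 ≤ T' := le_max_right _ _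
    obtain ⟨m, hm⟩ := exists_nat_gt (T' / τ)
    rw [div_lt_iff₀ hτ] at hm
    have hgm := translate_pow hg m
    have hfoot := footParam_translate hX hα hgm
    have hline := footParam_line_apply hX hα
    refine ⟨dualCurtain hα 0, dualCurtain hα T', ⟨L, hT _ _ (by simp [T'])⟩, true, true, m, ?_, ?_⟩
    · refine (Set.ssubset_iff_of_subset ?_).2 ⟨α (1 / 2 + m * τ), ?_, ?_⟩
      · rintro _ ⟨x, hx, rfl⟩
        rw [mem_dualCurtain_side_true hX] at hx ⊢
        rw [hfoot]; linarith
      · rw [mem_dualCurtain_side_true hX, hline]; linarith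
      · rintro ⟨x, hx, hx'⟩
        rw [mem_dualCurtain_side_true hX] at hx
        have := hfoot x
        rw [hx', hline] at this
        linarith
    · refine (Set.ssubset_iff_of_subset ?_).2 ⟨α (T' + 1 / 2), ?_, ?_⟩
      · intro x hx
        rw [mem_dualCurtain_side_true hX] at hx ⊢
        linarith
      · rw [mem_dualCurtain_side_true hX, hline]; linarith
      · rw [mem_dualCurtain_side_true hX, hline]; linarith
  obtain ⟨hα, τ, hτ, hgτ⟩ := id hg
  rcases hτ.lt_or_gt with h0 | h0
  · refine key _ hα.comp_neg (-τ) (by linarith) (fun t => ?_) (h.comp_neg hX)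
    rw [hgτ]; congr 1; ring
  · exact key α hα τ h0 hgτ h

end Dual

/-! ### Contracting lines have separated dual curtains -/

section Contracting

variable {X : Type*} [MetricSpace X] {α : ℝ → X}

/-- Coarsely Lipschitz functions on an interval. -/
lemma abs_sub_le_of_steps {f : ℝ → ℝ} {a b δ D : ℝ} (hab : a ≤ b) (hδ : 0 < δ) (hD : 0 ≤ D)
    (h : ∀ u ∈ Set.Icc a b, ∀ v ∈ Set.Icc a b, |u - v| ≤ δ → |f u - f v| ≤ D) :
    |f a - f b| ≤ D * ((b - a) / δ + 1) := by
  have key : ∀ n : ℕ, ∀ c ∈ Set.Icc a b, c - a ≤ n * δ → |f a - f c| ≤ n * D := by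
    intro n
    induction n with
    | zero =>
      intro c hc hcn
      have : c = a := le_antisymm (by simpa using hcn) hc.1
      simp [this]
    | succ n ih =>
      intro c hc hcn
      have hc' : max a (c - δ) ∈ Set.Icc a b :=
        ⟨le_max_left _ _, max_le hab (by linarith [hc.2])⟩
      push_cast at hcn ⊢
      have h1 := ih _ hc' (by
        rw [sub_le_iff_le_add]
        exact max_le (by nlinarith [n.cast_nonneg (α := ℝ)]) (by linarith))
      have h2 := h _ hc' c hc (by
        rw [abs_sub_comm, abs_of_nonneg]
        · linarith [le_max_right a (c - δ)]
        · exact sub_nonneg.2 (max_le hc.1 (by linarith)))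
      have h3 := abs_sub_le (f a) (f (max a (c - δ))) (f c)
      linarith
  have hpos : 0 ≤ (b - a) / δ := div_nonneg (by linarith) hδ.le
  have h1 := key ⌈(b - a) / δ⌉₊ b ⟨hab, le_rfl⟩ (by
    rw [← div_le_iff₀ hδ]; exact Nat.le_ceil _)
  have h2 := (Nat.ceil_lt_add_one hpos).le
  nlinarith

/-- Geodesics whose endpoints project far apart on a contracting line pass close to it. -/
lemma IsContractingGeodesic.exists_near (hα : IsGeodesicOn α Set.univ) {D : ℝ}
    (hD : 0 < D) (hc : IsContractingGeodesic D α Set.univ) {γ : ℝ → X} {a b : ℝ} (hab : a ≤ b)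
    (hγ : IsGeodesicOn γ (Set.Icc a b))
    (hfar : 8 * D < |footParam α Set.univ (γ a) - footParam α Set.univ (γ b)|) :
    ∃ u ∈ Set.Icc a b, dist (γ u) (α (footParam α Set.univ (γ u))) ≤ 2 * D := by
  have hα' := hα.isClosedGeodesic_univ
  set F : X → ℝ := footParam α Set.univ with hF
  set H : X → ℝ := fun x => dist x (α (F x)) with hH
  by_contra! hne
  have hball : ∀ x y, dist x y < H x → |F x - F y| ≤ D := by
    intro x y hxy
    rw [← hα.dist_eq]
    refine hc x (H x) ?_ x (Metric.mem_ball_self (lt_of_le_of_lt dist_nonneg hxy)) y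
      (by rwa [Metric.mem_ball, dist_comm]) _ _ (hα'.isFoot_footParam x) (hα'.isFoot_footParam y)
    refine Set.disjoint_left.2 ?_
    rintro _ hz ⟨s, -, rfl⟩
    rw [Metric.mem_ball, dist_comm] at hz
    exact absurd (hα'.dist_foot_le x (s := s) trivial) (not_le.2 hz)
  have ha : a ∈ Set.Icc a b := ⟨le_rfl, hab⟩
  have hb : b ∈ Set.Icc a b := ⟨hab, le_rfl⟩
  have hlen : b - a ≤ H (γ a) + |F (γ a) - F (γ b)| + H (γ b) := by
    have h1 := dist_triangle4 (γ a) (α (F (γ a))) (α (F (γ b))) (γ b)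
    rw [hγ a ha b hb, abs_sub_comm, abs_of_nonneg (by linarith), hα.dist_eq,
      dist_comm _ (γ b)] at h1
    exact h1
  have h2 : 2 * D < H (γ a) := hne a ha
  have h3 : 2 * D < H (γ b) := hne b hb
  rcases lt_or_ge (b - a) (H (γ a)) with h4 | h4
  · have := hball (γ a) (γ b) (by rwa [hγ a ha b hb, abs_sub_comm, abs_of_nonneg (by linarith)])
    linarith
  rcases lt_or_ge (b - a) (H (γ b)) with h5 | h5
  · have := hball (γ b) (γ a) (by rwa [hγ b hb a ha, abs_of_nonneg (by linarith)])
    rw [abs_sub_comm] at this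
    linarith
  -- Let `f` be the distance between the two end projections. Before `u` and after `v` the geodesic
  -- stays in balls about its endpoints that miss the line, so each end drifts by at most `D`. In
  -- between, each step of length `2 * D` drifts by at most `D`, and `v - u ≤ f + 2 * D`. Altogether
  -- `f ≤ f / 2 + 4 * D`, whence the `8 * D`.
  set u := a + (H (γ a) - D)
  set v := b - (H (γ b) - D)
  have hu : u ∈ Set.Icc a b := ⟨by simp only [u]; linarith, by simp only [u]; linarith⟩
  have hv : v ∈ Set.Icc a b := ⟨by simp only [v]; linarith, by simp only [v]; linarith⟩
  have h6 : |F (γ a) - F (γ u)| ≤ D := hball _ _ (by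
    rw [hγ a ha u hu, abs_sub_comm, abs_of_nonneg (by linarith [hu.1])]
    simp only [u]; linarith)
  have h7 : ∀ w ∈ Set.Icc a b, v ≤ w → |F (γ w) - F (γ b)| ≤ D := fun w hw hvw => by
    rw [abs_sub_comm]
    refine hball _ _ ?_
    rw [hγ b hb w hw, abs_of_nonneg (by linarith [hw.2])]
    simp only [v] at hvw; linarith
  rcases le_total v u with h8 | h8
  · have := abs_sub_le (F (γ a)) (F (γ u)) (F (γ b))
    linarith [h7 u hu h8]
  · have h9 := abs_sub_le_of_steps (f := fun w => F (γ w)) (δ := 2 * D) (D := D) h8 (by linarith)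
      hD.le (fun w hw w' hw' hww => hball _ _ (by
        have hwm : w ∈ Set.Icc a b := ⟨hu.1.trans hw.1, hw.2.trans hv.2⟩
        rw [hγ w hwm w' ⟨hu.1.trans hw'.1, hw'.2.trans hv.2⟩]
        exact hww.trans_lt (hne w hwm)))
    have h10 : D * ((v - u) / (2 * D) + 1) = (v - u) / 2 + D := by field_simp
    have h11 : v - u = b - a - H (γ a) - H (γ b) + 2 * D := by simp only [u, v]; ring
    have h12 := abs_sub_le (F (γ a)) (F (γ u)) (F (γ b))
    have h13 := abs_sub_le (F (γ u)) (F (γ v)) (F (γ b))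
    have h14 := h7 v hv le_rfl
    linarith

/-- Applying `exists_near` to a subsegment that projects into `[p, q]` also controls where along the
line the nearby point sits. -/
lemma IsContractingGeodesic.exists_near_crossing (hX : IsCAT0 X) (hα : IsGeodesicOn α Set.univ)
    {D : ℝ} (hD : 0 < D) (hc : IsContractingGeodesic D α Set.univ) {γ : ℝ → X} {a b : ℝ}
    (hab : a ≤ b) (hγ : IsGeodesicOn γ (Set.Icc a b)) {p q : ℝ} (hpq : p + 8 * D < q)
    (hcross : (footParam α Set.univ (γ a) ≤ p ∧ q ≤ footParam α Set.univ (γ b)) ∨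
      (footParam α Set.univ (γ b) ≤ p ∧ q ≤ footParam α Set.univ (γ a))) :
    ∃ u ∈ Set.Icc a b, dist (γ u) (α (footParam α Set.univ (γ u))) ≤ 2 * D ∧
      footParam α Set.univ (γ u) ∈ Set.Icc p q := by
  have key : ∀ {γ : ℝ → X} {a b : ℝ}, a ≤ b → IsGeodesicOn γ (Set.Icc a b) →
      (footParam α Set.univ (γ a) ≤ p ∧ q ≤ footParam α Set.univ (γ b)) →
      ∃ u ∈ Set.Icc a b, dist (γ u) (α (footParam α Set.univ (γ u))) ≤ 2 * D ∧
        footParam α Set.univ (γ u) ∈ Set.Icc p q := by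
    intro γ a b hab hγ hcr
    obtain ⟨s, t, hs, hst, ht, es, et, hu⟩ := exists_crossing_interval hab
      ((hα.isClosedGeodesic_univ.continuous_footParam hX).comp_continuousOn hγ.continuousOn)
      hcr.1 hcr.2 (by linarith)
    simp only [Function.comp_apply] at es et hu
    obtain ⟨u, hu', hd⟩ := hc.exists_near hα hD hst
      (hγ.mono (Set.Icc_subset_Icc hs ht)) (by
        rw [es, et, abs_sub_comm]
        exact lt_of_lt_of_le (by linarith) (le_abs_self _))
    exact ⟨u, ⟨hs.trans hu'.1, hu'.2.trans ht⟩, hd, hu u hu'⟩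
  rcases hcross with h | h
  · exact key hab hγ h
  · obtain ⟨u, hu, hd, hm⟩ := key (γ := fun t => γ (-t)) (a := -b) (b := -a) (by linarith)
      (fun s hs t ht => by
        rw [hγ (-s) ⟨by linarith [hs.2], by linarith [hs.1]⟩ (-t)
          ⟨by linarith [ht.2], by linarith [ht.1]⟩, ← abs_neg]
        congr 1; ring) (by simpa using h)
    exact ⟨-u, ⟨by linarith [hu.2], by linarith [hu.1]⟩, hd, hm⟩

lemma Curtain.exists_leg (hX : IsCAT0 X) (k : Curtain X) {x : X} (hx : x ∈ k.carrier) :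
    ∃ (γ : ℝ → X) (l : ℝ), 0 ≤ l ∧ IsGeodesicOn γ (Set.Icc 0 l) ∧ γ 0 = x ∧
      γ l = k.α (k.proj x) ∧ ∀ u ∈ Set.Icc 0 l, γ u ∈ k.carrier := by
  obtain ⟨γ, hγ, h0, h1⟩ := hX.exists_segment x (k.α (k.proj x))
  refine ⟨γ, _, dist_nonneg, hγ.geodesic, h0, h1, fun u hu => ?_⟩
  have e1 := hγ.geodesic 0 ⟨le_rfl, dist_nonneg⟩ u hu
  have e2 := hγ.geodesic u hu _ ⟨dist_nonneg, le_rfl⟩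
  rw [h0, zero_sub, abs_neg, abs_of_nonneg hu.1] at e1
  rw [h1, abs_sub_comm, abs_of_nonneg (by linarith [hu.2])] at e2
  have : k.proj (γ u) = k.proj x := k.isClosedGeodesic.footParam_of_between hX (by
    change dist x (γ u) + dist (γ u) (k.α (k.proj x)) = dist x (k.α (k.proj x))
    rw [e1, e2]; ring)
  rw [k.mem_carrier hX, this, ← k.mem_carrier hX]
  exact hx

/-- Two points of a curtain are joined inside it by three geodesics: a leg to the pole, a piece of
the pole, and a leg back. Their projections together cover a stretch of `27 * D`, so one of them
crosses a third of it, of length `9 * D > 8 * D`. -/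
lemma IsContractingGeodesic.exists_near_of_mem_carrier (hX : IsCAT0 X)
    (hα : IsGeodesicOn α Set.univ) {D : ℝ} (hD : 0 < D)
    (hc : IsContractingGeodesic D α Set.univ) (k : Curtain X) {x y : X} (hx : x ∈ k.carrier)
    (hy : y ∈ k.carrier) {p : ℝ} (hxp : footParam α Set.univ x ≤ p)
    (hyp : p + 27 * D ≤ footParam α Set.univ y) :
    ∃ z ∈ k.carrier, dist z (α (footParam α Set.univ z)) ≤ 2 * D ∧
      footParam α Set.univ z ∈ Set.Icc p (p + 27 * D) := by
  obtain ⟨γ₁, l₁, hl₁, hγ₁, h10, h11, h1⟩ := k.exists_leg hX hx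
  obtain ⟨γ₂, l₂, hl₂, hγ₂, h20, h21, h2⟩ := k.exists_leg hX hy
  set F : X → ℝ := footParam α Set.univ
  have hm1 := (k.mem_carrier hX).1 hx
  have hm2 := (k.mem_carrier hX).1 hy
  rcases le_or_gt (p + 9 * D) (F (k.α (k.proj x))) with h3 | h3
  · obtain ⟨u, hu, hd, hm⟩ := hc.exists_near_crossing hX hα hD hl₁ hγ₁ (p := p) (q := p + 9 * D)
      (by linarith) (Or.inl ⟨by rwa [h10], by rwa [h11]⟩)
    exact ⟨_, h1 u hu, hd, hm.1, hm.2.trans (by linarith)⟩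
  rcases le_or_gt (p + 18 * D) (F (k.α (k.proj y))) with h4 | h4
  · have hpole : ∀ a b, a ≤ b → Set.Icc a b ⊆ Set.Icc (k.r - 1 / 2) (k.r + 1 / 2) →
        (F (k.α a) ≤ p + 9 * D ∧ p + 18 * D ≤ F (k.α b)) ∨
          (F (k.α b) ≤ p + 9 * D ∧ p + 18 * D ≤ F (k.α a)) →
        ∃ z ∈ k.carrier, dist z (α (F z)) ≤ 2 * D ∧ F z ∈ Set.Icc p (p + 27 * D) := by
      intro a b hab hsub hcr
      obtain ⟨u, hu, hd, hm⟩ := hc.exists_near_crossing hX hα hD hab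
        (k.isGeodesicOn.mono (hsub.trans k.Icc_subset)) (by linarith) hcr
      refine ⟨_, (k.mem_carrier hX).2 ?_, hd, by linarith [hm.1], by linarith [hm.2]⟩
      rw [Curtain.proj, k.isClosedGeodesic.footParam_apply hX (k.Icc_subset (hsub hu))]
      exact hsub hu
    rcases le_total (k.proj x) (k.proj y) with h5 | h5
    · exact hpole _ _ h5 (Set.Icc_subset_Icc hm1.1 hm2.2) (Or.inl ⟨h3.le, h4⟩)
    · exact hpole _ _ h5 (Set.Icc_subset_Icc hm2.1 hm1.2) (Or.inr ⟨h3.le, h4⟩)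
  · obtain ⟨u, hu, hd, hm⟩ := hc.exists_near_crossing hX hα hD hl₂ hγ₂ (p := p + 18 * D)
      (q := p + 27 * D) (by linarith) (Or.inr ⟨by rw [h21]; exact h4.le, by rwa [h20]⟩)
    exact ⟨_, h2 u hu, hd, by linarith [hm.1], hm.2⟩

/-- Each curtain meeting both dual curtains has a point within `2 * D` of a fixed segment of length
`27 * D`. These points are pairwise within `(2 + 27 + 2) * D`, which bounds a chain by
`IsCurtainChain.card_le`. -/
lemma IsContractingGeodesic.hasSeparatedDuals (hX : IsCAT0 X) (hα : IsGeodesicOn α Set.univ)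
    {D₀ : ℝ} (hc₀ : IsContractingGeodesic D₀ α Set.univ) : HasSeparatedDuals hα := by
  obtain ⟨D, hD, hc⟩ : ∃ D, 0 < D ∧ IsContractingGeodesic D α Set.univ :=
    ⟨max D₀ 1, by positivity, fun x ρ h y hy z hz s t hs ht =>
      (hc₀ x ρ h y hy z hz s t hs ht).trans (le_max_left _ _)⟩
  -- One unit accounts for the half-widths of the two dual curtains; the other is slack.
  refine ⟨⌈31 * D + 2⌉₊, 27 * D + 1 + 1, fun r r' hr => ⟨?_, fun n c hcc hm => ?_⟩⟩
  · refine Set.disjoint_left.2 fun x hx hx' => ?_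
    rw [mem_dualCurtain_carrier hX] at hx hx'
    linarith [hx.2, hx'.1]
  · have hz : ∀ i, ∃ z ∈ (c i).carrier, dist z (α (footParam α Set.univ z)) ≤ 2 * D ∧
        footParam α Set.univ z ∈ Set.Icc (r + 1 / 2) (r + 1 / 2 + 27 * D) := by
      intro i
      obtain ⟨⟨x, hx, hx'⟩, ⟨y, hy, hy'⟩⟩ := hm i
      rw [mem_dualCurtain_carrier hX] at hx' hy'
      exact hc.exists_near_of_mem_carrier hX hα hD (c i) hx hy hx'.2 (by linarith [hy'.1])
    choose z hz hzd hzm using hz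
    have := hcc.card_le hX (M := 31 * D) (by linarith) z hz fun i j => by
      have h1 := dist_triangle4 (z i) (α (footParam α Set.univ (z i)))
        (α (footParam α Set.univ (z j))) (z j)
      rw [hα.dist_eq, dist_comm (α _) (z j)] at h1
      have h2 : |footParam α Set.univ (z i) - footParam α Set.univ (z j)| ≤ 27 * D := by
        rw [abs_le]
        constructor <;> linarith [(hzm i).1, (hzm i).2, (hzm j).1, (hzm j).2]
      linarith [hzd i, hzd j]
    exact_mod_cast this.trans (Nat.le_ceil _)

end Contracting

/-! ### Lines with separated dual curtains are contracting -/

section Bottleneck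

variable {X : Type*} [MetricSpace X] {α : ℝ → X}

/-- The projection of a line to a geodesic that starts perpendicularly to it. -/
lemma footParam_perpendicular (hX : IsCAT0 X) (hα : IsGeodesicOn α Set.univ) {σ : ℝ → X} {H r : ℝ}
    (hH : 0 ≤ H) (hσ : IsClosedGeodesic σ (Set.Icc 0 H)) (h0 : σ 0 = α r)
    (hfoot : ∀ w ∈ Set.Icc 0 H, footParam α Set.univ (σ w) = r) (t : ℝ) :
    footParam σ (Set.Icc 0 H) (α t) = 0 := by
  refine hσ.footParam_eq hX ⟨⟨le_rfl, hH⟩, fun w hw => ?_⟩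
  have h1 := hα.isClosedGeodesic_univ.sq_dist_ge hX (σ w) (s := t) trivial
  rw [hfoot w hw] at h1
  rw [h0, hα.dist_eq, dist_comm]
  refine abs_le_of_sq_le_sq (by nlinarith [sq_nonneg (dist (σ w) (α r))]) dist_nonneg

/-- If `p` lies between `x` and `y`, then one of `x`, `y` projects to `p` on any geodesic
ending at `p`. -/
lemma footParam_eq_or_of_between (hX : IsCAT0 X) {σ : ℝ → X} {H : ℝ} (hH : 0 ≤ H)
    (hσ : IsClosedGeodesic σ (Set.Icc 0 H)) {x y : X}
    (hp : dist x (σ H) + dist (σ H) y = dist x y) :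
    footParam σ (Set.Icc 0 H) x = H ∨ footParam σ (Set.Icc 0 H) y = H := by
  have hHm : H ∈ Set.Icc 0 H := ⟨hH, le_rfl⟩
  by_contra! hne
  have hlt : ∀ z, footParam σ (Set.Icc 0 H) z ≠ H → footParam σ (Set.Icc 0 H) z < H := fun z hz =>
    (hσ.footParam_mem z).2.lt_of_ne hz
  have key : ∀ z w, footParam σ (Set.Icc 0 H) z ≤ w → w < H → dist z (σ w) < dist z (σ H) := by
    intro z w hw hwH
    set g := footParam σ (Set.Icc 0 H) z
    have hg : g ∈ Set.Icc 0 H := hσ.footParam_mem z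
    have hgH : 0 < H - g := by linarith
    have h1 : dist z (σ g) < dist z (σ H) := by
      have := hσ.sq_dist_ge hX z hHm
      refine lt_of_pow_lt_pow_left₀ 2 dist_nonneg ?_
      nlinarith [pow_pos hgH 2]
    have hu0 : 0 ≤ (w - g) / (H - g) := div_nonneg (by linarith) hgH.le
    have hu1 : (w - g) / (H - g) < 1 := (div_lt_one hgH).2 (by linarith)
    have hwu : (1 - (w - g) / (H - g)) * g + (w - g) / (H - g) * H = w := by field_simp; ring
    have h2 := hσ.geodesic.dist_le_convexComb hX z hg hHm hu0 hu1.le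
      (by rw [hwu]; exact ⟨hg.1.trans hw, hwH.le⟩)
    rw [hwu] at h2
    nlinarith
  have h1 := key x _ (le_max_left _ (footParam σ (Set.Icc 0 H) y))
    (max_lt (hlt x hne.1) (hlt y hne.2))
  have h2 := key y _ (le_max_right (footParam σ (Set.Icc 0 H) x) _)
    (max_lt (hlt x hne.1) (hlt y hne.2))
  have h3 := dist_triangle x
    (σ (max (footParam σ (Set.Icc 0 H) x) (footParam σ (Set.Icc 0 H) y))) y
  rw [dist_comm y, dist_comm y] at h2
  linarith

/-- The bottleneck property of separated dual curtains. -/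
lemma dist_foot_le_of_separated (hX : IsCAT0 X) (hα : IsGeodesicOn α Set.univ) {L : ℕ}
    {x y p : X} (hp : dist x p + dist p y = dist x y)
    (hx : IsLSeparated L (dualCurtain hα (footParam α Set.univ x))
      (dualCurtain hα (footParam α Set.univ p)))
    (hy : IsLSeparated L (dualCurtain hα (footParam α Set.univ y))
      (dualCurtain hα (footParam α Set.univ p))) :
    dist p (α (footParam α Set.univ p)) ≤ 2 * L + 2 := by
  by_contra! hlarge
  have hα' := hα.isClosedGeodesic_univ
  set r := footParam α Set.univ p with hr
  obtain ⟨σ, hσ, h0, h1⟩ := hX.exists_segment (α r) p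
  rw [dist_comm] at hlarge
  set H := dist (α r) p
  have hH : 0 ≤ H := dist_nonneg
  have hfoot : ∀ w ∈ Set.Icc 0 H, footParam α Set.univ (σ w) = r := by
    intro w hw
    refine hα'.footParam_of_between hX ?_
    rw [← hr]
    have e1 := hσ.geodesic w hw 0 ⟨le_rfl, hH⟩
    have e2 := hσ.geodesic H ⟨hH, le_rfl⟩ w hw
    rw [h0, sub_zero, abs_of_nonneg hw.1] at e1
    rw [h1, abs_of_nonneg (by linarith [hw.2])] at e2
    rw [e1, e2, dist_comm p]; ring
  have hperp := footParam_perpendicular hX hα hH hσ h0 hfoot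
  have key : ∀ z, footParam σ (Set.Icc 0 H) z = H →
      ¬ IsLSeparated L (dualCurtain hα (footParam α Set.univ z)) (dualCurtain hα r) := by
    intro z hz hsep
    have hle : ∀ j : Fin (L + 1), ((j : ℕ) : ℝ) ≤ L := fun j => by
      exact_mod_cast Nat.lt_succ_iff.1 j.2
    -- Curtains dual to `σ` centred at `1, 3, …, 2 L + 1`; they fit because `H > 2 L + 2`. The dual
    -- curtain of the line at `r` contains `σ`, so it meets them all. So does the one through `z`:
    -- it is connected and contains a point of the line, projecting to `0` on `σ`, and `z`,
    -- projecting to `H`.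
    let c : Fin (L + 1) → Curtain X := fun j =>
      { I := Set.Icc 0 H
        ordConnected := hσ.ordConnected
        isClosed := hσ.closed
        α := σ
        isGeodesicOn := hσ.geodesic
        r := 2 * (j : ℕ) + 1
        pole_subset := by
          rw [interior_Icc]
          rintro t ⟨ht1, ht2⟩
          have := hle j
          have := (j : ℕ).cast_nonneg (α := ℝ)
          constructor <;> linarith }
    have hor : IsOriented c fun _ => true :=
      isOriented_of_dual hX (fun _ => rfl) (fun _ => rfl) fun i j hij => by
        have : ((i : ℕ) : ℝ) + 1 ≤ (j : ℕ) := by exact_mod_cast Fin.lt_def.1 hij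
        change 2 * ((i : ℕ) : ℝ) + 1 + 1 < 2 * (j : ℕ) + 1
        linarith
    have hmem : ∀ j : Fin (L + 1), 2 * ((j : ℕ) : ℝ) + 1 ∈ Set.Icc 0 H := fun j => by
      have := hle j
      have := (j : ℕ).cast_nonneg (α := ℝ)
      constructor <;> linarith
    have hcar : ∀ (j : Fin (L + 1)) w, footParam σ (Set.Icc 0 H) w = 2 * ((j : ℕ) : ℝ) + 1 →
        w ∈ (c j).carrier := by
      intro j w hw
      rw [(c j).mem_carrier hX]
      change footParam σ (Set.Icc 0 H) w ∈
        Set.Icc (2 * ((j : ℕ) : ℝ) + 1 - 1 / 2) (2 * ((j : ℕ) : ℝ) + 1 + 1 / 2)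
      rw [hw]
      constructor <;> linarith
    have := hsep.2 (L + 1) c (hor.isCurtainChain hX) fun j => ⟨?_, ?_⟩
    · omega
    · have hzmem : z ∈ (dualCurtain hα (footParam α Set.univ z)).carrier := by
        rw [mem_dualCurtain_carrier hX]; constructor <;> linarith
      obtain ⟨w, hw, hw'⟩ := ((dualCurtain hα (footParam α Set.univ z)).isPreconnected_carrier
        hX).intermediate_value (apply_mem_dualCurtain hX hα _) hzmem
        (hσ.continuous_footParam hX).continuousOn
        (show 2 * ((j : ℕ) : ℝ) + 1 ∈ _ by rw [hperp, hz]; exact hmem j)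
      exact ⟨w, hcar j w hw', hw⟩
    · refine ⟨σ (2 * ((j : ℕ) : ℝ) + 1), hcar j _ (hσ.footParam_apply hX (hmem j)), ?_⟩
      rw [mem_dualCurtain_carrier hX, hfoot _ (hmem j)]
      constructor <;> linarith
  rcases footParam_eq_or_of_between hX hH hσ (x := x) (y := y) (by rw [h1]; exact hp) with h | h
  · exact key x h hx
  · exact key y h hy

/-- Comparing each of two points of a ball with its centre costs the factor two. -/
lemma isContractingGeodesic_of_forall_dist_lt (hX : IsCAT0 X) (hα : IsGeodesicOn α Set.univ)
    {C : ℝ} (h : ∀ x y, dist x y < dist x (α (footParam α Set.univ x)) →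
      |footParam α Set.univ x - footParam α Set.univ y| ≤ C) :
    IsContractingGeodesic (2 * C) α Set.univ := by
  have hα' := hα.isClosedGeodesic_univ
  set F : X → ℝ := footParam α Set.univ
  intro x ρ hd y hy z hz s t hs ht
  rw [hα'.isFoot_iff hX] at hs ht
  have hρ : ρ ≤ dist x (α (F x)) := by
    by_contra! h
    exact Set.disjoint_left.1 hd
      (show α (F x) ∈ Metric.ball x ρ by rwa [Metric.mem_ball, dist_comm])
      ⟨_, trivial, rfl⟩
  rw [Metric.mem_ball, dist_comm] at hy hz
  have h1 := h x y (hy.trans_le hρ)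
  have h2 := h x z (hz.trans_le hρ)
  rw [hα.dist_eq, ← hs, ← ht]
  have := abs_sub_le (F y) (F x) (F z)
  rw [abs_sub_comm] at h1
  linarith

/-- On a geodesic from `x` to `y` with large drift, let `p` be the point where the projection has
advanced by `T`. The bottleneck puts `p` within `2 * L + 2` of the line, so reaching `p` uses up all
but `2 * L + 2` of the height of `x`, and the drift still to come forces `dist p y` above `T + 2 * L
+ 2`. So `y` is not in the ball. -/
lemma HasSeparatedDuals.isContractingGeodesic (hX : IsCAT0 X) {hα : IsGeodesicOn α Set.univ}
    (h : HasSeparatedDuals hα) : ∃ D, IsContractingGeodesic D α Set.univ := by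
  obtain ⟨L, T₀, hT₀⟩ := h
  obtain ⟨T, hT0, hT⟩ : ∃ T : ℝ, 0 ≤ T ∧ ∀ r r', r + T ≤ r' →
      IsLSeparated L (dualCurtain hα r) (dualCurtain hα r') :=
    ⟨max T₀ 0, le_max_right _ _, fun r r' h => hT₀ r r' (by linarith [le_max_left T₀ 0])⟩
  have hα' := hα.isClosedGeodesic_univ
  set F : X → ℝ := footParam α Set.univ
  have key : ∀ x y, dist x y < dist x (α (F x)) → |F x - F y| ≤ 2 * T + 2 * L + 2 := by
    intro x y hxy
    by_contra! hfar
    have hp : ∃ p, dist x p + dist p y = dist x y ∧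
        |F p - F y| = |F x - F y| - T ∧ IsLSeparated L (dualCurtain hα (F x)) (dualCurtain hα (F p))
        ∧ IsLSeparated L (dualCurtain hα (F y)) (dualCurtain hα (F p)) := by
      obtain ⟨γ, hγ, h0, h1⟩ := hX.exists_segment x y
      have hcont : ContinuousOn (fun u => F (γ u)) (Set.Icc 0 (dist x y)) :=
        (hα'.continuous_footParam hX).comp_continuousOn hγ.geodesic.continuousOn
      have hbet : ∀ u ∈ Set.Icc 0 (dist x y), dist x (γ u) + dist (γ u) y = dist x y := by
        intro u hu
        have e1 := hγ.geodesic u hu 0 ⟨le_rfl, dist_nonneg⟩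
        have e2 := hγ.geodesic _ ⟨dist_nonneg, le_rfl⟩ u hu
        rw [h0, sub_zero, abs_of_nonneg hu.1, dist_comm] at e1
        rw [h1, abs_of_nonneg (by linarith [hu.2]), dist_comm] at e2
        rw [e1, e2]; ring
      have hL : (0 : ℝ) ≤ L := L.cast_nonneg
      rcases le_total (F x) (F y) with hle | hle
      · rw [abs_sub_comm, abs_of_nonneg (by linarith)] at hfar
        obtain ⟨u, hu, hFu⟩ := intermediate_value_Icc dist_nonneg hcont
          (show F x + T ∈ _ by rw [h0, h1]; constructor <;> linarith)
        simp only at hFu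
        refine ⟨γ u, hbet u hu, ?_, hT _ _ ?_, (hT _ _ ?_).symm⟩
        · rw [hFu, abs_sub_comm, abs_of_nonneg (by linarith), abs_sub_comm,
            abs_of_nonneg (by linarith)]; ring
        · rw [hFu]
        · rw [hFu]; linarith
      · rw [abs_of_nonneg (by linarith)] at hfar
        obtain ⟨u, hu, hFu⟩ := intermediate_value_Icc' dist_nonneg hcont
          (show F x - T ∈ _ by rw [h0, h1]; constructor <;> linarith)
        simp only at hFu
        refine ⟨γ u, hbet u hu, ?_, (hT _ _ ?_).symm, hT _ _ ?_⟩
        · rw [hFu, abs_of_nonneg (by linarith), abs_of_nonneg (by linarith)]; ring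
        · rw [hFu]; linarith
        · rw [hFu]; linarith
    obtain ⟨p, hp, hpy, hs1, hs2⟩ := hp
    have h1 := dist_foot_le_of_separated hX hα hp hs1 hs2
    have h2 := hα'.dist_foot_le_add x p
    have h3 := hα'.abs_footParam_sub_le hX p y
    change |F p - F y| ≤ _ at h3
    change dist p (α (F p)) ≤ _ at h1
    change dist x (α (F x)) ≤ dist x p + dist p (α (F p)) at h2
    linarith
  exact ⟨_, isContractingGeodesic_of_forall_dist_lt hX hα key⟩

end Bottleneck

/-! ### Long chains along a line separate its dual curtains -/

section LongChains

variable {X : Type*} [MetricSpace X] {α : ℝ → X}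

/-- A curtain that meets `α` and misses a dual curtain further along `α` lies behind it. -/
lemma dualCurtain_subset_side (hX : IsCAT0 X) (hα : IsGeodesicOn α Set.univ) (h : Curtain X)
    {ε : Bool} {a b r : ℝ} (ha : α a ∈ h.carrier) (har : a < r - 1 / 2)
    (hmiss : ¬ (dualCurtain hα r).Meets h) (hb : α b ∈ h.side ε) (hbr : r - 1 / 2 ≤ b)
    {b' : ℝ} (hb' : r ≤ b') : (dualCurtain hα b').carrier ⊆ h.side ε := by
  have hα' := hα.isClosedGeodesic_univ
  -- The curtain `h` is connected, so its projection could pass `r - 1 / 2` only by meeting the dual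
  -- curtain at `r`. Hence `h` misses the connected set projecting to `[r - 1 / 2, ∞)`.
  have hlt : ∀ z ∈ h.carrier, footParam α Set.univ z < r - 1 / 2 := by
    intro z hz
    by_contra! hle
    obtain ⟨w, hw, hw'⟩ := (h.isPreconnected_carrier hX).intermediate_value ha hz
      (hα'.continuous_footParam hX).continuousOn
      (show r - 1 / 2 ∈ _ by rw [footParam_line_apply hX hα]; exact ⟨har.le, hle⟩)
    refine hmiss ⟨w, ?_, hw⟩
    rw [mem_dualCurtain_carrier hX, hw']
    constructor <;> linarith
  have hY := h.subset_side hX (hα'.isPreconnected_preimage hX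
    (Set.ordConnected_Ici (a := r - 1 / 2))) (Set.disjoint_right.2 fun z hz hz' =>
      absurd (hlt z hz) (not_lt.2 hz')) (z := α b)
      (by rw [Set.mem_preimage, footParam_line_apply hX hα]; exact hbr) hb
  refine fun z hz => hY ?_
  rw [mem_dualCurtain_carrier hX] at hz
  rw [Set.mem_preimage, Set.mem_Ici]
  linarith [hz.1]

lemma dualCurtain_meets (hX : IsCAT0 X) (hα : IsGeodesicOn α Set.univ) (k : Curtain X)
    {a b r : ℝ} (hab : a ≤ b) (ha : α a ∈ k.carrier) (hb : α b ∈ k.carrier)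
    (har : a ≤ r + 1 / 2) (hbr : r - 1 / 2 ≤ b) : (dualCurtain hα r).Meets k := by
  obtain ⟨w, hw, hw'⟩ := (k.isPreconnected_carrier hX).intermediate_value ha hb
    (hα.isClosedGeodesic_univ.continuous_footParam hX).continuousOn
    (show max a (r - 1 / 2) ∈ _ by
      rw [footParam_line_apply hX hα, footParam_line_apply hX hα]
      exact ⟨le_max_left _ _, max_le hab hbr⟩)
  refine ⟨w, ?_, hw⟩
  rw [mem_dualCurtain_carrier hX, hw']
  exact ⟨le_max_right _ _, max_le har (by linarith)⟩

lemma exists_line_mem_carrier (hX : IsCAT0 X) (hα : IsGeodesicOn α Set.univ) (h : Curtain X)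
    {ε : Bool} {a b : ℝ} (hab : a ≤ b) (ha : α a ∈ h.side (!ε)) (hb : α b ∈ h.side ε) :
    ∃ c ∈ Set.Icc a b, α c ∈ h.carrier := by
  have hS : IsPreconnected (α '' Set.Icc a b) :=
    isPreconnected_Icc.image _ (hα.continuousOn.mono (Set.subset_univ _))
  obtain ⟨_, ⟨c, hc, rfl⟩, hc'⟩ := h.inter_carrier_nonempty hX hS
    ⟨b, ⟨hab, le_rfl⟩, rfl⟩ hb ⟨a, ⟨le_rfl, hab⟩, rfl⟩ (fun h' => h.notMem_side_not hX h' ha)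
  exact ⟨c, hc, hc'⟩

/-- Dual curtains with centres more than one apart form a chain, so `L + 1` of them cannot all meet
both `h` and `k`. -/
lemma IsLSeparated.exists_not_meets (hX : IsCAT0 X) (hα : IsGeodesicOn α Set.univ) {L : ℕ}
    {h k : Curtain X} (hs : IsLSeparated L h k) {σ : ℝ} (hσ : 1 < σ) (r : ℝ) :
    ∃ j : ℕ, j ≤ L ∧ (¬ (dualCurtain hα (r + j * σ)).Meets h ∨
      ¬ (dualCurtain hα (r + j * σ)).Meets k) := by
  by_contra! hcon
  have hor : IsOriented (fun j : Fin (L + 1) => dualCurtain hα (r + (j : ℕ) * σ)) fun _ => true :=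
    isOriented_dualCurtain hX hα fun i j hij => by
      have : ((i : ℕ) : ℝ) + 1 ≤ (j : ℕ) := by exact_mod_cast Fin.lt_def.1 hij
      nlinarith
  have := hs.2 (L + 1) _ (hor.isCurtainChain hX) fun j => hcon j (Nat.lt_succ_iff.1 j.2)
  omega

/-- One of two consecutive elements of a long `L`-chain lies behind all dual curtains far along
the line. -/
lemma exists_right_bound (hX : IsCAT0 X) (hα : IsGeodesicOn α Set.univ) {L m s : ℕ}
    {c : Fin m → Curtain X} {ε : Fin m → Bool} (hor : IsOriented c ε)
    (hsep : ∀ i j, i ≠ j → IsLSeparated L (c i) (c j)) {t₀ t₁ : ℝ} (ht : t₀ < t₁)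
    (hside : ∀ i, α t₀ ∈ (c i).side (!ε i) ∧ α t₁ ∈ (c i).side (ε i))
    (hs : L + 1 ≤ 2 * s) {p p' : Fin m} (hp : (p : ℕ) + s + 1 = m) (hp' : (p' : ℕ) = p + 1) :
    ∃ i : Fin m, (p : ℕ) ≤ i ∧ ∃ B, ∀ b, B ≤ b →
      (dualCurtain hα b).carrier ⊆ (c i).side (ε i) := by
  have hlt : p < p' := Fin.lt_def.2 (by omega)
  have hsub := hor p p' hlt
  -- If the line returns to `c p'`, the `s - 1` later curtains separate `α t₁` from both meeting
  -- points `α a` and `α b`. Hence `b - a + 1 > L`, which leaves room for `L + 1` dual curtains all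
  -- meeting `c p'`; one of them misses `c p`.
  by_cases hcase : ∃ b, t₁ < b ∧ α b ∈ (c p').carrier
  · obtain ⟨b, hb, hbk⟩ := hcase
    obtain ⟨a, ha, hak⟩ := exists_line_mem_carrier hX hα (c p') ht.le (hside p').1 (hside p').2
    have hs1 : 1 ≤ s := by omega
    have hdist : ∀ e, α e ∈ (c p').carrier → (s : ℝ) - 1 < |e - t₁| := by
      intro e he
      have hne : α e ≠ α t₁ := fun h =>
        (c p').notMem_carrier_of_mem_side hX (hside p').2 (h ▸ he)
      have := Curtain.card_lt_dist hX (n := s - 1)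
        (c := fun i : Fin (s - 1) => c ⟨p' + 1 + i, by have := i.2; omega⟩)
        (fun i j hij => (hsep _ _ (by
          rw [Ne, Fin.mk.injEq]
          have := Fin.val_ne_of_ne hij
          omega)).1) hne (fun i => by
            rw [Curtain.separates_singleton]
            refine ⟨!ε _, ?_, by rw [Bool.not_not]; exact (hside _).2⟩
            exact hor.carrier_union_side_not hX (i := p') (Fin.lt_def.2 (by simp; omega))
              (Or.inl he))
      rw [hα.dist_eq, Nat.cast_sub hs1] at this
      exact_mod_cast this
    have h1 := hdist a hak
    have h2 := hdist b hbk
    rw [abs_sub_comm, abs_of_nonneg (by linarith [ha.2])] at h1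
    rw [abs_of_nonneg (by linarith)] at h2
    have h3 : (L : ℝ) + 1 ≤ 2 * s := by exact_mod_cast hs
    obtain ⟨σ, hσ, hσL⟩ : ∃ σ : ℝ, 1 < σ ∧ L * σ ≤ b - a + 1 := by
      rcases Nat.eq_zero_or_pos L with rfl | hL
      · exact ⟨2, one_lt_two, by simp; linarith [ha.2]⟩
      · have hL' : (0 : ℝ) < L := by exact_mod_cast hL
        exact ⟨(b - a + 1) / L, (one_lt_div hL').2 (by linarith), by rw [mul_div_cancel₀ _ hL'.ne']⟩
    obtain ⟨j, hj, hmiss⟩ := (hsep p p' hlt.ne).exists_not_meets hX hα hσ (a - 1 / 2)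
    have hj0 : 0 ≤ (j : ℝ) * σ := by positivity
    have hjL : (j : ℝ) * σ ≤ L * σ := by gcongr
    set r := a - 1 / 2 + j * σ with hr
    have hmiss' : ¬ (dualCurtain hα r).Meets (c p) := hmiss.resolve_right fun h =>
      h (dualCurtain_meets hX hα (c p') (by linarith [ha.2]) hak hbk (by linarith) (by linarith))
    obtain ⟨a', ha', hah⟩ := exists_line_mem_carrier hX hα (c p) ha.1 (hside p).1
      (hsub (Or.inl hak))
    refine ⟨p, le_rfl, r, fun b' hb' => dualCurtain_subset_side hX hα (c p) hah ?_ hmiss'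
      (hsub (Or.inl hbk)) (by linarith) hb'⟩
    by_contra! hle
    refine hmiss' ⟨α a', ?_, hah⟩
    rw [mem_dualCurtain_carrier hX, footParam_line_apply hX hα]
    exact ⟨hle, by linarith [ha'.2]⟩
  -- Otherwise the line stays ahead of both curtains after `t₁`, and any dual curtain beyond `t₁`
  -- missing one of them serves.
  · push Not at hcase
    have hgood : ∀ b, t₁ < b → α b ∈ (c p').side (ε p') := by
      intro b hb
      have hS : IsPreconnected (α '' Set.Icc t₁ b) :=
        isPreconnected_Icc.image _ (hα.continuousOn.mono (Set.subset_univ _))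
      refine (c p').subset_side hX hS ?_ ⟨t₁, ⟨le_rfl, hb.le⟩, rfl⟩ (hside p').2
        ⟨b, ⟨hb.le, le_rfl⟩, rfl⟩
      refine Set.disjoint_left.2 ?_
      rintro _ ⟨u, hu, rfl⟩ hu'
      rcases hu.1.eq_or_lt with rfl | h
      · exact (c p').notMem_carrier_of_mem_side hX (hside p').2 hu'
      · exact hcase u h hu'
    obtain ⟨j, hj, hmiss⟩ := (hsep p p' hlt.ne).exists_not_meets hX hα one_lt_two (t₁ + 1)
    have hj0 : 0 ≤ (j : ℝ) * 2 := by positivity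
    have hfin : ∀ i, (α (t₁ + 1 + j * 2) ∈ (c i).side (ε i)) →
        ¬ (dualCurtain hα (t₁ + 1 + j * 2)).Meets (c i) → ∀ b, t₁ + 1 + j * 2 ≤ b →
          (dualCurtain hα b).carrier ⊆ (c i).side (ε i) := by
      intro i hi hm b hb
      obtain ⟨a, ha, hai⟩ := exists_line_mem_carrier hX hα (c i) ht.le (hside i).1 (hside i).2
      exact dualCurtain_subset_side hX hα (c i) hai (by linarith [ha.2]) hm hi (by linarith) hb
    have hmem := hgood (t₁ + 1 + j * 2) (by linarith)
    rcases hmiss with h | h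
    · exact ⟨p, le_rfl, _, hfin p (hsub (Or.inr hmem)) h⟩
    · exact ⟨p', by omega, _, hfin p' hmem h⟩

/-- Used in both directions, `exists_right_bound` gives a curtain of index at least `m - s - 1`
behind the far right and one of index at most `s` ahead of the far left. With `s = L / 2 + 1` one
has `2 s + 2 ≤ L + 4 ≤ m`, so the two are distinct and in the right order. -/
lemma exists_separated_bounds (hX : IsCAT0 X) (hα : IsGeodesicOn α Set.univ) {L m : ℕ}
    (hm : L + 4 ≤ m) {c : Fin m → Curtain X} {ε : Fin m → Bool} (hor : IsOriented c ε)
    (hsep : ∀ i j, i ≠ j → IsLSeparated L (c i) (c j)) {t₀ t₁ : ℝ} (ht : t₀ < t₁)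
    (hside : ∀ i, α t₀ ∈ (c i).side (!ε i) ∧ α t₁ ∈ (c i).side (ε i)) :
    ∃ A B, ∀ a b, a ≤ A → B ≤ b → IsLSeparated L (dualCurtain hα a) (dualCurtain hα b) := by
  set s := L / 2 + 1
  obtain ⟨i, hi, B, hB⟩ := exists_right_bound hX hα hor hsep ht hside (s := s) (by omega)
    (p := ⟨m - s - 1, by omega⟩) (p' := ⟨m - s, by omega⟩) (by simp; omega) (by simp; omega)
  obtain ⟨k, hk, A, hA⟩ := exists_right_bound hX hα.comp_neg (hor.rev hX)
    (fun i j hij => hsep _ _ (Fin.rev_injective.ne hij)) (neg_lt_neg ht)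
    (fun i => by simpa using (hside i.rev).symm) (s := s) (by omega)
    (p := ⟨m - s - 1, by omega⟩) (p' := ⟨m - s, by omega⟩) (by simp; omega) (by simp; omega)
  have hki : k.rev < i := by
    rw [Fin.lt_def, Fin.val_rev]
    have := k.2
    simp only at hi hk
    omega
  refine ⟨-A, B, fun a b ha hb => ?_⟩
  have hb' := hB b hb
  have ha' := hA (-a) (by linarith)
  rw [carrier_dualCurtain_neg hX hα, neg_neg, Function.comp_apply] at ha'
  have hbk : (dualCurtain hα b).carrier ⊆ (c k.rev).side (ε k.rev) := fun x hx =>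
    hor _ _ hki (Or.inr (hb' hx))
  have hai : (dualCurtain hα a).carrier ⊆ (c i).side (!ε i) := fun x hx =>
    hor.carrier_union_side_not hX hki (Or.inr (ha' hx))
  refine (hsep _ _ hki.ne).of_between hX ?_ ?_
  · exact Set.disjoint_left.2 fun x hx hx' => (c i).notMem_side_not hX (hb' hx') (hai hx)
  · rintro S hS ⟨z, hz, hza⟩ ⟨w, hw, hwb⟩
    exact ⟨(c k.rev).inter_carrier_nonempty hX hS hw (hbk hwb) hz
        (fun h => (c k.rev).notMem_side_not hX h (ha' hza)),
      (c i).inter_carrier_nonempty hX hS hw (hb' hwb) hz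
        (fun h => (c i).notMem_side_not hX h (hai hza))⟩

lemma exists_int_mul_mem {τ : ℝ} (hτ : τ ≠ 0) {a b : ℝ} (hab : a + |τ| ≤ b) :
    ∃ k : ℤ, a ≤ k * τ ∧ k * τ ≤ b := by
  have key : ∀ τ : ℝ, 0 < τ → a + τ ≤ b → ∃ k : ℤ, a ≤ k * τ ∧ k * τ ≤ b := by
    intro τ hτ hab
    refine ⟨⌊b / τ⌋, ?_, ?_⟩
    · have := Int.lt_floor_add_one (b / τ)
      rw [div_lt_iff₀ hτ] at this
      linarith
    · have := Int.floor_le (b / τ)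
      rwa [le_div_iff₀ hτ] at this
  obtain ⟨k, h1, h2⟩ := key |τ| (abs_pos.2 hτ) hab
  rcases abs_choice τ with h | h <;> rw [h] at h1 h2
  · exact ⟨k, h1, h2⟩
  · exact ⟨-k, by push_cast; linarith, by push_cast; linarith⟩

/-- A value of `d_L` above `L + 4` means a chain of at least `L + 4` curtains. An interval of length
`|τ|` contains a multiple of `τ`, so a power of `g` moves any two dual curtains at distance `B - A +
|τ|` or more to positions outside `(A, B)`, on either side. -/
lemma IsAxis.hasSeparatedDuals (hX : IsCAT0 X) {g : X ≃ᵢ X} (hg : IsAxis g α) {L n : ℕ} {x : X}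
    (hx : x ∈ Set.range α) (hd : L + 4 < curtainDist L x ((g ^ n) x)) :
    HasSeparatedDuals hg.1 := by
  obtain ⟨hα, τ, hτ, hgτ⟩ := id hg
  obtain ⟨t, rfl⟩ := hx
  rw [translate_pow hgτ] at hd
  have hne : α t ≠ α (t + n * τ) := fun h => by rw [← h, curtainDist_self] at hd; omega
  obtain ⟨m, c₀, hc₀, hs₀, hm⟩ := exists_isLChain_of_ne hX L hne
  obtain ⟨c, ε, hor, hsep, hside⟩ := hc₀.exists_oriented hX hs₀
  obtain ⟨A, B, hAB⟩ : ∃ A B, ∀ a b, a ≤ A → B ≤ b →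
      IsLSeparated L (dualCurtain hα a) (dualCurtain hα b) := by
    have hne' : t ≠ t + n * τ := fun h => hne (congrArg α h)
    rcases hne'.lt_or_gt with hlt | hlt
    · exact exists_separated_bounds hX hα (by omega) hor hsep hlt hside
    · exact exists_separated_bounds hX hα (by omega) (hor.rev hX)
        (fun i j hij => hsep _ _ (Fin.rev_injective.ne hij)) hlt
        (fun i => by simpa using (hside i.rev).symm)
  refine ⟨L, B - A + |τ|, fun r r' hr => ?_⟩
  obtain ⟨k, hk1, hk2⟩ := exists_int_mul_mem hτ (a := B - r') (b := A - r) (by linarith)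
  have hback := translate_zpow hgτ (-k)
  refine ((hAB (r + k * τ) (r' + k * τ) (by linarith) (by linarith)).map (g ^ (-k))).of_carrier_eq
    ?_ ?_ <;> rw [carrier_dualCurtain_translate hX hα hback] <;> congr 2 <;> push_cast <;> ring

end LongChains

/-! ### Contracting lines and sublinear projections -/

section WeaklyContracting

variable {X : Type*} [MetricSpace X] {α : ℝ → X}

/-- The first part of a geodesic leading towards a line does not drift along the line. -/
lemma abs_footParam_sub_le_of_approach (hX : IsCAT0 X) (hα : IsGeodesicOn α Set.univ) {T : ℝ}
    (hT : 0 < T) (hMM : ∀ x y, T ≤ |footParam α Set.univ x - footParam α Set.univ y| →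
      (dist x (α (footParam α Set.univ x)) + dist y (α (footParam α Set.univ y))) / 4 ≤ dist x y)
    {γ : ℝ → X} {w R : ℝ} (hw : 0 ≤ w) (hγ : IsGeodesicOn γ (Set.Icc 0 w)) (hR : 64 * T ≤ R)
    (hwR : dist (γ w) (α (footParam α Set.univ (γ w))) ≤ R)
    (hfar : ∀ u, 0 ≤ u → u < w → R ≤ dist (γ u) (α (footParam α Set.univ (γ u))))
    (hlt : w < dist (γ 0) (α (footParam α Set.univ (γ 0)))) :
    |footParam α Set.univ (γ 0) - footParam α Set.univ (γ w)| ≤ 68 * T := by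
  have hα' := hα.isClosedGeodesic_univ
  set F : X → ℝ := footParam α Set.univ with hF
  by_contra! hlarge
  have h0m : (0 : ℝ) ∈ Set.Icc 0 w := ⟨le_rfl, hw⟩
  have hwm : w ∈ Set.Icc 0 w := ⟨hw, le_rfl⟩
  have hcont : ContinuousOn (fun u => |F (γ 0) - F (γ u)|) (Set.Icc 0 w) :=
    (continuousOn_const.sub
      ((hα'.continuous_footParam hX).comp_continuousOn hγ.continuousOn)).abs
  -- At time `q` the drift is exactly `T`. Comparing `γ q` with the point at the same fraction of
  -- the leg of `γ 0` bounds the height of `γ q`, and with it the remaining time `w - q`, by `4 * f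
  -- + 4 * R`, where `f` is the total drift.
  obtain ⟨q, hq, hqT⟩ := intermediate_value_Icc hw hcont
    (show T ∈ _ by rw [sub_self, abs_zero]; exact ⟨hT.le, by linarith⟩)
  simp only at hqT
  have hqw : q < w := hq.2.lt_of_ne fun h => by rw [h] at hqT; linarith
  have hw0 : 0 < w := lt_of_le_of_lt hq.1 hqw
  have hθ0 : 0 ≤ q / w := div_nonneg hq.1 hw
  have hθ1 : q / w ≤ 1 := (div_le_one hw0).2 hq.2
  have d0q : dist (γ 0) (γ q) = q := by
    rw [hγ 0 h0m q hq, zero_sub, abs_neg, abs_of_nonneg hq.1]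
  have dqw : dist (γ q) (γ w) = w - q := by
    rw [hγ q hq w hwm, abs_sub_comm, abs_of_nonneg (by linarith)]
  have d0w : dist (γ 0) (γ w) = w := by
    rw [hγ 0 h0m w hwm, zero_sub, abs_neg, abs_of_nonneg hw]
  obtain ⟨p, hp, hp'⟩ := hX.exists_between (γ 0) (α (F (γ 0))) hθ0 hθ1
  have hFp : F p = F (γ 0) := hα'.footParam_of_between hX (by
    rw [hp, ← hF, hp']; ring)
  have h1 := hMM p (γ q) (by rw [hFp, hqT])
  have h2 := hX.dist_le_mul_of_sides hθ0 hθ1 hp hp' (z := γ w) (q := γ q)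
    (by rw [d0q, d0w]; field_simp) (by rw [dqw, d0w]; field_simp)
  have h3 : dist (α (F (γ 0))) (γ w) ≤ |F (γ 0) - F (γ w)| + R := by
    have := dist_triangle (α (F (γ 0))) (α (F (γ w))) (γ w)
    rw [hα.dist_eq, dist_comm (α (F (γ w))) (γ w)] at this
    linarith
  have h4 : q / w * dist (α (F (γ 0))) (γ w) ≤ dist (α (F (γ 0))) (γ w) :=
    mul_le_of_le_one_left dist_nonneg hθ1
  have h5 : w - q ≤ dist (γ q) (α (F (γ q))) := by
    have := hα'.dist_foot_le_add (γ 0) (γ q)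
    rw [d0q] at this
    change dist (γ 0) (α (F (γ 0))) ≤ q + dist (γ q) (α (F (γ q))) at this
    change w < dist (γ 0) (α (F (γ 0))) at hlt
    linarith
  have hR0 : 0 < R := by linarith
  -- Heights before `w` are at least `R`, so a drift above `T` takes a distance of at least `R / 4`.
  -- Since `64 * T ≤ R`, the sum of all drifts gives `f ≤ 34 * T + f / 2`.
  have h6 := abs_sub_le_of_steps (f := fun u => F (γ u)) (δ := R / 8) (D := T) hqw.le
    (by positivity) hT.le (fun u hu v hv huv => by
      by_contra! hgt
      have hu' : u ∈ Set.Icc 0 w := ⟨hq.1.trans hu.1, hu.2⟩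
      have hv' : v ∈ Set.Icc 0 w := ⟨hq.1.trans hv.1, hv.2⟩
      have := hMM (γ u) (γ v) hgt.le
      rw [hγ u hu' v hv'] at this
      have hnu : 0 ≤ dist (γ u) (α (footParam α Set.univ (γ u))) := dist_nonneg
      have hnv : 0 ≤ dist (γ v) (α (footParam α Set.univ (γ v))) := dist_nonneg
      rcases hu.2.eq_or_lt with rfl | hlt1
      · rcases hv.2.eq_or_lt with rfl | hlt2
        · simp at hgt; linarith
        · linarith [hfar v hv'.1 hlt2]
      · linarith [hfar u hu'.1 hlt1])
  have h7 := abs_sub_le (F (γ 0)) (F (γ q)) (F (γ w))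
  change _ ≤ dist p (γ q) at h1
  have hHp : 0 ≤ dist p (α (footParam α Set.univ p)) := dist_nonneg
  set f := |F (γ 0) - F (γ w)|
  set H := dist (γ q) (α (F (γ q)))
  have h8 : H ≤ 4 * f + 4 * R := by
    change (_ + H) / 4 ≤ _ at h1
    linarith
  have h9 : T * ((w - q) / (R / 8) + 1) ≤ T * ((4 * f + 4 * R) / (R / 8) + 1) := by
    gcongr; linarith
  have h10 : T * ((4 * f + 4 * R) / (R / 8) + 1) = 33 * T + 32 * (T / R) * f := by
    field_simp; ring
  have h11 : T / R ≤ 1 / 64 := by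
    rw [div_le_div_iff₀ hR0 (by norm_num)]; linarith
  have h12 : T / R * f ≤ 1 / 64 * f := by
    have : 0 ≤ f := abs_nonneg _
    gcongr
  change |F (γ q) - F (γ w)| ≤ _ at h6
  linarith

/-- A line whose projection contracts balls of radius a fixed fraction of their distance to it
is contracting. -/
lemma exists_isContractingGeodesic_of_fraction (hX : IsCAT0 X) (hα : IsGeodesicOn α Set.univ)
    {T : ℝ} (hT : 0 < T) (hMM : ∀ x y, T ≤ |footParam α Set.univ x - footParam α Set.univ y| →
      (dist x (α (footParam α Set.univ x)) + dist y (α (footParam α Set.univ y))) / 4 ≤ dist x y) :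
    ∃ D, IsContractingGeodesic D α Set.univ := by
  have hα' := hα.isClosedGeodesic_univ
  -- The drift is at most `68 * T` until the geodesic comes within `64 * T` of the line, and the
  -- length left then is at most `64 * T`. If it never comes so close, its point nearest to the line
  -- takes that role, and the rest drifts by at most `9 * T`.
  refine ⟨_, isContractingGeodesic_of_forall_dist_lt hX hα (C := 132 * T) fun x y hxy => ?_⟩
  obtain ⟨γ, hγ, h0, h1⟩ := hX.exists_segment x y
  set F : X → ℝ := footParam α Set.univ with hF
  set l := dist x y
  have hl : 0 ≤ l := dist_nonneg
  have hcont : ContinuousOn (fun u => dist (γ u) (α (F (γ u)))) (Set.Icc 0 l) :=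
    hα'.continuous_dist_foot.comp_continuousOn hγ.geodesic.continuousOn
  have hlip : ∀ u ∈ Set.Icc 0 l, dist x (α (F x)) ≤ u + dist (γ u) (α (F (γ u))) := by
    intro u hu
    have h2 := hα'.dist_foot_le_add x (γ u)
    have h3 := hγ.geodesic 0 ⟨le_rfl, hl⟩ u hu
    rw [h0, zero_sub, abs_neg, abs_of_nonneg hu.1] at h3
    rwa [h3] at h2
  have hfin : ∀ u ∈ Set.Icc 0 l, |F (γ u) - F y| ≤ l - u := by
    intro u hu
    have h2 := hα'.abs_footParam_sub_le hX (γ u) y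
    have h3 := hγ.geodesic u hu l ⟨hl, le_rfl⟩
    rw [h1, abs_sub_comm, abs_of_nonneg (by linarith [hu.2])] at h3
    rwa [h3] at h2
  by_cases hcase : ∃ u ∈ Set.Icc 0 l, dist (γ u) (α (F (γ u))) ≤ 64 * T
  · have hK : IsCompact (Set.Icc 0 l ∩ (fun u => dist (γ u) (α (F (γ u)))) ⁻¹' Set.Iic (64 * T)) :=
      isCompact_Icc.of_isClosed_subset
        (hcont.preimage_isClosed_of_isClosed isClosed_Icc isClosed_Iic) Set.inter_subset_left
    obtain ⟨w, ⟨hw, hwR⟩, hmin⟩ := hK.exists_isLeast hcase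
    have h2 := abs_footParam_sub_le_of_approach hX hα hT hMM hw.1
      (hγ.geodesic.mono (Set.Icc_subset_Icc_right hw.2)) le_rfl hwR
      (fun u hu huw => by
        by_contra! h
        exact absurd (hmin ⟨⟨hu, huw.le.trans hw.2⟩, h.le⟩) (not_le.2 huw))
      (by rw [h0]; exact hw.2.trans_lt hxy)
    rw [h0] at h2
    have h3 := hfin w hw
    have h4 := hlip w hw
    have h5 := abs_sub_le (F x) (F (γ w)) (F y)
    change dist (γ w) (α (F (γ w))) ≤ _ at hwR
    linarith
  · push Not at hcase
    obtain ⟨w, hw, hmin⟩ := isCompact_Icc.exists_isMinOn ⟨0, le_rfl, hl⟩ hcont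
    set R := dist (γ w) (α (F (γ w)))
    have hmin' : ∀ u ∈ Set.Icc 0 l, R ≤ dist (γ u) (α (F (γ u))) := fun u hu => hmin hu
    have hR := hcase w hw
    have h2 := abs_footParam_sub_le_of_approach hX hα hT hMM hw.1
      (hγ.geodesic.mono (Set.Icc_subset_Icc_right hw.2)) hR.le le_rfl
      (fun u hu huw => hmin' u ⟨hu, huw.le.trans hw.2⟩)
      (by rw [h0]; exact hw.2.trans_lt hxy)
    rw [h0] at h2
    have hR0 : 0 < R := by linarith
    have h3 := abs_sub_le_of_steps (f := fun u => F (γ u)) (δ := R / 8) (D := T) hw.2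
      (by positivity) hT.le (fun u hu v hv huv => by
        by_contra! hgt
        have hu' : u ∈ Set.Icc 0 l := ⟨hw.1.trans hu.1, hu.2⟩
        have hv' : v ∈ Set.Icc 0 l := ⟨hw.1.trans hv.1, hv.2⟩
        have := hMM (γ u) (γ v) hgt.le
        rw [hγ.geodesic u hu' v hv'] at this
        linarith [hmin' u hu', hmin' v hv'])
    have h4 := hlip w hw
    have h5 : T * ((l - w) / (R / 8) + 1) ≤ T * (R / (R / 8) + 1) := by
      gcongr; linarith
    have h6 : T * (R / (R / 8) + 1) = 9 * T := by field_simp; norm_num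
    have h7 := abs_sub_le (F x) (F (γ w)) (F y)
    simp only [h1] at h3
    linarith

/-- Linear divergence from a line implies that its projection contracts. -/
lemma add_div_four_le_dist_of_divergence (hX : IsCAT0 X) (hα : IsGeodesicOn α Set.univ) {Λ : ℝ}
    (hΛ : 0 < Λ) (hdiv : ∀ x t, dist x (α (footParam α Set.univ x)) +
      1 / 2 * (|t - footParam α Set.univ x| - Λ) ≤ dist x (α t)) (x y : X)
    (hxy : 2 * Λ ≤ |footParam α Set.univ x - footParam α Set.univ y|) :
    (dist x (α (footParam α Set.univ x)) + dist y (α (footParam α Set.univ y))) / 4 ≤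
      dist x y := by
  set a := footParam α Set.univ x
  set b := footParam α Set.univ y
  -- Since `|a - b| ≥ 2 * Λ`, each diagonal exceeds the corresponding height by at least `|a - b| /
  -- 4`; the squared heights cancel and a term linear in the heights remains.
  have h1 := hX.quadrilateral x y (α a) (α b)
  rw [hα.dist_eq] at h1
  have h2 := hdiv x b
  have h3 := hdiv y a
  rw [abs_sub_comm] at h2
  change dist x (α a) + 1 / 2 * (|a - b| - Λ) ≤ _ at h2
  change dist y (α b) + 1 / 2 * (|a - b| - Λ) ≤ _ at h3
  set T := |a - b|
  have hx := dist_nonneg (x := x) (y := α a)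
  have hy := dist_nonneg (x := y) (y := α b)
  have h4 : (dist x (α a) + T / 4) ^ 2 ≤ dist x (α b) ^ 2 := by
    gcongr; linarith
  have h5 : (dist y (α b) + T / 4) ^ 2 ≤ dist y (α a) ^ 2 := by
    gcongr; linarith
  have hT : 0 < T := by linarith
  have h6 : T * ((dist x (α a) + dist y (α b)) / 4) ≤ T * dist x y := by nlinarith
  exact le_of_mul_le_mul_left h6 hT

end WeaklyContracting

/-! ### Half-flats from linear horofunctions -/

section HalfFlat

variable {X : Type*} [MetricSpace X] {α : ℝ → X}

/-- A function on a line bounded above by its expected quadratic expression, with equality at one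
point, is equal to it. -/
lemma sq_dist_eq_of_le (hX : IsCAT0 X) {β : ℝ → X} (hβ : IsGeodesicOn β Set.univ) {Q : X}
    {A B t₀ : ℝ} (hle : ∀ t, dist Q (β t) ^ 2 ≤ (t - t₀) ^ 2 + A * (t - t₀) + B)
    (heq : dist Q (β t₀) ^ 2 = B) (t : ℝ) :
    dist Q (β t) ^ 2 = (t - t₀) ^ 2 + A * (t - t₀) + B := by
  refine le_antisymm (hle t) ?_
  -- The squared distance minus `t²` is convex; if it lies below an affine function and touches it
  -- at one point, they agree. The midpoint used is that of `t` and its reflection in `t₀`.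
  have h1 := hβ.sq_dist_le hX Q (s := t) (t := 2 * t₀ - t) (u := 1 / 2) trivial trivial
    (by norm_num) (by norm_num) trivial
  rw [show (1 - 1 / 2) * t + 1 / 2 * (2 * t₀ - t) = t₀ by ring, heq] at h1
  have h2 := hle (2 * t₀ - t)
  nlinarith

/-- A family of rays based along a line, at most as far apart as in a flat half-plane, spans a
half-flat. -/
lemma boundsHalfFlat_of_rays (hX : IsCAT0 X) (hα : IsGeodesicOn α Set.univ) {c : ℝ}
    (hc0 : 0 ≤ c) (hc1 : c < 1) {G : ℝ → ℝ → X} (hG0 : ∀ t, G t 0 = α t)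
    (hray : ∀ t s s', 0 ≤ s → 0 ≤ s' → dist (G t s) (G t s') = |s - s'|)
    (hle : ∀ t t' s s', 0 ≤ s → 0 ≤ s' → dist (G t s) (G t' s') ^ 2 ≤
      (t - t') ^ 2 - 2 * c * (t - t') * (s - s') + (s - s') ^ 2) : BoundsHalfFlat α := by
  have hrow0 : ∀ t s τ, 0 ≤ s → dist (G t s) (α τ) ^ 2 =
      (τ - t) ^ 2 + 2 * c * s * (τ - t) + s ^ 2 := by
    intro t s τ hs
    refine sq_dist_eq_of_le hX hα (fun τ => ?_) ?_ τ
    · have := hle t τ s 0 hs le_rfl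
      rw [hG0] at this
      linarith
    · rw [← hG0, hray t s 0 hs le_rfl, sub_zero, sq_abs]
  have hrow : ∀ s, 0 ≤ s → IsGeodesicOn (fun t => G t s) Set.univ := by
    intro s hs
    have key : ∀ t t', t ≤ t' → dist (G t s) (G t' s) = t' - t := by
      intro t t' htt
      apply le_antisymm
      · have := hle t t' s s hs hs
        refine abs_le_of_sq_le_sq' (by nlinarith) (by linarith) |>.2
      · refine le_of_forall_pos_le_add fun δ hδ => ?_
        -- The distant points `α (t - N)` and `α (t' + N)` are `t' - t + 2 * N` apart, while their
        -- distances to the two points of the row sum to at most `2 * N + s ^ 2 / N`. This `N` makes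
        -- the excess at most `δ`.
        set N := s + 1 + s ^ 2 / δ
        have hsN : 0 ≤ s ^ 2 / δ := by positivity
        have hN : 0 < N := by simp only [N]; linarith
        have hNs : s + 1 ≤ N := by simp only [N]; linarith
        have hNδ : s ^ 2 / N ≤ δ := by
          rw [div_le_iff₀ hN]
          have : s ^ 2 / δ * δ = s ^ 2 := by field_simp
          simp only [N]; nlinarith
        have hcs : c * s ≤ s := by nlinarith
        have hcs0 : 0 ≤ c * s := by positivity
        have e0 : s ^ 2 / (2 * N) * N = s ^ 2 / 2 := by field_simp
        have e0' : 0 ≤ s ^ 2 / (2 * N) := by positivity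
        have b1 : dist (G t s) (α (t - N)) ≤ N - c * s + s ^ 2 / (2 * N) := by
          have := hrow0 t s (t - N) hs
          refine abs_le_of_sq_le_sq' ?_ (by linarith) |>.2
          rw [this]
          nlinarith [sq_nonneg (s ^ 2 / (2 * N) - c * s)]
        have b2 : dist (G t' s) (α (t' + N)) ≤ N + c * s + s ^ 2 / (2 * N) := by
          have := hrow0 t' s (t' + N) hs
          refine abs_le_of_sq_le_sq' ?_ (by linarith) |>.2
          rw [this]
          nlinarith [sq_nonneg (s ^ 2 / (2 * N) + c * s)]
        have b3 := dist_triangle4 (α (t - N)) (G t s) (G t' s) (α (t' + N))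
        rw [hα.dist_eq, abs_sub_comm, abs_of_nonneg (by linarith), dist_comm (α (t - N))] at b3
        have e1 : s ^ 2 / (2 * N) + s ^ 2 / (2 * N) = s ^ 2 / N := by field_simp; ring
        linarith
    intro t _ t' _
    rcases le_total t t' with h | h
    · rw [key t t' h, abs_sub_comm, abs_of_nonneg (by linarith)]
    · rw [dist_comm, key t' t h, abs_of_nonneg (by linarith)]
  have hexact : ∀ t t' s s', 0 ≤ s → 0 ≤ s' → dist (G t s) (G t' s') ^ 2 =
      (t - t') ^ 2 - 2 * c * (t - t') * (s - s') + (s - s') ^ 2 := by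
    intro t t' s s' hs hs'
    have := sq_dist_eq_of_le hX (hrow s' hs') (Q := G t s) (A := 2 * c * (s - s'))
      (B := (s - s') ^ 2) (t₀ := t) (fun τ => by
        have := hle t τ s s' hs hs'
        linarith) (by rw [hray t s s' hs hs', sq_abs]) t'
    rw [this]; ring
  have hκ2 : 0 < 1 - c ^ 2 := by nlinarith
  set κ := Real.sqrt (1 - c ^ 2)
  have hκ : 0 < κ := Real.sqrt_pos.2 hκ2
  have hκsq : κ ^ 2 = 1 - c ^ 2 := Real.sq_sqrt hκ2.le
  -- `hexact` is the Euclidean metric in oblique coordinates, the rays having inner product `-c`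
  -- with the direction of `α`; here it is rewritten in orthonormal ones.
  refine ⟨fun u v => G (u + c * (v / κ)) (v / κ), fun t => by simp [hG0], ?_⟩
  intro u u' v v' hv hv'
  rw [← Real.sqrt_sq dist_nonneg (x := dist _ _),
    hexact _ _ _ _ (div_nonneg hv hκ.le) (div_nonneg hv' hκ.le)]
  congr 1
  have e : (v / κ - v' / κ) ^ 2 * (1 - c ^ 2) = (v - v') ^ 2 := by
    rw [← hκsq]; field_simp
  rw [← e]; ring

end HalfFlat

/-! ### Horofunctions on periodic lines, and contraction in the absence of half-flats. -/

section HalfFlatLimit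

open Filter Topology

variable {X : Type*} [MetricSpace X] {α : ℝ → X}

/-- A line on which a horofunction is linear of slope in `[0, 1)` bounds a half-flat. -/
lemma boundsHalfFlat_of_tendsto [ProperSpace X] (hX : IsCAT0 X) (hα : IsGeodesicOn α Set.univ)
    {c : ℝ} (hc0 : 0 ≤ c) (hc1 : c < 1) {ι : Type*} {l : Filter ι} [l.NeBot] {x : ι → X}
    (hx : Tendsto (fun i => dist (x i) (α 0)) l atTop)
    (hlin : ∀ t, Tendsto (fun i => dist (x i) (α t) - dist (x i) (α 0)) l (𝓝 (c * t))) :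
    BoundsHalfFlat α := by
  set U := Ultrafilter.of l
  have hU : (U : Filter ι) ≤ l := Ultrafilter.of_le l
  have htop : ∀ t, Tendsto (fun i => dist (x i) (α t)) U atTop := fun t => by
    have := ((hlin t).add_atTop hx).mono_left hU
    simpa using this
  choose γ hγ h0 h1 using fun i t => hX.exists_segment (α t) (x i)
  have hev : ∀ t s, ∀ᶠ i in (U : Filter ι), s ≤ dist (α t) (x i) := fun t s => by
    filter_upwards [(htop t).eventually_ge_atTop s] with i hi
    rwa [dist_comm]
  have hlim : ∀ t s, ∃ p, 0 ≤ s → Tendsto (fun i => γ i t s) U (𝓝 p) := by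
    intro t s
    by_cases hs : 0 ≤ s
    · obtain ⟨p, -, hp⟩ := (isCompact_closedBall (α t) s).ultrafilter_le_nhds
        (U.map fun i => γ i t s) (by
          rw [le_principal_iff, Ultrafilter.mem_coe, Ultrafilter.mem_map]
          filter_upwards [hev t s] with i hi
          have := (hγ i t).geodesic s ⟨hs, hi⟩ 0 ⟨le_rfl, dist_nonneg⟩
          rw [h0, sub_zero, abs_of_nonneg hs] at this
          exact this.le)
      exact ⟨p, fun _ => hp⟩
    · exact ⟨α t, fun h => absurd h hs⟩
  choose G hG using hlim
  refine boundsHalfFlat_of_rays hX hα hc0 hc1 (G := G) (fun t => ?_) ?_ ?_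
  · refine tendsto_nhds_unique (hG t 0 le_rfl) ?_
    simp only [h0]
    exact tendsto_const_nhds
  · intro t s s' hs hs'
    refine tendsto_nhds_unique ((hG t s hs).dist (hG t s' hs')) (tendsto_const_nhds.congr' ?_)
    filter_upwards [hev t s, hev t s'] with i hi hi'
    exact ((hγ i t).geodesic s ⟨hs, hi⟩ s' ⟨hs', hi'⟩).symm
  · intro t t' s s' hs hs'
    have hinv : ∀ t s, Tendsto (fun i => 1 - s / dist (x i) (α t)) U (𝓝 (1 - 0)) := fun t s =>
      tendsto_const_nhds.sub ((htop t).const_div_atTop s)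
    have hab : Tendsto (fun i => dist (x i) (α t) - dist (x i) (α t')) U (𝓝 (c * t - c * t')) := by
      have := ((hlin t).sub (hlin t')).mono_left hU
      simpa using this
    -- With `a`, `b` the distances from `x i` to `α t`, `α t'`, the comparison bound is `(a - b - (s
    -- - s'))² + (1 - s / a) (1 - s' / b) ((t - t')² - (a - b)²)`. Here `a - b` tends to `c * (t -
    -- t')` and both fractions `1 - s / a` and `1 - s' / b` tend to one.
    have hR := ((hab.sub_const (s - s')).pow 2).add
      (((hinv t s).mul (hinv t' s')).mul ((hab.pow 2).const_sub ((t - t') ^ 2)))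
    refine le_of_tendsto_of_tendsto (((hG t s hs).dist (hG t' s' hs')).pow 2)
      (hR.trans (by apply le_of_eq; congr 1; ring)) ?_
    filter_upwards [hev t s, hev t' s', (htop t).eventually_gt_atTop 0,
      (htop t').eventually_gt_atTop 0] with i hi hi' ha hb
    have side : ∀ t s, 0 ≤ s → s ≤ dist (α t) (x i) → 0 < dist (x i) (α t) →
        dist (x i) (γ i t s) = (1 - s / dist (x i) (α t)) * dist (x i) (α t) ∧
        dist (γ i t s) (α t) = (1 - (1 - s / dist (x i) (α t))) * dist (x i) (α t) := by
      intro t s hs hi ha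
      have e1 := (hγ i t).geodesic s ⟨hs, hi⟩ 0 ⟨le_rfl, dist_nonneg⟩
      have e2 := (hγ i t).geodesic _ ⟨dist_nonneg, le_rfl⟩ s ⟨hs, hi⟩
      rw [h0, sub_zero, abs_of_nonneg hs] at e1
      rw [h1, abs_of_nonneg (by linarith), dist_comm (α t)] at e2
      rw [e1, e2]
      constructor <;> field_simp
      ring
    obtain ⟨p1, p2⟩ := side t s hs hi ha
    obtain ⟨q1, q2⟩ := side t' s' hs' hi' hb
    rw [dist_comm] at hi hi'
    have := hX.sq_dist_le_of_sides (sub_nonneg.2 ((div_le_one ha).2 hi))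
      (sub_le_self _ (by positivity)) (sub_nonneg.2 ((div_le_one hb).2 hi'))
      (sub_le_self _ (by positivity)) p1 p2 q1 q2
    rw [hα.dist_eq, sq_abs] at this
    refine this.trans_eq ?_
    set a := dist (x i) (α t)
    set b := dist (x i) (α t')
    have ea : (1 - s / a) * a = a - s := by field_simp
    have eb : (1 - s' / b) * b = b - s' := by field_simp
    linear_combination ((1 - s / a) * a + a - s) * ea + ((1 - s' / b) * b + b - s') * eb
      - 2 * (1 - s / a) * a * eb - 2 * (b - s') * ea

/-- An eventually monotone convex function eventually bounded by `t / 2` has an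
asymptotic slope. -/
lemma ConvexOn.exists_asymptotic_slope {φ : ℝ → ℝ} (hφ : ConvexOn ℝ Set.univ φ) {τ : ℝ}
    (hmono : MonotoneOn φ (Set.Ici τ)) (hle : ∀ t, τ ≤ t → φ t ≤ t / 2) :
    ∃ c, 0 ≤ c ∧ c ≤ 1 / 2 ∧ ∀ s, Tendsto (fun t => φ (t + s) - φ t) atTop (𝓝 (c * s)) := by
  have hadj : ∀ {a b c d : ℝ}, a < b → b ≤ c → c < d →
      (φ b - φ a) / (b - a) ≤ (φ d - φ c) / (d - c) := by
    intro a b c d hab hbc hcd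
    rcases hbc.eq_or_lt with rfl | hbc
    · exact hφ.slope_mono_adjacent trivial trivial hab hcd
    · exact (hφ.slope_mono_adjacent trivial trivial hab hbc).trans
        (hφ.slope_mono_adjacent trivial trivial hbc hcd)
  set S : Set ℝ := {σ | ∃ a b, τ ≤ a ∧ a < b ∧ σ = (φ b - φ a) / (b - a)}
  have hS0 : ∀ σ ∈ S, 0 ≤ σ := by
    rintro _ ⟨a, b, ha, hab, rfl⟩
    exact div_nonneg (sub_nonneg.2 (hmono ha (ha.trans hab.le) hab.le)) (by linarith)
  have hS1 : ∀ σ ∈ S, σ ≤ 1 / 2 := by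
    rintro _ ⟨a, b, ha, hab, rfl⟩
    by_contra! h
    set σ := (φ b - φ a) / (b - a)
    -- A slope above one half persists by convexity and would exceed the bound `t / 2` at `b + N`.
    set N := (|b / 2 - φ b| + 1) / (σ - 1 / 2)
    have hN : 0 < N := div_pos (by positivity) (by linarith)
    have h1 : σ ≤ _ := hadj hab le_rfl (show b < b + N by linarith)
    rw [add_sub_cancel_left, le_div_iff₀ hN] at h1
    have h2 := hle (b + N) (by linarith)
    have h3 : N * (σ - 1 / 2) = |b / 2 - φ b| + 1 := div_mul_cancel₀ _ (by linarith)
    linarith [le_abs_self (b / 2 - φ b)]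
  have hSne : S.Nonempty := ⟨_, τ, τ + 1, le_rfl, by linarith, rfl⟩
  have hSb : BddAbove S := ⟨1 / 2, hS1⟩
  have hpos : ∀ s, 0 < s → Tendsto (fun t => φ (t + s) - φ t) atTop (𝓝 (sSup S * s)) := by
    intro s hs
    have hslope : Tendsto (fun t => (φ (t + s) - φ t) / s) atTop (𝓝 (sSup S)) := by
      refine tendsto_order.2 ⟨fun m hm => ?_, fun m hm => ?_⟩
      · obtain ⟨_, ⟨a, b, ha, hab, rfl⟩, hσ⟩ := exists_lt_of_lt_csSup hSne hm
        filter_upwards [eventually_ge_atTop b] with t ht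
        have := hadj hab ht (show t < t + s by linarith)
        rw [add_sub_cancel_left] at this
        exact hσ.trans_le this
      · filter_upwards [eventually_ge_atTop τ] with t ht
        refine lt_of_le_of_lt (le_csSup hSb ⟨t, t + s, ht, by linarith, ?_⟩) hm
        rw [add_sub_cancel_left]
    refine (hslope.mul_const s).congr fun t => div_mul_cancel₀ _ hs.ne'
  obtain ⟨σ, hσ⟩ := hSne
  refine ⟨sSup S, (hS0 σ hσ).trans (le_csSup hSb hσ), csSup_le ⟨σ, hσ⟩ hS1, fun s => ?_⟩
  rcases lt_trichotomy s 0 with hs | rfl | hs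
  · have := ((hpos (-s) (by linarith)).comp (tendsto_atTop_add_const_right atTop s
      tendsto_id)).neg
    simpa using this
  · simp
  · exact hpos s hs

/-- A periodic line in a proper space that does not bound a half-flat diverges linearly from the
fibres of its projection, in the positive direction. -/
lemma exists_forward_divergence [ProperSpace X] (hX : IsCAT0 X) (hα : IsGeodesicOn α Set.univ)
    (hflat : ¬ BoundsHalfFlat α) {g : X ≃ᵢ X} {τ : ℝ} (hτ : 0 < τ)
    (hg : ∀ t, g (α t) = α (t + τ)) : ∃ Λ, 0 < Λ ∧ ∀ x t, footParam α Set.univ x ≤ t →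
      dist x (α (footParam α Set.univ x)) + 1 / 2 * (t - footParam α Set.univ x - Λ) ≤
        dist x (α t) := by
  have hα' := hα.isClosedGeodesic_univ
  by_contra! hcon
  -- A failure of divergence with constant `n + 1`, translated so that the foot lies in `[0, τ]`.
  -- The parameter `t` exceeds the foot by more than `n` because the foot is the nearest point of
  -- the line.
  have hseq : ∀ n : ℕ, ∃ (y : X) (t : ℝ), 0 ≤ footParam α Set.univ y ∧
      footParam α Set.univ y ≤ τ ∧ footParam α Set.univ y + n < t ∧
      dist y (α t) ≤ dist y (α (footParam α Set.univ y)) +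
        1 / 2 * (t - footParam α Set.univ y) := by
    intro n
    obtain ⟨x, t, hxt, hlt⟩ := hcon (n + 1) (by positivity)
    have h1 := hα'.dist_foot_le x (s := t) trivial
    obtain ⟨k, hk0, hk1⟩ := exists_int_mul_mem hτ.ne' (a := -footParam α Set.univ x)
      (b := -footParam α Set.univ x + τ) (by rw [abs_of_pos hτ])
    have hz := translate_zpow hg k
    have hf := footParam_translate hX hα hz x
    refine ⟨(g ^ k) x, t + k * τ, ?_⟩
    rw [hf, ← hz, ← hz, (g ^ k).dist_eq, (g ^ k).dist_eq]
    have hn : (0 : ℝ) ≤ n := by positivity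
    refine ⟨?_, ?_, ?_, ?_⟩ <;> linarith
  choose y t hy0 hyτ hyt hy using hseq
  set f := fun n => footParam α Set.univ (y n) with hf
  have hH : ∀ n : ℕ, (n : ℝ) / 2 ≤ dist (y n) (α (f n)) := by
    intro n
    have h1 := hα'.sq_dist_ge hX (y n) (s := t n) trivial
    have h2 : dist (y n) (α (t n)) ^ 2 ≤ (dist (y n) (α (f n)) + 1 / 2 * (t n - f n)) ^ 2 := by
      gcongr; exact hy n
    have h3 : (n : ℝ) < t n - f n := by linarith [hyt n]
    change dist (y n) (α (f n)) ^ 2 + (t n - f n) ^ 2 ≤ _ at h1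
    have hn : (0 : ℝ) ≤ n := by positivity
    by_contra! h4
    nlinarith [dist_nonneg (x := y n) (y := α (f n))]
  set ψ : ℕ → ℝ → ℝ := fun n s => dist (y n) (α s) - dist (y n) (α 0) with hψ
  have hbound : ∀ n s, |ψ n s| ≤ |s| := fun n s => by
    have := abs_dist_sub_le (α s) (α 0) (y n)
    rwa [hα.dist_eq, sub_zero, dist_comm, dist_comm (α 0)] at this
  -- The limit `φ` of `ψ n` along `U` is the restriction to the line of a horofunction: convex, and
  -- on `[τ, ∞)` nondecreasing and at most `s / 2`.
  set U := hyperfilter ℕ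
  have hlim : ∀ s, ∃ p, Tendsto (fun n => ψ n s) U (𝓝 p) := by
    intro s
    obtain ⟨p, -, hp⟩ := (isCompact_Icc (a := -|s|) (b := |s|)).ultrafilter_le_nhds
      (U.map fun n => ψ n s) (by
        rw [le_principal_iff, Ultrafilter.mem_coe, Ultrafilter.mem_map]
        exact Eventually.of_forall fun n => abs_le.1 (hbound n s))
    exact ⟨p, hp⟩
  choose φ hφ using hlim
  have hUtop : (U : Filter ℕ) ≤ atTop := by
    rw [← Nat.cofinite_eq_atTop]; exact hyperfilter_le_cofinite
  have hconv : ConvexOn ℝ Set.univ φ := by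
    refine ⟨convex_univ, fun s _ s' _ a b ha hb hab => ?_⟩
    refine le_of_tendsto_of_tendsto (hφ _) (((hφ s).const_mul a).add ((hφ s').const_mul b))
      (Eventually.of_forall fun n => ?_)
    have := hα.dist_le_convexComb hX (y n) (s := s) (t := s') (u := b) trivial trivial hb
      (by linarith) trivial
    rw [show 1 - b = a by linarith] at this
    simp only [hψ, smul_eq_mul]
    have e : a * dist (y n) (α 0) + b * dist (y n) (α 0) = dist (y n) (α 0) := by
      rw [← add_mul, hab, one_mul]
    linarith
  have hmono : MonotoneOn φ (Set.Ici τ) := by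
    intro s hs s' hs' hss
    refine le_of_tendsto_of_tendsto (hφ s) (hφ s') (Eventually.of_forall fun n => ?_)
    simp only [hψ]
    gcongr 1
    have hfs : f n ≤ s := (hyτ n).trans hs
    rcases hss.eq_or_lt with rfl | hss
    · rfl
    have hpos : 0 < s' - f n := by linarith
    have hu0 : 0 ≤ (s - f n) / (s' - f n) := div_nonneg (by linarith) hpos.le
    have hu1 : (s - f n) / (s' - f n) ≤ 1 := (div_le_one hpos).2 (by linarith)
    have h1 := hα.dist_le_convexComb hX (y n) (s := f n) (t := s') trivial trivial hu0 hu1 trivial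
    rw [show (1 - (s - f n) / (s' - f n)) * f n + (s - f n) / (s' - f n) * s' = s by
      field_simp; ring] at h1
    have h2 := hα'.dist_foot_le (y n) (s := s') trivial
    change dist (y n) (α (f n)) ≤ _ at h2
    have h3 := mul_le_mul_of_nonneg_left h2 (sub_nonneg.2 hu1)
    linarith
  have hhalf : ∀ s, τ ≤ s → φ s ≤ s / 2 := by
    intro s hs
    refine le_of_tendsto (hφ s) ?_
    obtain ⟨N, hN⟩ := exists_nat_ge s
    filter_upwards [hUtop (eventually_ge_atTop N)] with n hn
    have hst : s ≤ t n := by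
      have := hyt n
      have := hy0 n
      have : (N : ℝ) ≤ n := by exact_mod_cast hn
      linarith
    have hfs : f n ≤ s := (hyτ n).trans hs
    have hpos : 0 < t n - f n := by
      have : (0 : ℝ) ≤ n := by positivity
      linarith [hyt n]
    have hu0 : 0 ≤ (s - f n) / (t n - f n) := div_nonneg (by linarith) hpos.le
    have hu1 : (s - f n) / (t n - f n) ≤ 1 := (div_le_one hpos).2 (by linarith)
    have h1 := hα.dist_le_convexComb hX (y n) (s := f n) (t := t n) trivial trivial hu0 hu1 trivial
    rw [show (1 - (s - f n) / (t n - f n)) * f n + (s - f n) / (t n - f n) * t n = s by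
      field_simp; ring] at h1
    have h2 := mul_le_mul_of_nonneg_left (hy n) hu0
    have h3 : (s - f n) / (t n - f n) * (1 / 2 * (t n - f n)) = 1 / 2 * (s - f n) := by
      field_simp
    have h4 := hα'.dist_foot_le (y n) (s := 0) trivial
    have h5 := hy0 n
    change dist (y n) (α (f n)) ≤ _ at h4
    change (0 : ℝ) ≤ f n at h5
    rw [mul_add] at h2
    change _ ≤ _ * dist (y n) (α (f n)) + (s - f n) / (t n - f n) * (1 / 2 * (t n - f n)) at h2
    simp only [hψ]
    linarith
  obtain ⟨c, hc0, hc1, hc⟩ := hconv.exists_asymptotic_slope hmono hhalf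
  -- Translating by `g ^ (-k)` replaces `φ` by `s ↦ φ (s + k τ) - φ (k τ)`, which tends to `c * s`.
  -- The iterated limit, in `n` along `U` and then in `k`, is a single limit along the curried
  -- filter, so no diagonal sequence is needed.
  have hne : (Filter.curry (atTop : Filter ℕ) (U : Filter ℕ)).NeBot := by
    rw [neBot_iff]
    intro h
    have : (∅ : Set (ℕ × ℕ)) ∈ Filter.curry (atTop : Filter ℕ) (U : Filter ℕ) := by rw [h]; trivial
    rw [mem_curry_iff] at this
    obtain ⟨k, hk⟩ := this.exists
    exact U.neBot.ne (empty_mem_iff_bot.1 hk)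
  have hd : ∀ (k n : ℕ) s, dist (((g ^ k)⁻¹) (y n)) (α s) = dist (y n) (α (s + k * τ)) := by
    intro k n s
    rw [← translate_pow hg, ← (g ^ k).dist_eq]
    congr 1
    exact (g ^ k).apply_symm_apply _
  refine hflat (boundsHalfFlat_of_tendsto hX hα hc0 (by linarith)
    (l := Filter.curry (atTop : Filter ℕ) (U : Filter ℕ))
    (x := fun p => ((g ^ p.1)⁻¹) (y p.2)) ?_ fun s => ?_)
  · simp only [hd]
    refine tendsto_atTop.2 fun B => eventually_curry_iff.2 (Eventually.of_forall fun k => ?_)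
    obtain ⟨N, hN⟩ := exists_nat_ge (2 * B)
    filter_upwards [hUtop (eventually_ge_atTop N)] with n hn
    have h1 := hα'.dist_foot_le (y n) (s := 0 + k * τ) trivial
    have h2 := hH n
    have : (N : ℝ) ≤ n := by exact_mod_cast hn
    change dist (y n) (α (f n)) ≤ _ at h1
    linarith
  · simp only [hd]
    have hk : Tendsto (fun k : ℕ => (k : ℝ) * τ) atTop atTop :=
      tendsto_natCast_atTop_atTop.atTop_mul_const hτ
    refine tendsto_nhds.2 fun V hV hm => eventually_curry_iff.2 ?_
    filter_upwards [((hc s).comp hk).eventually (hV.mem_nhds hm)] with k hk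
    have h1 := (hφ (k * τ + s)).sub (hφ (k * τ))
    filter_upwards [h1.eventually (hV.mem_nhds hk)] with n hn
    simp only [hψ, sub_sub_sub_cancel_right] at hn
    rwa [zero_add, add_comm s]

lemma BoundsHalfFlat.of_comp_neg (h : BoundsHalfFlat fun t => α (-t)) : BoundsHalfFlat α := by
  obtain ⟨F, h0, hF⟩ := h
  refine ⟨fun t s => F (-t) s, fun t => by simp [h0], fun t t' s s' hs hs' => ?_⟩
  rw [hF _ _ _ _ hs hs']
  ring_nf

lemma IsAxis.exists_isContractingGeodesic [ProperSpace X] (hX : IsCAT0 X) {g : X ≃ᵢ X}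
    (hα : IsAxis g α) (hflat : ¬ BoundsHalfFlat α) : ∃ D, IsContractingGeodesic D α Set.univ := by
  obtain ⟨hα, τ, hτ, hg⟩ := hα
  obtain ⟨g, τ, hτ, hg⟩ : ∃ (g : X ≃ᵢ X) (τ : ℝ), 0 < τ ∧ ∀ t, g (α t) = α (t + τ) := by
    rcases hτ.lt_or_gt with h | h
    · exact ⟨g⁻¹, -τ, by linarith, translate_inv hg⟩
    · exact ⟨g, τ, h, hg⟩
  obtain ⟨Λ₁, h₁, hdiv₁⟩ := exists_forward_divergence hX hα hflat hτ hg
  obtain ⟨Λ₂, h₂, hdiv₂⟩ := exists_forward_divergence hX hα.comp_neg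
    (fun h => hflat h.of_comp_neg) (g := g⁻¹) hτ (fun t => by
      rw [translate_inv hg]; congr 1; ring)
  have hdiv : ∀ x t, dist x (α (footParam α Set.univ x)) +
      1 / 2 * (|t - footParam α Set.univ x| - (Λ₁ + Λ₂)) ≤ dist x (α t) := by
    intro x t
    rcases le_total (footParam α Set.univ x) t with h | h
    · have := hdiv₁ x t h
      rw [abs_of_nonneg (by linarith)]
      linarith
    · have := hdiv₂ x (-t) (by rw [footParam_comp_neg hX hα]; linarith)
      rw [footParam_comp_neg hX hα, neg_neg, neg_neg] at this
      rw [abs_of_nonpos (by linarith)]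
      linarith
  exact exists_isContractingGeodesic_of_fraction hX hα (T := 2 * (Λ₁ + Λ₂)) (by linarith)
    (add_div_four_le_dist_of_divergence hX hα (by linarith) hdiv)

end HalfFlatLimit

/-- A contracting axis does not bound a half-flat. -/
lemma IsContractingGeodesic.not_boundsHalfFlat {X : Type*} [MetricSpace X] {α : ℝ → X} {D : ℝ}
    (hc : IsContractingGeodesic D α Set.univ) : ¬ BoundsHalfFlat α := by
  rintro ⟨F, hF0, hF⟩
  -- The ball of radius `R` about the point at height `R` over `α 0` misses the line and contains
  -- the point at height `R` over `α (R - 1 / 2)`; the feet are `|D| + 1 / 2` apart.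
  set R := |D| + 1
  have hR : 0 < R := by positivity
  have hfoot : ∀ t, IsFoot α Set.univ (F t R) t := fun t => ⟨trivial, fun s _ => by
    rw [← hF0, ← hF0, hF _ _ _ _ hR.le le_rfl, hF _ _ _ _ hR.le le_rfl]
    exact Real.sqrt_le_sqrt (by nlinarith [sq_nonneg (t - s)])⟩
  have hdist : ∀ t t', dist (F t R) (F t' R) = |t - t'| := fun t t' => by
    rw [hF _ _ _ _ hR.le hR.le, sub_self, zero_pow two_ne_zero, add_zero, Real.sqrt_sq_eq_abs]
  have hα : dist (α 0) (α (R - 1 / 2)) = |0 - (R - 1 / 2)| := by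
    rw [← hF0, ← hF0, hF _ _ _ _ le_rfl le_rfl, sub_self, zero_pow two_ne_zero, add_zero,
      Real.sqrt_sq_eq_abs]
  have h := hc (F 0 R) R (Set.disjoint_left.2 (by
    rintro _ hz ⟨s, -, rfl⟩
    rw [Metric.mem_ball, ← hF0, hF _ _ _ _ le_rfl hR.le] at hz
    have : R ≤ Real.sqrt ((s - 0) ^ 2 + (0 - R) ^ 2) :=
      Real.le_sqrt_of_sq_le (by nlinarith [sq_nonneg (s - 0)])
    linarith)) (F 0 R) (Metric.mem_ball_self hR) (F (R - 1 / 2) R) (by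
      rw [Metric.mem_ball, hdist, sub_zero, abs_of_nonneg (by simp only [R]; linarith [abs_nonneg D])]
      linarith) _ _ (hfoot _) (hfoot _)
  rw [hα, zero_sub, abs_neg, abs_of_nonneg (by simp only [R]; linarith [abs_nonneg D])] at h
  have := le_abs_self D
  simp only [R] at h
  linarith

/-! ### The equivalences. -/

lemma IsRankOneIsometry.isContractingIsometry {X : Type*} [MetricSpace X] [ProperSpace X]
    (hX : IsCAT0 X) {g : X ≃ᵢ X} (hg : IsRankOneIsometry g) : IsContractingIsometry g := by
  obtain ⟨hyp, α, hα, hflat⟩ := hg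
  exact ⟨hyp, α, hα, hα.exists_isContractingGeodesic hX hflat⟩

theorem mainTheorem2 {X : Type*} [MetricSpace X] (hX : IsCAT0 X)
    (g : X ≃ᵢ X) (hg : IsSemisimpleIsometry g) :
    List.TFAE
      [ IsContractingIsometry g,
        ∃ L : ℕ, ActsLoxodromically L g,
        IsHyperbolicIsometry g ∧ ∃ (L n : ℕ) (α : ℝ → X) (x : X),
          IsAxis g α ∧ x ∈ Set.range α ∧ L + 4 < curtainDist L x ((g ^ n) x),
        ∃ h₁ h₂ : Curtain X, (∃ L : ℕ, IsLSeparated L h₁ h₂) ∧ Skewers g h₁ h₂ ] ∧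
    (ProperSpace X → (IsContractingIsometry g ↔ IsRankOneIsometry g)) := by
  constructor
  · tfae_have 1 → 4 := by
      rintro ⟨-, α, hα, D, hD⟩
      exact (hD.hasSeparatedDuals hX hα.1).exists_skewers hX hα
    tfae_have 4 → 2 := by
      rintro ⟨h₁, h₂, ⟨L, hs⟩, hsk⟩
      exact ⟨L, hsk.actsLoxodromically hX hs⟩
    tfae_have 2 → 3 := by
      rintro ⟨L, hL⟩
      obtain ⟨hyp, n, α, x, h⟩ := hL.exists_isAxis hX hg
      exact ⟨hyp, L, n, α, x, h⟩
    tfae_have 3 → 1 := by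
      rintro ⟨hyp, L, n, α, x, hα, hx, hd⟩
      exact ⟨hyp, α, hα, (hα.hasSeparatedDuals hX hx hd).isContractingGeodesic hX⟩
    tfae_finish
  · intro _
    exact ⟨fun ⟨hyp, α, hα, D, hD⟩ => ⟨hyp, α, hα, hD.not_boundsHalfFlat⟩,
      fun h => h.isContractingIsometry hX⟩
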